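/- Let $a$ be a fourth-power-free integer (so $a\neq 0$), let $E_a$ be the elliptic curve $y^2=x^3+ax$, and let $P\in E_a(\mathbb Q)$ be a point of infinite order. For $n\ge 1$ write $x(nP)=A_n/B_n$ with $\gcd(A_n,B_n)=1$ and $B_n>0$. We say that $B_n$ has a primitive divisor if some prime divides $B_n$ but does not divide $B_1B_2\cdots B_{n-1}$. For coprime integers $u,v$ put $h(u/v)=\log\max\{|u|,|v|\}$; for $Q\in E_a(\mathbb Q)\setminus\{O\}$ put $h(Q)=h(x(Q))$, and put $h(O)=0$. Let $\hat h(P)=\frac12\lim_{N\to\infty}4^{-N}h(2^NP)$ be the canonical height. Let $$C=0.26+\tfrac14\log|a|,\qquad \rho(n)=\sum_{p\mid n}\frac1{p^2},$$ where the sum is over the primes dividing $n$, and let $\omega(n)$ be the number of distinct primes dividing $n$. Let $\phi_k,\psi_k^2\in\mathbb Z[x]$ be the division polynomials of $E_a$, so that $x(kQ)=\phi_k(x(Q))/\psi_k^2(x(Q))$, with $\deg\phi_k=k^2$ and $\deg\psi_k^2=k^2-1$. Let $\phi_k(u,v)$ and $\psi_k^2(u,v)$ denote their homogenizations, of degrees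 $k^2$ and $k^2-1$. For $k\ge2$ let $$K_k=\min_{T_1\ne\pm T_2}\left\{|x(T_1)-x(T_2)|,\ |x(T_1)^{-1}-x(T_2)^{-1}|\right\},$$ where $T_1,T_2$ run over the nonzero $k$-torsion points of $E_1:y^2=x^3+x$ over $\mathbb C$, and the second quantity is considered only when $x(T_1)x(T_2)\neq0$. Fix $k\ge 2$ such that $\psi_k^2=fg$, where $f,g\in\mathbb Z[x]$ are coprime as polynomials over $\mathbb Q$ (that is, they have no common complex root), and let $d=\min\{\deg f,\deg g\}$. For $m\ge1$ let $$g_k=\gcd\big(\phi_k(A_m,B_m),\psi_k^2(A_m,B_m)\big),$$ $$N(m)=\log|g_k|-d\log\Big(\frac{K_k|a|^{-1/2}}2\Big)+2dC+2\log(mk)+2C\,\omega(mk).$$ 1. Let $m\ge1$. If $B_{mk}$ has no primitive divisor, $d>k^2\rho(mk)$, and $$2m^2\ \ge\ \frac{-\log\big(K_k|a|^{-1/2}/2\big)+2C}{\hat h(P)},$$ then $$2(mk)^2\ \le\ \frac{N(m)}{\Big(\dfrac{d}{k^2}-\rho(mk)\Big)\hat h(P)}.$$ 2. With $a,P,k,f,g$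 fixed, $N(m)=O(\log m)$ as $m\to\infty$. 3. There is an $M$, depending on $a,P,k,f,g$, such that for every $m\ge M$ with $d>k^2\rho(mk)$ the term $B_{mk}$ has a primitive divisor. -/

import Mathlib

namespace EllDiv

open Polynomial Filter

/-- `a` is fourth-power-free: the only fourth powers dividing it are those of units
(in particular `a ≠ 0`). -/
def FourthPowerFree (a : ℤ) : Prop := ∀ b : ℤ, b ^ 4 ∣ a → IsUnit b

/-- The curve `E_a : y² = x³ + a x`. -/
def curve {R : Type*} [CommRing R] (a : R) : WeierstrassCurve R := ⟨0, 0, 0, a, 0⟩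

/-- The affine `x`-coordinate of a point; the point at infinity gets the placeholder value `0`. -/
def xCoord {R : Type*} [CommRing R] {W : WeierstrassCurve R} :
    W.toAffine.Point → R
  | .zero => 0
  | .some x _ _ => x

/-- The numerator `A_n` of `x(nP)` in lowest terms. -/
noncomputable def A {a : ℤ} (P : (curve (a : ℚ)).toAffine.Point) (n : ℕ) : ℤ :=
  (xCoord (n • P)).num

/-- The denominator `B_n > 0` of `x(nP)` in lowest terms. -/
noncomputable def B {a : ℤ} (P : (curve (a : ℚ)).toAffine.Point) (n : ℕ) : ℕ :=
  (xCoord (n • P)).den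

/-- The `n`-th term of `x₁, x₂, …` has a primitive divisor. -/
def HasPrimitiveDivisor (x : ℕ → ℕ) (n : ℕ) : Prop :=
  ∃ p : ℕ, p.Prime ∧ p ∣ x n ∧ ¬ p ∣ ∏ i ∈ Finset.Ico 1 n, x i

/-- The logarithmic height `h(P) = h(x(P))`, where `h(u/v) = log max(|u|, |v|)` for coprime
`u, v` (`Rat.logHeight₁_eq_log_max`), and `h(O) = 0`. -/
noncomputable def naiveHeight {a : ℤ} (P : (curve (a : ℚ)).toAffine.Point) : ℝ :=
  Height.logHeight₁ (xCoord P)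

/-- The canonical height `ĥ(P) = (1/2) lim 4^{-N} h(2^N P)`. -/
noncomputable def canonicalHeight {a : ℤ} (P : (curve (a : ℚ)).toAffine.Point) : ℝ :=
  (1 / 2) * limUnder atTop (fun N : ℕ => naiveHeight (2 ^ N • P) / 4 ^ N)

/-- The height-difference constant `C = 0.26 + (log |a|)/4`. -/
noncomputable def heightConst (a : ℤ) : ℝ := 0.26 + Real.log |(a : ℝ)| / 4

/-- `ρ(n) = ∑_{p ∣ n} 1/p²`, the sum over the prime divisors of `n`. -/
noncomputable def rho (n : ℕ) : ℝ := ∑ p ∈ n.primeFactors, 1 / (p : ℝ) ^ 2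

/-- `K_k`: the minimum of `|x(T₁) - x(T₂)|` and (where `x(T₁) x(T₂) ≠ 0`) of
`|x(T₁)⁻¹ - x(T₂)⁻¹|`, over pairs of nonzero `k`-torsion points `T₁ ≠ ±T₂` of
`E_1 : y² = x³ + x` over `ℂ` (all such points are algebraic). -/
noncomputable def rootSep (k : ℕ) : ℝ :=
  sInf {r : ℝ | ∃ T₁ T₂ : (curve (1 : ℂ)).toAffine.Point,
    T₁ ≠ 0 ∧ T₂ ≠ 0 ∧ k • T₁ = 0 ∧ k • T₂ = 0 ∧ T₁ ≠ T₂ ∧ T₁ ≠ -T₂ ∧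
    (r = ‖xCoord T₁ - xCoord T₂‖ ∨
      (xCoord T₁ * xCoord T₂ ≠ 0 ∧ r = ‖(xCoord T₁)⁻¹ - (xCoord T₂)⁻¹‖))}

/-- `K_k |a|^{-1/2} / 2`. -/
noncomputable def halfSep (a : ℤ) (k : ℕ) : ℝ :=
  rootSep k * |(a : ℝ)| ^ (-(1 / 2) : ℝ) / 2

/-- The homogenization of `p` (of degree `deg p`) evaluated at `(u, v)`. -/
noncomputable def homEval (p : ℤ[X]) (u v : ℤ) : ℤ :=
  MvPolynomial.eval ![u, v] (p.homogenize p.natDegree)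

/-- `g_k = gcd(φ_k(A_m, B_m), ψ_k²(A_m, B_m))`; Mathlib's `Φ` and `ΨSq` are the
univariate division polynomials `φ_k` and `ψ_k²`. -/
noncomputable def gk {a : ℤ} (P : (curve (a : ℚ)).toAffine.Point) (k m : ℕ) : ℕ :=
  Int.gcd (homEval ((curve a).Φ k) (A P m) (B P m)) (homEval ((curve a).ΨSq k) (A P m) (B P m))

/-- `log |g_k| - d log (K_k |a|^{-1/2} / 2) + 2 d C + 2 log (mk) + 2 C ω(mk)`. -/
noncomputable def boundNumerator {a : ℤ} (P : (curve (a : ℚ)).toAffine.Point) (d k m : ℕ) : ℝ :=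
  Real.log (gk P k m) - d * Real.log (halfSep a k) + 2 * d * heightConst a
    + 2 * Real.log ((m : ℝ) * k)
    + 2 * heightConst a * (ArithmeticFunction.cardDistinctFactors (m * k) : ℝ)

end EllDiv

open EllDiv Polynomial Filter

/-! Two estimates for log B_{mk} collide. Write s = `halfSep a k` and let H be the multiplicative
height of mP.

Lower bound. One has g_k B_{mk} = B_m |ψ_k²(A_m, B_m)| (`gk_mul`). Since ψ_k² = fg and the roots of
f stay away from those of g, the number A_m/B_m, or its inverse when that is the smaller one, cannot
be near a root of f and near a root of g at once. One of f, g therefore has size at least (sH)^deg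
there, and the other is a nonzero integer. Hence log g_k + log B_{mk} ≥ d(2m²ĥ(P) + log s − 2C)
(`far_or_far`, `le_log_gk_add_log_B`).

Upper bound. A prime dividing B_i and B_j divides B_{gcd(i,j)}, and once l divides B_m, passing from
m to ms raises the l-adic valuation by at most that of s². Without a primitive divisor, B_n thus
divides n² ∏_{p ∣ n} B_{n/p}, so log B_n ≤ 2 log n + 2n²ρ(n)ĥ(P) + 2Cω(n). Comparison at n = mk is
claim 1.

Both bounds use |h(nP) − 2n²ĥ(P)| ≤ 2C. The constant C comes from doubling: a size function that at
most quadruples in logarithm gives one side. The other side needs the cancellation in successive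
doublings, which divides 2a, then 4, then 1 when a is fourth-power-free (`sizeTwo_doubles`).

Claim 2 holds because log g_k is bounded: φ_k and ψ_k² have size at most a constant times H^{k²},
while h(mkP) and k²h(mP) differ by a bounded amount. For claim 3 the difficulty is that d/k² − ρ(mk)
might tend to 0. By `exists_gap` this happens only if m has two distinct prime factors p, q below a
fixed bound. Then B_n B_{n/(pq)} still divides n² ∏ B_{n/p}, and the extra factor supplies a term of
order m² that the gap no longer provides.

The multiplication formula is proved by induction for points of infinite order. Having infinitely
many such points turns it into polynomial identities, which then identify the roots of ψ_k² over ℂ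
with torsion points. -/

open EllDiv Polynomial Filter

namespace EllDiv

/-! ### Addition and doubling formulas on y² = x³ + cx -/

section GroupLaw

variable {F : Type*} [Field F] {c : F}

theorem curve_equation_iff (x y : F) :
    (curve c).toAffine.Equation x y ↔ y ^ 2 = x ^ 3 + c * x := by
  simp [WeierstrassCurve.Affine.equation_iff, curve]

theorem curve_negY (x y : F) : (curve c).toAffine.negY x y = -y := by
  simp [WeierstrassCurve.Affine.negY, curve]

/-- The affine `y`-coordinate of a point, with value `0` at infinity. -/
def yCoord {R : Type*} [CommRing R] {W : WeierstrassCurve R} : W.toAffine.Point → R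
  | .zero => 0
  | .some _ y _ => y

theorem equation_coords {P : (curve c).toAffine.Point} (hP : P ≠ 0) :
    yCoord P ^ 2 = xCoord P ^ 3 + c * xCoord P := by
  rcases P with _ | ⟨x, y, h⟩
  · exact absurd rfl hP
  · exact (curve_equation_iff x y).1 h.1

theorem equation_coords' (P : (curve c).toAffine.Point) :
    yCoord P ^ 2 = xCoord P ^ 3 + c * xCoord P := by
  rcases P with _ | ⟨x, y, h⟩
  · simp [xCoord, yCoord]
  · exact (curve_equation_iff x y).1 h.1

theorem xCoord_neg (P : (curve c).toAffine.Point) : xCoord (-P) = xCoord P := by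
  rcases P with _ | ⟨x, y, h⟩ <;> rfl

theorem yCoord_neg (P : (curve c).toAffine.Point) : yCoord (-P) = -yCoord P := by
  rcases P with _ | ⟨x, y, h⟩
  · exact neg_zero.symm
  · exact curve_negY x y

theorem point_ext {P Q : (curve c).toAffine.Point} (hP : P ≠ 0) (hQ : Q ≠ 0)
    (hx : xCoord P = xCoord Q) (hy : yCoord P = yCoord Q) : P = Q := by
  rcases P with _ | ⟨x, y, h⟩
  · exact absurd rfl hP
  rcases Q with _ | ⟨x', y', h'⟩
  · exact absurd rfl hQ
  simp only [xCoord, yCoord] at hx hy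
  subst hx hy
  rfl

theorem xCoord_eq_iff {P Q : (curve c).toAffine.Point} (hP : P ≠ 0) (hQ : Q ≠ 0) :
    xCoord P = xCoord Q ↔ P = Q ∨ P = -Q := by
  rcases P with _ | ⟨x, y, h⟩
  · exact absurd rfl hP
  rcases Q with _ | ⟨x', y', h'⟩
  · exact absurd rfl hQ
  exact WeierstrassCurve.Affine.Point.X_eq_iff

variable [DecidableEq F]

theorem add_coords {P Q : (curve c).toAffine.Point} (hP : P ≠ 0) (hQ : Q ≠ 0)
    (h : xCoord P ≠ xCoord Q) :
    P + Q ≠ 0 ∧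
      xCoord (P + Q) =
        ((yCoord P - yCoord Q) / (xCoord P - xCoord Q)) ^ 2 - xCoord P - xCoord Q ∧
      yCoord (P + Q) = -((yCoord P - yCoord Q) / (xCoord P - xCoord Q) *
        (xCoord (P + Q) - xCoord P) + yCoord P) := by
  rcases P with _ | ⟨x, y, hp⟩
  · exact absurd rfl hP
  rcases Q with _ | ⟨x', y', hq⟩
  · exact absurd rfl hQ
  simp only [xCoord] at h
  rw [WeierstrassCurve.Affine.Point.add_of_X_ne h]
  refine ⟨WeierstrassCurve.Affine.Point.some_ne_zero _, ?_, ?_⟩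
  · simp only [xCoord, yCoord, WeierstrassCurve.Affine.addX,
      WeierstrassCurve.Affine.slope_of_X_ne h]
    simp [curve]
  · simp only [xCoord, yCoord, WeierstrassCurve.Affine.addY, WeierstrassCurve.Affine.negAddY,
      WeierstrassCurve.Affine.slope_of_X_ne h, curve_negY]

theorem sub_coords {P Q : (curve c).toAffine.Point} (hP : P ≠ 0) (hQ : Q ≠ 0)
    (h : xCoord P ≠ xCoord Q) :
    P - Q ≠ 0 ∧
      xCoord (P - Q) =
        ((yCoord P + yCoord Q) / (xCoord P - xCoord Q)) ^ 2 - xCoord P - xCoord Q := by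
  have := add_coords hP (neg_ne_zero.2 hQ) (by rwa [xCoord_neg])
  rw [xCoord_neg, yCoord_neg, ← sub_eq_add_neg, sub_neg_eq_add] at this
  exact ⟨this.1, this.2.1⟩

/-- The numbers x(P ± Q) are the roots of a quadratic whose coefficients depend only on x(P), x(Q).
Its sum and product relations drive the torsion criterion, the parallelogram law and the
divisibility of the B_n. -/
theorem sq_mul_xCoord_add_add_xCoord_sub {P Q : (curve c).toAffine.Point} (hP : P ≠ 0)
    (hQ : Q ≠ 0) (h : xCoord P ≠ xCoord Q) :
    (xCoord P - xCoord Q) ^ 2 * (xCoord (P + Q) + xCoord (P - Q)) =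
      2 * (xCoord P + xCoord Q) * (c + xCoord P * xCoord Q) := by
  rw [(add_coords hP hQ h).2.1, (sub_coords hP hQ h).2]
  have h1 := equation_coords hP
  have h2 := equation_coords hQ
  have h3 := sub_ne_zero.2 h
  field_simp
  linear_combination 2 * h1 + 2 * h2

theorem sq_mul_xCoord_add_mul_xCoord_sub {P Q : (curve c).toAffine.Point} (hP : P ≠ 0)
    (hQ : Q ≠ 0) (h : xCoord P ≠ xCoord Q) :
    (xCoord P - xCoord Q) ^ 2 * (xCoord (P + Q) * xCoord (P - Q)) =
      (xCoord P * xCoord Q - c) ^ 2 := by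
  rw [(add_coords hP hQ h).2.1, (sub_coords hP hQ h).2]
  have h1 := equation_coords hP
  have h2 := equation_coords hQ
  have h3 := sub_ne_zero.2 h
  have e1 : (yCoord P - yCoord Q) * (yCoord P + yCoord Q) =
      xCoord P ^ 3 + c * xCoord P - (xCoord Q ^ 3 + c * xCoord Q) := by
    linear_combination h1 - h2
  have e2 : (yCoord P - yCoord Q) ^ 2 + (yCoord P + yCoord Q) ^ 2 =
      2 * (xCoord P ^ 3 + c * xCoord P + (xCoord Q ^ 3 + c * xCoord Q)) := by
    linear_combination 2 * h1 + 2 * h2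
  generalize yCoord P - yCoord Q = s at *
  generalize yCoord P + yCoord Q = t at *
  generalize xCoord P = x at *
  generalize xCoord Q = z at *
  field_simp
  linear_combination (s * t + (x ^ 3 + c * x - (z ^ 3 + c * z))) * e1 -
    (x - z) ^ 2 * (x + z) * e2

/-- The odd counterpart: the difference of the two roots sees the y-coordinates, which links ψ_{2m}
to y(mP). -/
theorem sq_mul_xCoord_sub_sub_xCoord_add {P Q : (curve c).toAffine.Point} (hP : P ≠ 0)
    (hQ : Q ≠ 0) (h : xCoord P ≠ xCoord Q) :
    (xCoord P - xCoord Q) ^ 2 * (xCoord (P - Q) - xCoord (P + Q)) =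
      4 * yCoord P * yCoord Q := by
  rw [(add_coords hP hQ h).2.1, (sub_coords hP hQ h).2]
  have h3 := sub_ne_zero.2 h
  field_simp
  ring

theorem two_nsmul_eq_zero_iff [NeZero (2 : F)] {P : (curve c).toAffine.Point} (hP : P ≠ 0) :
    2 • P = 0 ↔ yCoord P = 0 := by
  rw [two_nsmul, add_eq_zero_iff_eq_neg]
  constructor
  · intro h
    have := congrArg yCoord h
    rw [yCoord_neg] at this
    have h2 : (2 : F) * yCoord P = 0 := by linear_combination this
    exact (mul_eq_zero.1 h2).resolve_left two_ne_zero
  · intro h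
    refine point_ext hP (neg_ne_zero.2 hP) (xCoord_neg P).symm ?_
    rw [yCoord_neg, h, neg_zero]

theorem double_coords [NeZero (2 : F)] {P : (curve c).toAffine.Point} (hP : P ≠ 0)
    (hy : yCoord P ≠ 0) :
    xCoord (2 • P) = ((3 * xCoord P ^ 2 + c) / (2 * yCoord P)) ^ 2 - 2 * xCoord P ∧
      yCoord (2 • P) = -((3 * xCoord P ^ 2 + c) / (2 * yCoord P) *
        (xCoord (2 • P) - xCoord P) + yCoord P) := by
  rcases P with _ | ⟨x, y, hp⟩
  · exact absurd rfl hP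
  simp only [yCoord] at hy
  have hne : y ≠ (curve c).toAffine.negY x y := by
    rw [curve_negY]
    intro h
    have h2 : (2 : F) * y = 0 := by linear_combination h
    exact hy ((mul_eq_zero.1 h2).resolve_left two_ne_zero)
  rw [two_nsmul, WeierstrassCurve.Affine.Point.add_self_of_Y_ne hne]
  have hsl : (curve c).toAffine.slope x x y y = (3 * x ^ 2 + c) / (2 * y) := by
    rw [WeierstrassCurve.Affine.slope_of_Y_ne rfl hne, curve_negY]
    simp [curve, two_mul]
  constructor
  · simp only [xCoord, yCoord, WeierstrassCurve.Affine.addX, hsl]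
    simp [curve]
    ring
  · simp only [xCoord, yCoord, WeierstrassCurve.Affine.addY, WeierstrassCurve.Affine.negAddY,
      hsl, curve_negY]

theorem four_mul_sq_mul_xCoord_double [NeZero (2 : F)] {P : (curve c).toAffine.Point} (hP : P ≠ 0)
    (hy : yCoord P ≠ 0) :
    4 * yCoord P ^ 2 * xCoord (2 • P) = (xCoord P ^ 2 - c) ^ 2 := by
  rw [(double_coords hP hy).1]
  have h1 := equation_coords hP
  have h2 : (2 : F) ≠ 0 := two_ne_zero
  field_simp
  linear_combination (-32 * xCoord P) * h1

/-- Relation between `x(T)`, `x(2R)` and `x(R ± T)`. -/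
theorem four_mul_sq_mul_sub_double [NeZero (2 : F)] {R T : (curve c).toAffine.Point} (hR : R ≠ 0)
    (hT : T ≠ 0) (hy : yCoord R ≠ 0) (h : xCoord R ≠ xCoord T) :
    4 * yCoord R ^ 2 * (xCoord T - xCoord (2 • R)) =
      (xCoord T - xCoord R) ^ 2 * ((xCoord R - xCoord (R + T)) *
        (xCoord (R - T) - xCoord R)) := by
  have h1 := sq_mul_xCoord_add_add_xCoord_sub hR hT h
  have h2 := sq_mul_xCoord_add_mul_xCoord_sub hR hT h
  have h3 := four_mul_sq_mul_xCoord_double hR hy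
  have h4 := equation_coords hR
  linear_combination 4 * xCoord T * h4 - h3 - xCoord R * h1 + h2

end GroupLaw

/-! ### The isomorphism between E_c and E_{u⁴c} -/

section Scaling

variable {F : Type*} [Field F]

theorem curve_nonsingular_iff (c x y : F) :
    (curve c).toAffine.Nonsingular x y ↔
      y ^ 2 = x ^ 3 + c * x ∧ (3 * x ^ 2 + c ≠ 0 ∨ y ≠ -y) := by
  rw [WeierstrassCurve.Affine.nonsingular_iff, curve_equation_iff]
  simp [curve, eq_comm]

theorem curve_nonsingular_scale {c u x y : F} (hu : u ≠ 0)
    (h : (curve c).toAffine.Nonsingular x y) :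
    (curve (u ^ 4 * c)).toAffine.Nonsingular (u ^ 2 * x) (u ^ 3 * y) := by
  rw [curve_nonsingular_iff] at h ⊢
  refine ⟨by linear_combination u ^ 6 * h.1, h.2.imp (fun h1 h2 => h1 ?_) (fun h1 h2 => h1 ?_)⟩
  · have : u ^ 4 * (3 * x ^ 2 + c) = 0 := by linear_combination h2
    exact (mul_eq_zero.1 this).resolve_left (pow_ne_zero _ hu)
  · have : u ^ 3 * y = u ^ 3 * (-y) := by linear_combination h2
    exact mul_left_cancel₀ (pow_ne_zero _ hu) this

/-- The map `(x, y) ↦ (u² x, u³ y)` on points. -/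
def scaleFun (c : F) {u : F} (hu : u ≠ 0) :
    (curve c).toAffine.Point → (curve (u ^ 4 * c)).toAffine.Point
  | .zero => .zero
  | .some x y h => .some (u ^ 2 * x) (u ^ 3 * y) (curve_nonsingular_scale hu h)

theorem xCoord_scaleFun (c : F) {u : F} (hu : u ≠ 0) (P : (curve c).toAffine.Point) :
    xCoord (scaleFun c hu P) = u ^ 2 * xCoord P := by
  rcases P with _ | ⟨x, y, h⟩
  · exact (mul_zero _).symm
  · rfl

theorem scaleFun_eq_zero_iff (c : F) {u : F} (hu : u ≠ 0) (P : (curve c).toAffine.Point) :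
    scaleFun c hu P = 0 ↔ P = 0 := by
  rcases P with _ | ⟨x, y, h⟩
  · exact ⟨fun _ => rfl, fun _ => rfl⟩
  · exact ⟨fun h' => absurd h' (WeierstrassCurve.Affine.Point.some_ne_zero _),
      fun h' => absurd h' (WeierstrassCurve.Affine.Point.some_ne_zero _)⟩

variable [DecidableEq F]

theorem scaleFun_add (c : F) {u : F} (hu : u ≠ 0) (P Q : (curve c).toAffine.Point) :
    scaleFun c hu (P + Q) = scaleFun c hu P + scaleFun c hu Q := by
  rcases P with _ | ⟨x, y, hp⟩
  · change scaleFun c hu (0 + Q) = 0 + scaleFun c hu Q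
    rw [zero_add, zero_add]
  rcases Q with _ | ⟨x', y', hq⟩
  · change scaleFun c hu (_ + 0) = scaleFun c hu _ + 0
    rw [add_zero, add_zero]
  by_cases hxy : x = x' ∧ y = (curve c).toAffine.negY x' y'
  · rw [WeierstrassCurve.Affine.Point.add_of_Y_eq hxy.1 hxy.2]
    have h1 : u ^ 2 * x = u ^ 2 * x' := by rw [hxy.1]
    have h2 : u ^ 3 * y = (curve (u ^ 4 * c)).toAffine.negY (u ^ 2 * x') (u ^ 3 * y') := by
      rw [hxy.2, curve_negY, curve_negY]; ring
    exact (WeierstrassCurve.Affine.Point.add_of_Y_eq h1 h2).symm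
  · have hxy' : ¬ (u ^ 2 * x = u ^ 2 * x' ∧
        u ^ 3 * y = (curve (u ^ 4 * c)).toAffine.negY (u ^ 2 * x') (u ^ 3 * y')) := by
      rintro ⟨h1, h2⟩
      refine hxy ⟨mul_left_cancel₀ (pow_ne_zero _ hu) h1, ?_⟩
      rw [curve_negY] at h2 ⊢
      exact mul_left_cancel₀ (pow_ne_zero 3 hu) (by rw [h2]; ring)
    have hsl : (curve (u ^ 4 * c)).toAffine.slope (u ^ 2 * x) (u ^ 2 * x') (u ^ 3 * y)
        (u ^ 3 * y') = u * (curve c).toAffine.slope x x' y y' := by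
      by_cases hx : x = x'
      · have hy : y ≠ (curve c).toAffine.negY x' y' := fun h => hxy ⟨hx, h⟩
        have hy' : u ^ 3 * y ≠
            (curve (u ^ 4 * c)).toAffine.negY (u ^ 2 * x') (u ^ 3 * y') :=
          fun h => hxy' ⟨by rw [hx], h⟩
        rw [WeierstrassCurve.Affine.slope_of_Y_ne hx hy,
          WeierstrassCurve.Affine.slope_of_Y_ne (by rw [hx]) hy', curve_negY, curve_negY]
        simp only [curve]
        -- A vanishing denominator need not be excluded: division by zero then makes both slopes 0.
        by_cases h0 : y - -y = 0
        · have : u ^ 3 * y - -(u ^ 3 * y) = 0 := by linear_combination u ^ 3 * h0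
          rw [h0, this]; simp
        · have : u ^ 3 * y - -(u ^ 3 * y) ≠ 0 := by
            intro h
            exact h0 ((mul_eq_zero.1 (show u ^ 3 * (y - -y) = 0 by
              linear_combination h)).resolve_left (pow_ne_zero _ hu))
          rw [div_eq_iff this, mul_div_assoc', div_mul_eq_mul_div, eq_div_iff h0]
          ring
      · have hx' : u ^ 2 * x ≠ u ^ 2 * x' :=
          fun h => hx (mul_left_cancel₀ (pow_ne_zero _ hu) h)
        rw [WeierstrassCurve.Affine.slope_of_X_ne hx, WeierstrassCurve.Affine.slope_of_X_ne hx',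
          ← mul_sub, ← mul_sub]
        have := sub_ne_zero.2 hx
        field_simp
    simp only [scaleFun]
    rw [WeierstrassCurve.Affine.Point.add_some hxy, WeierstrassCurve.Affine.Point.add_some hxy']
    simp only [WeierstrassCurve.Affine.Point.some.injEq, WeierstrassCurve.Affine.addY,
      WeierstrassCurve.Affine.negAddY, WeierstrassCurve.Affine.addX, hsl, curve_negY]
    simp only [curve]
    constructor <;> ring

/-- The map `(x, y) ↦ (u² x, u³ y)` as a homomorphism of groups. -/
def scaleHom (c : F) {u : F} (hu : u ≠ 0) :
    (curve c).toAffine.Point →+ (curve (u ^ 4 * c)).toAffine.Point where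
  toFun := scaleFun c hu
  map_zero' := rfl
  map_add' := scaleFun_add c hu

/-- The image of a `k`-torsion point under scaling. -/
theorem exists_scaled_torsion {b c u : F} (hu : u ≠ 0) (hb : b = u ^ 4 * c) {k : ℕ}
    {P : (curve c).toAffine.Point} (h0 : P ≠ 0) (hk : k • P = 0) :
    ∃ Q : (curve b).toAffine.Point, Q ≠ 0 ∧ k • Q = 0 ∧ xCoord Q = u ^ 2 * xCoord P := by
  subst hb
  refine ⟨scaleHom c hu P, fun h => h0 ((scaleFun_eq_zero_iff c hu P).1 h), ?_,
    xCoord_scaleFun c hu P⟩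
  rw [← map_nsmul, hk, map_zero]

end Scaling

/-! ### The multiplication-by-n formula at points of infinite order -/

section Multiplication

variable {F : Type*} [Field F] {c : F}

/-- The values of the division polynomials at a point. -/
noncomputable def divVal (P : (curve c).toAffine.Point) (n : ℤ) : F :=
  normEDS (2 * yCoord P) ((curve c).Ψ₃.eval (xCoord P)) ((curve c).preΨ₄.eval (xCoord P)) n

theorem eval_Ψ₂Sq' (x : F) : (curve c).Ψ₂Sq.eval x = 4 * x ^ 3 + 4 * c * x := by
  simp [WeierstrassCurve.Ψ₂Sq, curve, WeierstrassCurve.b₂, WeierstrassCurve.b₄,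
    WeierstrassCurve.b₆]
  exact Or.inl (by ring)

theorem eval_Ψ₂Sq (P : (curve c).toAffine.Point) :
    (curve c).Ψ₂Sq.eval (xCoord P) = (2 * yCoord P) ^ 2 := by
  rw [eval_Ψ₂Sq']
  linear_combination (-4) * equation_coords' P

theorem eval_Ψ₃ (x : F) : (curve c).Ψ₃.eval x = 3 * x ^ 4 + 6 * c * x ^ 2 - c ^ 2 := by
  simp [WeierstrassCurve.Ψ₃, curve, WeierstrassCurve.b₂, WeierstrassCurve.b₄,
    WeierstrassCurve.b₆, WeierstrassCurve.b₈]
  ring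

theorem eval_preΨ₄ (x : F) : (curve c).preΨ₄.eval x =
    2 * (x ^ 6 + 5 * c * x ^ 4 - 5 * c ^ 2 * x ^ 2 - c ^ 3) := by
  simp [WeierstrassCurve.preΨ₄, curve, WeierstrassCurve.b₂, WeierstrassCurve.b₄,
    WeierstrassCurve.b₆, WeierstrassCurve.b₈]
  ring

theorem eval_preΨ (P : (curve c).toAffine.Point) (n : ℤ) :
    ((curve c).preΨ n).eval (xCoord P) = preNormEDS ((2 * yCoord P) ^ 4)
      ((curve c).Ψ₃.eval (xCoord P)) ((curve c).preΨ₄.eval (xCoord P)) n := by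
  rw [WeierstrassCurve.preΨ, ← coe_evalRingHom, map_preNormEDS, map_pow]
  simp only [coe_evalRingHom, eval_Ψ₂Sq, ← pow_mul]

theorem eval_ΨSq (P : (curve c).toAffine.Point) (n : ℤ) :
    ((curve c).ΨSq n).eval (xCoord P) = divVal P n ^ 2 := by
  rw [WeierstrassCurve.ΨSq, divVal, normEDS, eval_mul, eval_pow, eval_preΨ]
  split_ifs
  · rw [eval_Ψ₂Sq]; ring
  · simp

theorem eval_Φ (P : (curve c).toAffine.Point) (n : ℤ) :
    ((curve c).Φ n).eval (xCoord P) =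
      xCoord P * divVal P n ^ 2 - divVal P (n + 1) * divVal P (n - 1) := by
  rw [← eval_ΨSq, WeierstrassCurve.Φ, divVal, divVal, normEDS, normEDS]
  simp only [eval_sub, eval_mul, eval_X, eval_preΨ]
  by_cases h : Even n
  · have h1 : ¬ Even (n + 1) := by simpa [Int.even_add_one] using h
    have h2 : ¬ Even (n - 1) := by simpa [Int.even_sub_one] using h
    simp [h, h1, h2]
  · have h1 : Even (n + 1) := by simpa [Int.even_add_one] using h
    have h2 : Even (n - 1) := by simpa [Int.even_sub_one] using h
    simp only [h, h1, h2, if_true, if_false, eval_Ψ₂Sq]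
    ring

theorem divVal_zero (P : (curve c).toAffine.Point) : divVal P 0 = 0 := normEDS_zero ..
theorem divVal_one (P : (curve c).toAffine.Point) : divVal P 1 = 1 := normEDS_one ..
theorem divVal_two (P : (curve c).toAffine.Point) : divVal P 2 = 2 * yCoord P := normEDS_two ..
theorem divVal_three (P : (curve c).toAffine.Point) :
    divVal P 3 = 3 * xCoord P ^ 4 + 6 * c * xCoord P ^ 2 - c ^ 2 := by
  rw [divVal, normEDS_three, eval_Ψ₃]
theorem divVal_four (P : (curve c).toAffine.Point) :
    divVal P 4 = 2 * (xCoord P ^ 6 + 5 * c * xCoord P ^ 4 - 5 * c ^ 2 * xCoord P ^ 2 - c ^ 3) *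
      (2 * yCoord P) := by
  rw [divVal, normEDS_four, eval_preΨ₄]

theorem divVal_even (P : (curve c).toAffine.Point) (m : ℤ) :
    divVal P (2 * m) * (2 * yCoord P) =
      divVal P (m - 1) ^ 2 * divVal P m * divVal P (m + 2) -
        divVal P (m - 2) * divVal P m * divVal P (m + 1) ^ 2 := normEDS_even ..

theorem divVal_odd (P : (curve c).toAffine.Point) (m : ℤ) :
    divVal P (2 * m + 1) =
      divVal P (m + 2) * divVal P m ^ 3 - divVal P (m - 1) * divVal P (m + 1) ^ 3 :=
  normEDS_odd ..

variable [DecidableEq F]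

/-- The multiplication formula at `n`. -/
def MulX (P : (curve c).toAffine.Point) (n : ℕ) : Prop :=
  divVal P n ≠ 0 ∧ (xCoord P - xCoord (n • P)) * divVal P n ^ 2 =
    divVal P (n + 1) * divVal P (n - 1)

variable {P : (curve c).toAffine.Point}

theorem nsmul_ne_zero_of_infinite (hP : ¬ IsOfFinAddOrder P) {n : ℕ} (hn : n ≠ 0) : n • P ≠ 0 :=
  fun h => hP (isOfFinAddOrder_iff_nsmul_eq_zero.2 ⟨n, Nat.pos_of_ne_zero hn, h⟩)

theorem xCoord_nsmul_ne (hP : ¬ IsOfFinAddOrder P) {m n : ℕ} (hm : m ≠ 0) (hn : n ≠ 0)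
    (h : m ≠ n) : xCoord (m • P) ≠ xCoord (n • P) := by
  have key : ∀ {m n : ℕ}, m < n → m • P ≠ n • P := fun {m n} hmn he => by
    obtain ⟨d, rfl⟩ := Nat.exists_eq_add_of_lt hmn
    have hd : (d + 1) • P = 0 := by
      have : m • P + (d + 1) • P = m • P + 0 := by rw [← add_smul, add_zero, he, add_assoc]
      exact add_left_cancel this
    exact nsmul_ne_zero_of_infinite hP d.succ_ne_zero hd
  rw [Ne, xCoord_eq_iff (nsmul_ne_zero_of_infinite hP hm) (nsmul_ne_zero_of_infinite hP hn)]
  rintro (he | he)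
  · rcases lt_or_gt_of_ne h with h | h
    · exact key h he
    · exact key h he.symm
  · rw [eq_neg_iff_add_eq_zero, ← add_smul] at he
    exact nsmul_ne_zero_of_infinite hP (by omega) he

/-- The odd recurrence is a combination of the two formulas for x(P) − x(mP) and x(P) − x((m+1)P) in
which x(P) cancels. -/
theorem divVal_odd_eq {m : ℕ} (h1 : MulX P m) (h2 : MulX P (m + 1)) :
    divVal P (2 * m + 1) = divVal P m ^ 2 * divVal P (m + 1) ^ 2 *
      (xCoord (m • P) - xCoord ((m + 1) • P)) := by
  have e1 := h1.2
  have e2 := h2.2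
  push_cast at e2
  rw [divVal_odd]
  rw [show ((m : ℤ) + 1 + 1) = m + 2 by ring, show ((m : ℤ) + 1 - 1) = m by ring] at e2
  linear_combination divVal P (m + 1) ^ 2 * e1 - divVal P m ^ 2 * e2

theorem mulX_one : MulX P 1 := by
  refine ⟨?_, ?_⟩
  · simp [divVal_one]
  · simp [divVal_zero]

/-- The points (m+1)P and mP have difference P and sum (2m+1)P, so the difference formula for their
x-coordinates gives x(P) − x((2m+1)P) as a product of y-coordinates, that is, of ψ_{2m} and
ψ_{2m+2}. -/
theorem mulX_odd (hP : ¬ IsOfFinAddOrder P) {m : ℕ} (hm : m ≠ 0)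
    (h1 : MulX P m) (h2 : MulX P (m + 1))
    (y1 : divVal P (2 * m) = 2 * yCoord (m • P) * divVal P m ^ 4)
    (y2 : divVal P (2 * (m + 1)) = 2 * yCoord ((m + 1) • P) * divVal P (m + 1) ^ 4) :
    MulX P (2 * m + 1) := by
  have ho := divVal_odd_eq h1 h2
  have hne : xCoord ((m + 1) • P) ≠ xCoord (m • P) :=
    xCoord_nsmul_ne hP (by omega) hm (by omega)
  have hd := sq_mul_xCoord_sub_sub_xCoord_add
    (nsmul_ne_zero_of_infinite hP (show m + 1 ≠ 0 by omega))
    (nsmul_ne_zero_of_infinite hP hm) hne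
  rw [show (m + 1) • P - m • P = P by rw [succ_nsmul]; abel,
    ← add_smul, show m + 1 + m = 2 * m + 1 by ring] at hd
  obtain ⟨n1, -⟩ := h1
  obtain ⟨n2, -⟩ := h2
  push_cast at n2
  refine ⟨?_, ?_⟩
  · push_cast
    rw [ho]
    exact mul_ne_zero (mul_ne_zero (pow_ne_zero _ n1) (pow_ne_zero _ n2))
      (sub_ne_zero.2 hne.symm)
  · push_cast
    rw [show (2 * (m : ℤ) + 1 + 1) = 2 * (m + 1) by ring,
      show (2 * (m : ℤ) + 1 - 1) = 2 * m by ring, ho, y1, y2]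
    linear_combination divVal P m ^ 4 * divVal P (m + 1) ^ 4 * hd

variable [NeZero (2 : F)]

theorem yCoord_nsmul_ne_zero (hP : ¬ IsOfFinAddOrder P) {n : ℕ} (hn : n ≠ 0) :
    yCoord (n • P) ≠ 0 := by
  intro h
  have := (two_nsmul_eq_zero_iff (nsmul_ne_zero_of_infinite hP hn)).2 h
  rw [← mul_smul] at this
  exact nsmul_ne_zero_of_infinite hP (by omega) this

/-- The same difference formula, now for (m+2)P and P, turns the even recurrence into a formula for
y((m+2)P). The shift by 2 keeps all three indices positive. -/
theorem divVal_even_eq (hP : ¬ IsOfFinAddOrder P) {m : ℕ} (h0 : MulX P (m + 1))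
    (h1 : MulX P (m + 2)) (h2 : MulX P (m + 3)) :
    divVal P (2 * (m + 2)) = 2 * yCoord ((m + 2) • P) * divVal P (m + 2) ^ 4 := by
  have hy : yCoord P ≠ 0 := by simpa using yCoord_nsmul_ne_zero hP one_ne_zero
  have hP0 : P ≠ 0 := by simpa using nsmul_ne_zero_of_infinite hP one_ne_zero
  have hne : xCoord ((m + 2) • P) ≠ xCoord P := by
    simpa using xCoord_nsmul_ne hP (m := m + 2) (n := 1) (by omega) (by omega) (by omega)
  have hd := sq_mul_xCoord_sub_sub_xCoord_add
    (nsmul_ne_zero_of_infinite hP (show m + 2 ≠ 0 by omega)) hP0 hne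
  rw [show (m + 2) • P - P = (m + 1) • P by
      rw [sub_eq_iff_eq_add]; rw [← succ_nsmul],
    ← succ_nsmul] at hd
  obtain ⟨n0, e0⟩ := h0
  obtain ⟨n1, e1⟩ := h1
  obtain ⟨n2, e2⟩ := h2
  push_cast at e0 e1 e2 n0 n1 n2
  rw [show ((m : ℤ) + 1 + 1) = m + 2 by ring, show ((m : ℤ) + 1 - 1) = m by ring] at e0
  rw [show ((m : ℤ) + 2 + 1) = m + 3 by ring, show ((m : ℤ) + 2 - 1) = m + 1 by ring] at e1
  rw [show ((m : ℤ) + 3 + 1) = m + 4 by ring, show ((m : ℤ) + 3 - 1) = m + 2 by ring] at e2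
  have hev := divVal_even P (m + 2)
  rw [show ((m : ℤ) + 2 - 1) = m + 1 by ring, show ((m : ℤ) + 2 + 1) = m + 3 by ring,
    show ((m : ℤ) + 2 + 2) = m + 4 by ring, show ((m : ℤ) + 2 - 2) = m by ring] at hev
  have h2y : (2 * yCoord P) ≠ 0 := mul_ne_zero two_ne_zero hy
  apply mul_right_cancel₀ h2y
  rw [hev]
  generalize divVal P m = w0 at *
  generalize divVal P (m + 1) = w1 at *
  generalize divVal P (m + 2) = w2 at *
  generalize divVal P (m + 3) = w3 at *
  generalize divVal P (m + 4) = w4 at *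
  generalize xCoord ((m + 1) • P) = x1 at *
  generalize xCoord ((m + 2) • P) = x2 at *
  rw [show m + 2 + 1 = m + 3 by ring] at hd
  generalize xCoord ((m + 3) • P) = x3 at *
  generalize xCoord P = x at *
  generalize yCoord P = y at *
  generalize yCoord ((m + 2) • P) = y2 at *
  linear_combination w2 ^ 4 * hd - w1 ^ 2 * e2 + w3 ^ 2 * e0 -
    (x1 - x3) * ((x - x2) * w2 ^ 2 + w3 * w1) * e1

/-- Take R = (m+2)P and T = P in `four_mul_sq_mul_sub_double`: the differences x(R) − x(R ± P) are,
up to squares, ψ at the odd indices next to 2(m+2). -/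
theorem mulX_even (hP : ¬ IsOfFinAddOrder P) {m : ℕ} (h0 : MulX P (m + 1))
    (h1 : MulX P (m + 2)) (h2 : MulX P (m + 3)) : MulX P (2 * (m + 2)) := by
  have hev := divVal_even_eq hP h0 h1 h2
  have ho1 := divVal_odd_eq h0 h1
  have ho2 := divVal_odd_eq h1 h2
  have hy2 := yCoord_nsmul_ne_zero hP (show m + 2 ≠ 0 by omega)
  have hP0 : P ≠ 0 := by simpa using nsmul_ne_zero_of_infinite hP one_ne_zero
  have hne : xCoord ((m + 2) • P) ≠ xCoord P := by
    simpa using xCoord_nsmul_ne hP (m := m + 2) (n := 1) (by omega) (by omega) (by omega)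
  have key := four_mul_sq_mul_sub_double
    (nsmul_ne_zero_of_infinite hP (show m + 2 ≠ 0 by omega)) hP0 hy2 hne
  rw [show (m + 2) • P - P = (m + 1) • P by
      rw [sub_eq_iff_eq_add]; rw [← succ_nsmul],
    ← succ_nsmul, ← mul_smul] at key
  obtain ⟨n1, e1⟩ := h1
  push_cast at e1 n1 ho1 ho2
  rw [show ((m : ℤ) + 2 + 1) = m + 3 by ring, show ((m : ℤ) + 2 - 1) = m + 1 by ring] at e1
  rw [show (2 * ((m : ℤ) + 1) + 1) = 2 * (m + 2) - 1 by ring,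
    show ((m : ℤ) + 1 + 1) = m + 2 by ring] at ho1
  rw [show ((m : ℤ) + 2 + 1) = m + 3 by ring] at ho2
  rw [show m + 2 + 1 = m + 3 by ring] at key ho2
  rw [show m + 1 + 1 = m + 2 by ring] at ho1
  refine ⟨?_, ?_⟩
  · push_cast
    rw [hev]
    exact mul_ne_zero (mul_ne_zero two_ne_zero hy2) (pow_ne_zero _ n1)
  · push_cast
    rw [hev, ho1, ho2]
    generalize divVal P (m + 1) = w1 at *
    generalize divVal P (m + 2) = w2 at *
    generalize divVal P (m + 3) = w3 at *
    generalize xCoord ((m + 1) • P) = x1 at *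
    generalize xCoord ((m + 2) • P) = x2 at *
    generalize xCoord ((m + 3) • P) = x3 at *
    generalize xCoord ((2 * (m + 2)) • P) = x4 at *
    generalize xCoord P = x at *
    generalize yCoord ((m + 2) • P) = y2 at *
    linear_combination w2 ^ 8 * key + w2 ^ 4 * (x2 - x3) * (x1 - x2) *
      ((x - x2) * w2 ^ 2 + w3 * w1) * e1

theorem mulX_two (hP : ¬ IsOfFinAddOrder P) : MulX P 2 := by
  have hy : yCoord P ≠ 0 := by simpa using yCoord_nsmul_ne_zero hP one_ne_zero
  have hP0 : P ≠ 0 := by simpa using nsmul_ne_zero_of_infinite hP one_ne_zero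
  have h2 : (2 : F) ≠ 0 := two_ne_zero
  have hx := four_mul_sq_mul_xCoord_double hP0 hy
  have he := equation_coords hP0
  refine ⟨?_, ?_⟩
  · push_cast
    rw [divVal_two]
    exact mul_ne_zero h2 hy
  · push_cast
    rw [divVal_one, divVal_two, divVal_three]
    linear_combination (-1) * hx + 4 * xCoord P * he

theorem divVal_four_eq (hP : ¬ IsOfFinAddOrder P) :
    divVal P 4 = 2 * yCoord (2 • P) * divVal P 2 ^ 4 := by
  have hy : yCoord P ≠ 0 := by simpa using yCoord_nsmul_ne_zero hP one_ne_zero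
  have hP0 : P ≠ 0 := by simpa using nsmul_ne_zero_of_infinite hP one_ne_zero
  have h2 : (2 : F) ≠ 0 := two_ne_zero
  have he := equation_coords hP0
  have hd := double_coords hP0 hy
  have h1 : 2 * yCoord P * yCoord (2 • P) =
      -((3 * xCoord P ^ 2 + c) * (xCoord (2 • P) - xCoord P) + 2 * yCoord P ^ 2) := by
    rw [hd.2]; field_simp
  have hx := four_mul_sq_mul_xCoord_double hP0 hy
  rw [divVal_four, divVal_two]
  generalize xCoord (2 • P) = x2 at *
  generalize yCoord (2 • P) = y2 at *
  generalize xCoord P = x at *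
  generalize yCoord P = y at *
  have h3 : 8 * y ^ 3 * y2 = 2 * (x ^ 6 + 5 * c * x ^ 4 - 5 * c ^ 2 * x ^ 2 - c ^ 3) / 2 := by
    rw [mul_div_cancel_left₀ _ h2]
    linear_combination 4 * y ^ 2 * h1 - (3 * x ^ 2 + c) * hx +
      (4 * x * (3 * x ^ 2 + c) - 8 * (y ^ 2 + (x ^ 3 + c * x))) * he
  rw [mul_div_cancel_left₀ _ h2] at h3
  linear_combination (-4) * y * h3

theorem mulX_and (hP : ¬ IsOfFinAddOrder P) (n : ℕ) (hn : n ≠ 0) : MulX P n := by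
  induction n using Nat.strong_induction_on with
  | _ n ih =>
    have Y : ∀ m : ℕ, m ≠ 0 → m + 1 < n →
        divVal P (2 * m) = 2 * yCoord (m • P) * divVal P m ^ 4 := by
      intro m hm hmn
      match m, hm with
      | 1, _ => simp [divVal_one, divVal_two]
      | k + 2, _ =>
        exact_mod_cast divVal_even_eq hP (ih _ (by omega) (by omega)) (ih _ (by omega) (by omega))
          (ih _ (by omega) (by omega))
    rcases Nat.even_or_odd' n with ⟨m, rfl | rfl⟩
    · match m, hn with
      | 1, _ => exact mulX_two hP
      | k + 2, _ =>
        exact mulX_even hP (ih _ (by omega) (by omega)) (ih _ (by omega) (by omega))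
          (ih _ (by omega) (by omega))
    · match m with
      | 0 => exact mulX_one
      | 1 =>
        -- The case n = 3 needs ψ₄ in terms of y(2P), and `divVal_even_eq` would require n = 3
        -- itself; ψ₄ is therefore computed directly.
        refine mulX_odd hP one_ne_zero mulX_one (mulX_two hP) ?_ ?_
        · simp [divVal_one, divVal_two]
        · have := divVal_four_eq hP
          norm_num
          exact this
      | k + 2 =>
        refine mulX_odd hP (by omega) (ih _ (by omega) (by omega)) (ih _ (by omega) (by omega))
          (Y _ (by omega) (by omega)) ?_
        exact_mod_cast Y (k + 2 + 1) (by omega) (by omega)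

/-- The multiplication-by-`n` formula for points of infinite order. -/
theorem xCoord_nsmul_mul_eval_ΨSq (hP : ¬ IsOfFinAddOrder P) {n : ℕ} (hn : n ≠ 0) :
    ((curve c).ΨSq n).eval (xCoord P) ≠ 0 ∧
      xCoord (n • P) * ((curve c).ΨSq n).eval (xCoord P) =
        ((curve c).Φ n).eval (xCoord P) := by
  obtain ⟨h1, h2⟩ := mulX_and hP n hn
  rw [eval_ΨSq, eval_Φ]
  exact ⟨pow_ne_zero _ h1, by linear_combination (-1) * h2⟩

end Multiplication

theorem curve_map {R S : Type*} [CommRing R] [CommRing S] (f : R →+* S) (c : R) :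
    (curve c).map f = curve (f c) := by
  simp [curve, WeierstrassCurve.map]

/-! ### Roots of ψ_n² as x-coordinates of n-torsion points -/

section Torsion

variable {F : Type*} [Field F] {c : F}

/-- The polynomial identities expressing that `(Φ_n : ΨSq_n)` is a recurrence sequence under
addition and subtraction. -/
structure AddSubIdentities (c : F) (n : ℕ) : Prop where
  prod_ΨSq : (curve c).ΨSq (n + 2 : ℕ) * (curve c).ΨSq n =
    ((curve c).Φ (n + 1 : ℕ) - X * (curve c).ΨSq (n + 1 : ℕ)) ^ 2
  prod_Φ : (curve c).Φ (n + 2 : ℕ) * (curve c).Φ n =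
    (X * (curve c).Φ (n + 1 : ℕ) - C c * (curve c).ΨSq (n + 1 : ℕ)) ^ 2
  cross : (curve c).Φ (n + 2 : ℕ) * (curve c).ΨSq n + (curve c).Φ n * (curve c).ΨSq (n + 2 : ℕ) =
    2 * ((curve c).Φ (n + 1 : ℕ) + X * (curve c).ΨSq (n + 1 : ℕ)) *
      (C c * (curve c).ΨSq (n + 1 : ℕ) + X * (curve c).Φ (n + 1 : ℕ))

variable [DecidableEq F]

theorem isOfFinAddOrder_of_nsmul {G : Type*} [AddGroup G] {P : G} {j : ℕ} (hj : j ≠ 0)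
    (h : IsOfFinAddOrder (j • P)) : IsOfFinAddOrder P := by
  rw [isOfFinAddOrder_iff_nsmul_eq_zero] at h ⊢
  obtain ⟨n, hn, h⟩ := h
  exact ⟨n * j, by positivity, by rwa [mul_smul]⟩

theorem infinite_xCoord_nsmul {P : (curve c).toAffine.Point} (hP : ¬ IsOfFinAddOrder P) :
    (Set.range fun j : ℕ => xCoord ((j + 1) • P)).Infinite :=
  Set.infinite_range_of_injective fun i j h => by
    by_contra hij
    exact xCoord_nsmul_ne hP i.succ_ne_zero j.succ_ne_zero (by omega) h

variable [NeZero (2 : F)]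

theorem eval_addSub {Q : (curve c).toAffine.Point} (hQ : ¬ IsOfFinAddOrder Q) (n : ℕ) :
    eval (xCoord Q) ((curve c).ΨSq (n + 2 : ℕ) * (curve c).ΨSq n) =
        eval (xCoord Q) (((curve c).Φ (n + 1 : ℕ) - X * (curve c).ΨSq (n + 1 : ℕ)) ^ 2) ∧
      eval (xCoord Q) ((curve c).Φ (n + 2 : ℕ) * (curve c).Φ n) =
        eval (xCoord Q) ((X * (curve c).Φ (n + 1 : ℕ) - C c * (curve c).ΨSq (n + 1 : ℕ)) ^ 2) ∧
      eval (xCoord Q) ((curve c).Φ (n + 2 : ℕ) * (curve c).ΨSq n +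
          (curve c).Φ n * (curve c).ΨSq (n + 2 : ℕ)) =
        eval (xCoord Q) (2 * ((curve c).Φ (n + 1 : ℕ) + X * (curve c).ΨSq (n + 1 : ℕ)) *
          (C c * (curve c).ΨSq (n + 1 : ℕ) + X * (curve c).Φ (n + 1 : ℕ))) := by
  have hQ0 : Q ≠ 0 := by simpa using nsmul_ne_zero_of_infinite hQ one_ne_zero
  have k1 : eval (xCoord Q) ((curve c).ΨSq (n + 2 : ℕ) * (curve c).ΨSq n) =
      eval (xCoord Q) (((curve c).Φ (n + 1 : ℕ) - X * (curve c).ΨSq (n + 1 : ℕ)) ^ 2) := by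
    simp only [eval_mul, eval_pow, eval_sub, eval_X, eval_ΨSq, eval_Φ]
    push_cast
    rw [show (n : ℤ) + 1 + 1 = n + 2 by ring, show (n : ℤ) + 1 - 1 = n by ring]
    ring
  refine ⟨k1, ?_⟩
  simp only [eval_mul, eval_pow, eval_sub, eval_add, eval_X, eval_C, eval_ofNat] at k1 ⊢
  rcases Nat.eq_zero_or_pos n with rfl | hn
  · obtain ⟨-, e2⟩ := xCoord_nsmul_mul_eval_ΨSq hQ two_ne_zero
    have hy : yCoord Q ≠ 0 := by simpa using yCoord_nsmul_ne_zero hQ one_ne_zero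
    have hx := four_mul_sq_mul_xCoord_double hQ0 hy
    have he := equation_coords hQ0
    simp only [zero_add, Nat.cast_zero, Nat.cast_one, WeierstrassCurve.ΨSq_zero,
      WeierstrassCurve.ΨSq_one, WeierstrassCurve.Φ_zero, WeierstrassCurve.Φ_one, eval_zero,
      eval_one, eval_X] at e2 ⊢
    rw [← e2]
    push_cast
    rw [WeierstrassCurve.ΨSq_two, eval_Ψ₂Sq]
    exact ⟨by linear_combination hx, by linear_combination 4 * he⟩
  · obtain ⟨-, e0⟩ := xCoord_nsmul_mul_eval_ΨSq hQ hn.ne'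
    obtain ⟨-, e1⟩ := xCoord_nsmul_mul_eval_ΨSq hQ (show n + 1 ≠ 0 by omega)
    obtain ⟨-, e2⟩ := xCoord_nsmul_mul_eval_ΨSq hQ (show n + 2 ≠ 0 by omega)
    have hne : xCoord ((n + 1) • Q) ≠ xCoord Q := by
      simpa using xCoord_nsmul_ne hQ (m := n + 1) (n := 1) (by omega) (by omega) (by omega)
    have hR := nsmul_ne_zero_of_infinite hQ (show n + 1 ≠ 0 by omega)
    have h1 := sq_mul_xCoord_add_add_xCoord_sub hR hQ0 hne
    have h2 := sq_mul_xCoord_add_mul_xCoord_sub hR hQ0 hne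
    rw [show (n + 1) • Q - Q = n • Q by rw [sub_eq_iff_eq_add]; rw [← succ_nsmul],
      ← succ_nsmul, show n + 1 + 1 = n + 2 by ring] at h1 h2
    rw [← e1] at k1
    rw [← e0, ← e1, ← e2]
    clear e0 e1 e2
    generalize eval (xCoord Q) ((curve c).ΨSq (n : ℕ)) = w0 at *
    generalize eval (xCoord Q) ((curve c).ΨSq (n + 1 : ℕ)) = w1 at *
    generalize eval (xCoord Q) ((curve c).ΨSq (n + 2 : ℕ)) = w2 at *
    generalize xCoord (n • Q) = x0 at *
    generalize xCoord ((n + 1) • Q) = x1 at *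
    generalize xCoord ((n + 2) • Q) = x2 at *
    generalize xCoord Q = x at *
    exact ⟨by linear_combination x2 * x0 * k1 + w1 ^ 2 * h2,
      by linear_combination (x2 + x0) * k1 + w1 ^ 2 * h1⟩

/-- Each identity holds at the infinitely many values x(jP), hence as an identity of polynomials. It
can then be evaluated at torsion points and over extension fields, where the induction above is
unavailable. -/
theorem addSubIdentities_of_infinite {P : (curve c).toAffine.Point} (hP : ¬ IsOfFinAddOrder P)
    (n : ℕ) : AddSubIdentities c n := by
  have key : ∀ p q : F[X], (∀ Q : (curve c).toAffine.Point, ¬ IsOfFinAddOrder Q →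
      eval (xCoord Q) p = eval (xCoord Q) q) → p = q := fun p q h =>
    eq_of_infinite_eval_eq p q <| (infinite_xCoord_nsmul hP).mono <| by
      rintro _ ⟨j, rfl⟩
      exact h _ fun h' => hP (isOfFinAddOrder_of_nsmul j.succ_ne_zero h')
  exact ⟨key _ _ fun Q hQ => (eval_addSub hQ n).1, key _ _ fun Q hQ => (eval_addSub hQ n).2.1,
    key _ _ fun Q hQ => (eval_addSub hQ n).2.2⟩

omit [DecidableEq F] [NeZero (2 : F)] in
theorem AddSubIdentities.map {K : Type*} [Field K] (f : F →+* K) {n : ℕ}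
    (h : AddSubIdentities c n) : AddSubIdentities (f c) n := by
  have e1 := fun m : ℤ => (curve c).map_ΨSq f m
  have e2 := fun m : ℤ => (curve c).map_Φ f m
  rw [curve_map] at e1 e2
  constructor
  · simpa only [e1, e2, Polynomial.map_mul, Polynomial.map_pow, Polynomial.map_sub,
      Polynomial.map_add, map_X, map_C, Polynomial.map_ofNat] using congrArg (Polynomial.map f) h.prod_ΨSq
  · simpa only [e1, e2, Polynomial.map_mul, Polynomial.map_pow, Polynomial.map_sub,
      Polynomial.map_add, map_X, map_C, Polynomial.map_ofNat] using congrArg (Polynomial.map f) h.prod_Φ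
  · simpa only [e1, e2, Polynomial.map_mul, Polynomial.map_pow, Polynomial.map_sub,
      Polynomial.map_add, map_X, map_C, Polynomial.map_ofNat] using congrArg (Polynomial.map f) h.cross

/-- Homogeneous `x`-coordinate. -/
def xHom (P : (curve c).toAffine.Point) : F × F :=
  match P with
  | .zero => (1, 0)
  | .some x _ _ => (x, 1)

omit [DecidableEq F] [NeZero (2 : F)] in
theorem xHom_zero : xHom (0 : (curve c).toAffine.Point) = (1, 0) := rfl

omit [DecidableEq F] [NeZero (2 : F)] in
theorem xHom_of_ne_zero {P : (curve c).toAffine.Point} (h : P ≠ 0) : xHom P = (xCoord P, 1) := by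
  rcases P with _ | ⟨x, y, h'⟩
  · exact absurd rfl h
  · rfl

omit [DecidableEq F] [NeZero (2 : F)] in
theorem xHom_neg (P : (curve c).toAffine.Point) : xHom (-P) = xHom P := by
  rcases P with _ | ⟨x, y, h⟩ <;> rfl

omit [DecidableEq F] [NeZero (2 : F)] in
theorem xHom_ne {P : (curve c).toAffine.Point} (h : (xHom P).2 = 0) : (xHom P).1 ≠ 0 := by
  rcases P with _ | ⟨x, y, h'⟩
  · exact one_ne_zero
  · exact absurd h one_ne_zero

theorem xHom_double (hc : c ≠ 0) {T : (curve c).toAffine.Point} (hT : T ≠ 0) :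
    ∃ μ : F, μ ≠ 0 ∧ (xHom (2 • T)).1 * μ = (xCoord T ^ 2 - c) ^ 2 ∧
      (xHom (2 • T)).2 * μ = 4 * xCoord T * (xCoord T ^ 2 + c) := by
  have he := equation_coords hT
  have h2 : (2 : F) ≠ 0 := two_ne_zero
  by_cases hy : yCoord T = 0
  · rw [(two_nsmul_eq_zero_iff hT).2 hy, xHom_zero]
    refine ⟨(xCoord T ^ 2 - c) ^ 2, ?_, by ring, ?_⟩
    · intro h
      have h3 : xCoord T ^ 2 = c := sub_eq_zero.1 (pow_eq_zero_iff two_ne_zero |>.1 h)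
      rw [hy] at he
      have h4 : 2 * c * xCoord T = 0 := by linear_combination (-1) * he - xCoord T * h3
      rcases mul_eq_zero.1 h4 with h5 | h5
      · exact mul_ne_zero h2 hc h5
      · rw [h5] at h3; exact hc (by rw [← h3]; ring)
    · rw [hy] at he; linear_combination 4 * he
  · rw [xHom_of_ne_zero (fun h => hy ((two_nsmul_eq_zero_iff hT).1 h))]
    refine ⟨4 * yCoord T ^ 2, ?_, ?_, ?_⟩
    · rw [show (4 : F) = 2 * 2 by norm_num]
      exact mul_ne_zero (mul_ne_zero h2 h2) (pow_ne_zero _ hy)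
    · linear_combination four_mul_sq_mul_xCoord_double hT hy
    · linear_combination 4 * he

/-- Homogeneous coordinates absorb the cases R = 0 and R = ±T, so sum and product relations hold for
every R up to a nonzero factor μ. -/
theorem xHom_add_sub (hc : c ≠ 0) (R : (curve c).toAffine.Point) {T : (curve c).toAffine.Point}
    (hT : T ≠ 0) :
    ∃ μ : F, μ ≠ 0 ∧
      (xHom (R + T)).2 * (xHom (R - T)).2 * μ = ((xHom R).1 - xCoord T * (xHom R).2) ^ 2 ∧
      (xHom (R + T)).1 * (xHom (R - T)).1 * μ = (xCoord T * (xHom R).1 - c * (xHom R).2) ^ 2 ∧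
      ((xHom (R + T)).1 * (xHom (R - T)).2 + (xHom (R - T)).1 * (xHom (R + T)).2) * μ =
        2 * ((xHom R).1 + xCoord T * (xHom R).2) *
          (c * (xHom R).2 + xCoord T * (xHom R).1) := by
  by_cases hR : R = 0
  · subst hR
    rw [zero_add, zero_sub, xHom_neg, xHom_of_ne_zero hT, xHom_zero]
    exact ⟨1, one_ne_zero, by ring, by ring, by ring⟩
  by_cases hx : xCoord R = xCoord T
  · obtain ⟨μ, hμ, e1, e2⟩ := xHom_double hc hT
    rw [xHom_of_ne_zero hR, hx]
    rcases (xCoord_eq_iff hR hT).1 hx with rfl | rfl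
    · rw [sub_self, ← two_nsmul, xHom_zero]
      exact ⟨μ, hμ, by ring, by linear_combination e1, by linear_combination e2⟩
    · rw [neg_add_cancel, show -T - T = -(2 • T) by rw [two_nsmul]; abel, xHom_neg, xHom_zero]
      exact ⟨μ, hμ, by ring, by linear_combination e1, by linear_combination e2⟩
  · rw [xHom_of_ne_zero hR, xHom_of_ne_zero (add_coords hR hT hx).1,
      xHom_of_ne_zero (sub_coords hR hT hx).1]
    refine ⟨(xCoord R - xCoord T) ^ 2, pow_ne_zero _ (sub_ne_zero.2 hx), by ring, ?_, ?_⟩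
    · linear_combination sq_mul_xCoord_add_mul_xCoord_sub hR hT hx
    · linear_combination sq_mul_xCoord_add_add_xCoord_sub hR hT hx

/-- The values (Φ_n, ΨSq_n) at T and the coordinates of nT obey the same recurrence, which gives the
symmetric product of the terms n and n + 2 in terms of the term n + 1. -/
theorem eval_eq_xHom_nsmul (hc : c ≠ 0) (hI : ∀ n, AddSubIdentities c n)
    {T : (curve c).toAffine.Point} (hT : T ≠ 0) (n : ℕ) :
    ∃ l : F, l ≠ 0 ∧ eval (xCoord T) ((curve c).Φ n) = l * (xHom (n • T)).1 ∧
      eval (xCoord T) ((curve c).ΨSq n) = l * (xHom (n • T)).2 := by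
  induction n using Nat.strong_induction_on with
  | _ n ih =>
    match n with
    | 0 => exact ⟨1, one_ne_zero, by simp [xHom_zero], by simp [xHom_zero]⟩
    | 1 => exact ⟨1, one_ne_zero, by simp [xHom_of_ne_zero hT], by simp [xHom_of_ne_zero hT]⟩
    | n + 2 =>
      obtain ⟨l0, hl0, a0, b0⟩ := ih n (by omega)
      obtain ⟨l1, hl1, a1, b1⟩ := ih (n + 1) (by omega)
      obtain ⟨μ, hμ, m1, m2, m3⟩ := xHom_add_sub hc ((n + 1) • T) hT
      rw [show (n + 1) • T - T = n • T by rw [sub_eq_iff_eq_add]; rw [← succ_nsmul],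
        ← succ_nsmul, show n + 1 + 1 = n + 2 by ring] at m1 m2 m3
      have i1 := congrArg (eval (xCoord T)) (hI n).prod_ΨSq
      have i2 := congrArg (eval (xCoord T)) (hI n).prod_Φ
      have i3 := congrArg (eval (xCoord T)) (hI n).cross
      simp only [eval_mul, eval_pow, eval_sub, eval_add, eval_X, eval_C, eval_ofNat,
        a0, b0, a1, b1] at i1 i2 i3
      have hz := @xHom_ne F _ c (n • T)
      generalize eval (xCoord T) ((curve c).Φ (n + 2 : ℕ)) = p at *
      generalize eval (xCoord T) ((curve c).ΨSq (n + 2 : ℕ)) = q at *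
      generalize xHom (n • T) = v0 at *
      generalize xHom ((n + 1) • T) = v1 at *
      generalize xHom ((n + 2) • T) = v2 at *
      generalize xCoord T = x at *
      refine ⟨l1 ^ 2 * μ / l0, by positivity, ?_⟩
      -- The pairs (p, q) and v2 have, after rescaling, the same symmetric product with v0. Since v0
      -- ≠ (0, 0), they are proportional.
      have j1 : (q * l0 - l1 ^ 2 * μ * v2.2) * v0.2 = 0 := by
        linear_combination i1 - l1 ^ 2 * m1
      have j2 : (p * l0 - l1 ^ 2 * μ * v2.1) * v0.1 = 0 := by
        linear_combination i2 - l1 ^ 2 * m2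
      have j3 : (p * l0 - l1 ^ 2 * μ * v2.1) * v0.2 +
          (q * l0 - l1 ^ 2 * μ * v2.2) * v0.1 = 0 := by
        linear_combination i3 - l1 ^ 2 * m3
      have : p * l0 - l1 ^ 2 * μ * v2.1 = 0 ∧ q * l0 - l1 ^ 2 * μ * v2.2 = 0 := by
        by_cases h0 : v0.2 = 0
        · have h1 := hz h0
          have h2 := (mul_eq_zero.1 j2).resolve_right h1
          rw [h2, zero_mul, zero_add] at j3
          exact ⟨h2, (mul_eq_zero.1 j3).resolve_right h1⟩
        · have h2 := (mul_eq_zero.1 j1).resolve_right h0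
          rw [h2, zero_mul, add_zero] at j3
          exact ⟨(mul_eq_zero.1 j3).resolve_right h0, h2⟩
      constructor
      · field_simp; linear_combination this.1
      · field_simp; linear_combination this.2

theorem nsmul_eq_zero_iff_eval_ΨSq (hc : c ≠ 0) (hI : ∀ n, AddSubIdentities c n)
    {T : (curve c).toAffine.Point} (hT : T ≠ 0) (n : ℕ) :
    n • T = 0 ↔ eval (xCoord T) ((curve c).ΨSq n) = 0 := by
  obtain ⟨l, hl, -, h⟩ := eval_eq_xHom_nsmul hc hI hT n
  rw [h]
  constructor
  · intro h0; rw [h0, xHom_zero, mul_zero]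
  · intro h0
    by_contra h1
    rw [xHom_of_ne_zero h1, mul_one] at h0
    exact hl h0

end Torsion

/-! ### Cancellation in repeated doublings -/

section IntegerDoubling

/-- Arithmetic data attached to doubling the point with `x = A / b²`, `x³ + a x = (w / b³)²`:
the double has `x = (e / b')²` in lowest terms, and `D` is the cancelled factor. -/
structure DoublingData (a A b w D e b' : ℤ) : Prop where
  coprime : IsCoprime A b
  eq : w ^ 2 = A * (A ^ 2 + a * b ^ 4)
  num : A ^ 2 - a * b ^ 4 = D * e
  den : 2 * b * w = D * b'
  coprime' : IsCoprime e b'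

theorem sq_dvd_of_cube_dvd_sq {p w : ℤ} (hp : Prime p) (h : p ^ 3 ∣ w ^ 2) : p ^ 2 ∣ w := by
  obtain ⟨v, rfl⟩ := hp.dvd_of_dvd_pow ((dvd_pow_self p three_ne_zero).trans h)
  rw [mul_pow, show p ^ 3 = p ^ 2 * p by ring] at h
  have h1 := (mul_dvd_mul_iff_left (pow_ne_zero 2 hp.ne_zero)).1 h
  rw [sq]
  exact mul_dvd_mul_left p (hp.dvd_of_dvd_pow h1)

theorem sq_dvd_of_pow_four_dvd_cube {p w : ℤ} (hp : Prime p) (h : p ^ 4 ∣ w ^ 3) :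
    p ^ 2 ∣ w := by
  obtain ⟨v, rfl⟩ := hp.dvd_of_dvd_pow ((dvd_pow_self p four_ne_zero).trans h)
  rw [mul_pow, show p ^ 4 = p ^ 3 * p by ring] at h
  have h1 := (mul_dvd_mul_iff_left (pow_ne_zero 3 hp.ne_zero)).1 h
  rw [sq]
  exact mul_dvd_mul_left p (hp.dvd_of_dvd_pow h1)

/-- Rational root theorem: s = n/D satisfies the monic integral cubic (s + 4e)(s + 2e)² = Dt, hence
is an integer. -/
theorem dvd_of_cubic {n D e t : ℤ} (hD : D ≠ 0)
    (h : (n + 4 * D * e) * (n + 2 * D * e) ^ 2 = D ^ 4 * t) : D ∣ n := by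
  obtain ⟨n1, D1, hcop, h1, h2⟩ := Int.exists_gcd_one (Int.gcd_pos_of_ne_zero_right n hD)
  generalize ((n.gcd D : ℕ) : ℤ) = g at h1 h2
  have hg : g ≠ 0 := fun h0 => hD (by rw [h2, h0, mul_zero])
  have h3 : (n1 + 4 * D1 * e) * (n1 + 2 * D1 * e) ^ 2 = D1 ^ 4 * g * t := by
    apply mul_left_cancel₀ (pow_ne_zero 3 hg)
    rw [h1, h2] at h
    linear_combination h
  have h4 : D1 ∣ n1 ^ 3 := ⟨D1 ^ 3 * g * t - 8 * e * n1 ^ 2 - 20 * D1 * e ^ 2 * n1 -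
    16 * D1 ^ 2 * e ^ 3, by linear_combination h3⟩
  have h5 : IsCoprime D1 (n1 ^ 3) := (Int.isCoprime_iff_gcd_eq_one.2 hcop).symm.pow_right
  have h6 : IsUnit D1 := isUnit_of_dvd_one (h5.dvd_of_dvd_mul_left (by simpa using h4))
  rw [h1, h2]
  exact mul_dvd_mul h6.dvd dvd_rfl

namespace DoublingData

variable {a A b w D e b' : ℤ}

theorem dvd_of_dvd (h : DoublingData a A b w D e b') {n : ℤ} (h1 : n ∣ A ^ 2 - a * b ^ 4)
    (h2 : n ∣ 2 * b * w) : n ∣ D := by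
  obtain ⟨u, v, huv⟩ := h.coprime'
  have : D = u * (A ^ 2 - a * b ^ 4) + v * (2 * b * w) := by
    linear_combination (-D) * huv - u * h.num - v * h.den
  rw [this]
  exact dvd_add (h1.mul_left _) (h2.mul_left _)

theorem isCoprime_num (h : DoublingData a A b w D e b') : IsCoprime (A ^ 2 - a * b ^ 4) b := by
  have h1 : IsCoprime (A ^ 2) b := h.coprime.pow_left
  have : A ^ 2 - a * b ^ 4 = A ^ 2 + b * (-(a * b ^ 3)) := by ring
  rw [this]
  exact h1.add_mul_left_left _

theorem isCoprime_factor (h : DoublingData a A b w D e b') : IsCoprime D b :=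
  h.isCoprime_num.of_isCoprime_of_dvd_left ⟨e, h.num⟩

/-- The cancellation in a doubling divides `2a`. -/
theorem dvd_two_mul (h : DoublingData a A b w D e b') (hD : D ≠ 0) : D ∣ 2 * a := by
  obtain ⟨k, hk⟩ : D ∣ 2 * w := h.isCoprime_factor.dvd_of_dvd_mul_right
    ⟨b', by linear_combination h.den⟩
  set n := 4 * (a * b ^ 4) with hn
  have hA : A ^ 2 = a * b ^ 4 + D * e := by linear_combination h.num
  have h16 : (2 * w) ^ 4 = 16 * A ^ 2 * (A ^ 2 + a * b ^ 4) ^ 2 := by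
    linear_combination 16 * (w ^ 2 + A * (A ^ 2 + a * b ^ 4)) * h.eq
  rw [hk, hA] at h16
  -- Substituting A² = ab⁴ + De in (2w)⁴ = 16A²(A² + ab⁴)² gives a cubic in n = 4ab⁴; on the other
  -- side 2w = Dk because D is prime to b.
  have hcub : (n + 4 * D * e) * (n + 2 * D * e) ^ 2 = D ^ 4 * k ^ 4 := by
    rw [hn]; linear_combination (-1) * h16
  have hDn : D ∣ n := dvd_of_cubic hD hcub
  obtain ⟨s, hs⟩ := hDn
  have hs3 : (s + 4 * e) * (s + 2 * e) ^ 2 = D * k ^ 4 := by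
    apply mul_left_cancel₀ (pow_ne_zero 3 hD)
    rw [hs] at hcub
    linear_combination hcub
  -- The cubic yields D ∣ 4ab⁴. A factor 2 is saved: for D even the cubic modulo 2 makes s even, and
  -- for D odd the 2 is invertible.
  have h2 : D ∣ 2 * (a * b ^ 4) := by
    rcases Int.even_or_odd D with hev | hodd
    · have : Even s := by
        have : Even (D * k ^ 4) := hev.mul_right _
        rw [← hs3] at this
        simpa [Int.even_mul, Int.even_add, Int.even_pow, show Even (4 : ℤ) by decide] using this
      obtain ⟨r, hr⟩ := this
      exact ⟨r, by linarith [show 4 * (a * b ^ 4) = D * (r + r) by rw [← hr, ← hs]]⟩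
    · have hc : IsCoprime D 2 := (Int.prime_two.coprime_iff_not_dvd.2 (by
        rwa [← even_iff_two_dvd, Int.not_even_iff_odd])).symm
      exact hc.dvd_of_dvd_mul_left ⟨s, by rw [← hs, hn]; ring⟩
  have hc : IsCoprime D (b ^ 4) := h.isCoprime_factor.pow_right
  exact hc.dvd_of_dvd_mul_right (by rwa [mul_assoc])

/-- Comparing valuations in f² = e⁴ + ab'⁴ with p ∣ e and p ∤ b', and using that p⁴ ∤ a, gives
v_p(a) = 2. Back in the first doubling, p² ∣ D and p ∣ e, so p³ ∣ A² − ab⁴. This forces p⁴ ∣ 2A³,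
hence p² ∣ A and p³ ∣ ab⁴, a contradiction as p ∤ b. -/
theorem not_dvd_of_odd_prime (ha : FourthPowerFree a) (h : DoublingData a A b w D e b') {f : ℤ}
    (hf : f ^ 2 = e ^ 4 + a * b' ^ 4) {p : ℤ} (hp : Prime p) (hp2 : ¬ p ∣ 2) (hpe : p ∣ e)
    (hpa : p ∣ a) : False := by
  have hb' : ¬ p ∣ b' := fun hb =>
    hp.not_isUnit (h.coprime'.isUnit_of_dvd' hpe hb)
  have hpZ : p ∣ A ^ 2 - a * b ^ 4 := h.num ▸ hpe.mul_left D
  have hpA : p ∣ A := hp.dvd_of_dvd_pow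
    ((dvd_sub_left (hpa.mul_right (b ^ 4))).1 hpZ)
  have hb : ¬ p ∣ b := fun hb => hp.not_isUnit (h.coprime.isUnit_of_dvd' hpA hb)
  have he4 : p ^ 4 ∣ e ^ 4 := pow_dvd_pow_of_dvd hpe 4
  have a_of : ∀ j : ℕ, j ≤ 4 → p ^ j ∣ f ^ 2 → p ^ j ∣ a := fun j hj hjf => by
    rw [hf] at hjf
    have h1 := (dvd_add_right ((pow_dvd_pow p hj).trans he4)).1 hjf
    exact hp.pow_dvd_of_dvd_mul_right j (fun h2 => hb' (hp.dvd_of_dvd_pow h2)) h1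
  have f_of : ∀ j : ℕ, j ≤ 4 → p ^ j ∣ a → p ^ j ∣ f ^ 2 := fun j hj hja => by
    rw [hf]
    exact dvd_add ((pow_dvd_pow p hj).trans he4) (hja.mul_right _)
  have hpf : p ∣ f := hp.dvd_of_dvd_pow (by simpa using f_of 1 (by norm_num) (by simpa using hpa))
  have hp2a : p ^ 2 ∣ a := a_of 2 (by norm_num) (pow_dvd_pow_of_dvd hpf 2)
  have hp3a : ¬ p ^ 3 ∣ a := fun h3 => by
    have h4 := sq_dvd_of_cube_dvd_sq hp (f_of 3 (by norm_num) h3)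
    have h5 : p ^ 4 ∣ f ^ 2 := by
      have := pow_dvd_pow_of_dvd h4 2
      rwa [← pow_mul] at this
    exact hp.not_isUnit (ha p (a_of 4 le_rfl h5))
  have hA2 : p ^ 2 ∣ A ^ 2 := pow_dvd_pow_of_dvd hpA 2
  have hZ2 : p ^ 2 ∣ A ^ 2 - a * b ^ 4 := dvd_sub hA2 (hp2a.mul_right _)
  have hw3 : p ^ 3 ∣ w ^ 2 := by
    rw [h.eq, show p ^ 3 = p * p ^ 2 by ring]
    exact mul_dvd_mul hpA (dvd_add hA2 (hp2a.mul_right _))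
  have hw : p ^ 2 ∣ w := sq_dvd_of_cube_dvd_sq hp hw3
  have hD : p ^ 2 ∣ D := h.dvd_of_dvd hZ2 (hw.mul_left _)
  have hZ3 : p ^ 3 ∣ A ^ 2 - a * b ^ 4 := by
    rw [h.num, show p ^ 3 = p ^ 2 * p by ring]
    exact mul_dvd_mul hD hpe
  have hw4 : p ^ 4 ∣ w ^ 2 := by
    have := pow_dvd_pow_of_dvd hw 2
    rwa [← pow_mul] at this
  have h2A : p ^ 4 ∣ 2 * A ^ 3 := by
    have : 2 * A ^ 3 = w ^ 2 + A * (A ^ 2 - a * b ^ 4) := by linear_combination (-1) * h.eq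
    rw [this]
    refine dvd_add hw4 ?_
    rw [show p ^ 4 = p * p ^ 3 by ring]
    exact mul_dvd_mul hpA hZ3
  have hA3 : p ^ 4 ∣ A ^ 3 := hp.pow_dvd_of_dvd_mul_left 4 hp2 h2A
  have hA4 : p ^ 3 ∣ A ^ 2 := by
    have := pow_dvd_pow_of_dvd (sq_dvd_of_pow_four_dvd_cube hp hA3) 2
    rw [← pow_mul] at this
    exact (pow_dvd_pow p (by norm_num)).trans this
  have : p ^ 3 ∣ a * b ^ 4 := by
    have := dvd_sub hA4 hZ3
    rwa [sub_sub_cancel] at this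
  exact hp3a (hp.pow_dvd_of_dvd_mul_right 3 (fun h2 => hb (hp.dvd_of_dvd_pow h2)) this)

/-- If A and b have opposite parity, De = A² − ab⁴ is odd while Db' = 2bw is even. If both are odd,
w is even, so 4 divides D and both A² ± ab⁴, hence 4 ∣ 2A². Coprimality excludes the remaining case.
-/
theorem not_all_odd (h : DoublingData a A b w D e b') (ha : Odd a) (hb' : Odd b') : False := by
  have hw := h.eq
  have hn := h.num
  have hd := h.den
  by_cases hA : Even A
  · have hb : Odd b := by
      by_contra hb
      rw [Int.not_odd_iff_even] at hb
      exact Int.prime_two.not_isUnit (h.coprime.isUnit_of_dvd' hA.two_dvd hb.two_dvd)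
    have h1 : Odd (A ^ 2 - a * b ^ 4) :=
      (Int.even_pow.2 ⟨hA, two_ne_zero⟩).sub_odd (ha.mul hb.pow)
    rw [hn, Int.odd_mul] at h1
    have : Even (D * b') := ⟨b * w, by rw [← hd]; ring⟩
    rcases Int.even_mul.1 this with h2 | h2
    · exact (Int.not_even_iff_odd.2 h1.1) h2
    · exact (Int.not_even_iff_odd.2 hb') h2
  · rw [Int.not_even_iff_odd] at hA
    by_cases hb : Even b
    · have h1 : Odd (A ^ 2 - a * b ^ 4) := by
        simp [Int.odd_sub, Int.odd_pow, Int.even_pow, hA, hb]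
      rw [hn, Int.odd_mul] at h1
      have : Even (D * b') := ⟨b * w, by rw [← hd]; ring⟩
      rcases Int.even_mul.1 this with h2 | h2
      · exact (Int.not_even_iff_odd.2 h1.1) h2
      · exact (Int.not_even_iff_odd.2 hb') h2
    · rw [Int.not_even_iff_odd] at hb
      have hev : Even (A ^ 2 + a * b ^ 4) := by
        simp [Int.even_add, Int.even_mul, Int.even_pow, Int.not_even_iff_odd.2 hA,
          Int.not_even_iff_odd.2 hb, Int.not_even_iff_odd.2 ha]
      have hwe : Even w := by
        have : Even (w ^ 2) := by rw [hw]; exact hev.mul_left _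
        exact (Int.even_pow.1 this).1
      obtain ⟨v, rfl⟩ := hwe.two_dvd
      have h4 : (4 : ℤ) ∣ A ^ 2 + a * b ^ 4 := by
        have hc : IsCoprime (4 : ℤ) A := by
          have : IsCoprime (2 : ℤ) A := Int.prime_two.coprime_iff_not_dvd.2 (by
            rwa [← even_iff_two_dvd, Int.not_even_iff_odd])
          have := this.pow_left (m := 2)
          norm_num at this
          exact this
        exact hc.dvd_of_dvd_mul_left ⟨v ^ 2, by rw [← hw]; ring⟩
      have h4D : (4 : ℤ) ∣ D := by
        have hc : IsCoprime (4 : ℤ) b' := by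
          have : IsCoprime (2 : ℤ) b' := Int.prime_two.coprime_iff_not_dvd.2 (by
            rwa [← even_iff_two_dvd, Int.not_even_iff_odd])
          have := this.pow_left (m := 2)
          norm_num at this
          exact this
        exact hc.dvd_of_dvd_mul_right ⟨b * v, by rw [← hd]; ring⟩
      have h4Z : (4 : ℤ) ∣ A ^ 2 - a * b ^ 4 := by rw [hn]; exact h4D.mul_right _
      have h42 : (4 : ℤ) ∣ 2 * A ^ 2 := by
        have := dvd_add h4 h4Z
        rwa [show A ^ 2 + a * b ^ 4 + (A ^ 2 - a * b ^ 4) = 2 * A ^ 2 by ring] at this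
      have : (2 : ℤ) ∣ A ^ 2 := by
        rw [show (4 : ℤ) = 2 * 2 by norm_num] at h42
        exact (mul_dvd_mul_iff_left two_ne_zero).1 h42
      have := Int.prime_two.dvd_of_dvd_pow this
      rw [← even_iff_two_dvd] at this
      exact (Int.not_even_iff_odd.2 hA) this

variable {f D₂ e₂ b₂ : ℤ}

/-- If a second doubling cancels a factor of `2`, the first numerator is even and `4 ∥ a`. -/
theorem even_of_even (ha : FourthPowerFree a) (h : DoublingData a A b w D e b')
    (h₂ : DoublingData a (e ^ 2) b' (e * f) D₂ e₂ b₂) (hf : f ^ 2 = e ^ 4 + a * b' ^ 4)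
    (hD : Even D₂) : Even e ∧ Odd b' ∧ a % 8 = 4 := by
  have hn := h₂.num
  have hev : Even ((e ^ 2) ^ 2 - a * b' ^ 4) := by rw [hn]; exact hD.mul_right _
  have he : Even e := by
    by_contra he
    have h1 : Odd a ∧ Odd b' := by
      simpa [Int.even_sub, Int.even_mul, Int.even_pow, he, not_or] using hev
    exact h.not_all_odd h1.1 h1.2
  have hb : Odd b' := by
    by_contra hb
    rw [Int.not_odd_iff_even] at hb
    exact Int.prime_two.not_isUnit (h.coprime'.isUnit_of_dvd' he.two_dvd hb.two_dvd)
  refine ⟨he, hb, ?_⟩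
  have hae : Even a := by
    have h1 : Even a ∨ Even b' := by
      simpa [Int.even_sub, Int.even_mul, Int.even_pow, he] using hev
    exact h1.resolve_right (Int.not_even_iff_odd.2 hb)
  obtain ⟨x, rfl⟩ := he.two_dvd
  obtain ⟨y, rfl⟩ := hb
  have hfe : Even f := by
    have : Even (f ^ 2) := by
      rw [hf]; exact (Int.even_pow.2 ⟨⟨x, by ring⟩, four_ne_zero⟩).add (hae.mul_right _)
    exact (Int.even_pow.1 this).1
  obtain ⟨z, rfl⟩ := hfe.two_dvd
  have ho : Odd ((2 * y + 1) ^ 4) := (odd_two_mul_add_one y).pow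
  obtain ⟨t, ht⟩ := ho
  rw [ht] at hf
  have h4 : (4 : ℤ) ∣ a := by
    obtain ⟨a', rfl⟩ := hae.two_dvd
    have : (2 : ℤ) ∣ a' := ⟨z ^ 2 - 4 * x ^ 4 - a' * t, by linarith [hf]⟩
    rw [show (4 : ℤ) = 2 * 2 by norm_num]
    exact mul_dvd_mul_left 2 this
  obtain ⟨a', rfl⟩ := h4
  -- If 8 ∣ a, then f² = e⁴ + ab'⁴ with e even and b' odd pushes the divisibility to 16 ∣ a.
  have ha' : ¬ (2 : ℤ) ∣ a' := by
    rintro ⟨a'', rfl⟩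
    have hz : Even z := by
      have : Even (z ^ 2) := ⟨2 * x ^ 4 + a'' * (2 * t + 1), by linarith [hf]⟩
      exact (Int.even_pow.1 this).1
    obtain ⟨z', rfl⟩ := hz.two_dvd
    have : (2 : ℤ) ∣ a'' := ⟨z' ^ 2 - x ^ 4 - a'' * t, by linarith [hf]⟩
    obtain ⟨a3, rfl⟩ := this
    have := ha 2 ⟨a3, by ring⟩
    exact Int.prime_two.not_isUnit this
  omega

/-- Congruence of the numerator when the second doubling cancels a factor `2`. -/
theorem num_mod_eight {a e b : ℤ} (he : Even e) (hb : Odd b) (ha : a % 8 = 4) :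
    (e ^ 4 - a * b ^ 4) % 8 = 4 := by
  obtain ⟨x, rfl⟩ := he.two_dvd
  obtain ⟨t, ht⟩ : Odd (b ^ 4) := hb.pow
  obtain ⟨q, hq⟩ : ∃ q, a = 8 * q + 4 := ⟨a / 8, by omega⟩
  rw [ht, hq]
  have : (2 * x) ^ 4 - (8 * q + 4) * (2 * t + 1) =
      4 + 8 * (2 * x ^ 4 - 2 * q * t - q - t - 1) := by ring
  rw [this]
  omega

/-- The cancellation in doubling a double divides `4`. -/
theorem dvd_four (ha : FourthPowerFree a) (h : DoublingData a A b w D e b')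
    (h₂ : DoublingData a (e ^ 2) b' (e * f) D₂ e₂ b₂) (hf : f ^ 2 = e ^ 4 + a * b' ^ 4)
    (hD₂ : D₂ ≠ 0) : D₂ ∣ 4 := by
  have h2a := h₂.dvd_two_mul hD₂
  -- An odd prime dividing D₂ would divide a and e, so D₂ is a power of 2 up to sign.
  have hodd : ∀ p : ℕ, p.Prime → p ∣ D₂.natAbs → p = 2 := by
    intro p hp hpD
    by_contra hp2
    have hpZ : Prime (p : ℤ) := Nat.prime_iff_prime_int.1 hp
    have hpD' : (p : ℤ) ∣ D₂ := Int.natCast_dvd.2 hpD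
    have hn2 : ¬ (p : ℤ) ∣ 2 := fun h => hp2 ((Nat.prime_dvd_prime_iff_eq hp Nat.prime_two).1
      (by exact_mod_cast h))
    have hpa : (p : ℤ) ∣ a := (hpZ.dvd_or_dvd (hpD'.trans h2a)).resolve_left hn2
    have hpe : (p : ℤ) ∣ e := by
      have h1 : (p : ℤ) ∣ (e ^ 2) ^ 2 - a * b' ^ 4 := h₂.num ▸ hpD'.mul_right _
      have h2 := (dvd_sub_left (hpa.mul_right (b' ^ 4))).1 h1
      exact hpZ.dvd_of_dvd_pow (hpZ.dvd_of_dvd_pow h2)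
    exact h.not_dvd_of_odd_prime ha hf hpZ hn2 hpe hpa
  have hpow := Nat.eq_prime_pow_of_unique_prime_dvd (Int.natAbs_ne_zero.2 hD₂)
    (fun {d} hd hdd => hodd d hd hdd)
  set j := D₂.natAbs.primeFactorsList.length
  -- The numerator D₂e₂ is 4 modulo 8 when D₂ is even, so 8 ∤ D₂.
  have hj : j ≤ 2 := by
    by_contra hj
    have h8 : (8 : ℤ) ∣ D₂ := by
      rw [← Int.dvd_natAbs, hpow]
      exact_mod_cast pow_dvd_pow 2 (show 3 ≤ j by omega)
    obtain ⟨he, hb, ha8⟩ := h.even_of_even ha h₂ hf (even_iff_two_dvd.2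
      ((by norm_num : (2 : ℤ) ∣ 8).trans h8))
    have h1 := num_mod_eight he hb ha8
    have h2 : (8 : ℤ) ∣ e ^ 4 - a * b' ^ 4 := by
      have := h8.mul_right e₂
      rwa [← h₂.num, ← pow_mul] at this
    omega
  rw [← Int.natAbs_dvd, hpow]
  exact_mod_cast pow_dvd_pow 2 hj

variable {f₂ D₃ e₃ b₃ : ℤ}

/-- No cancellation occurs in the third doubling. -/
theorem isUnit_factor (ha : FourthPowerFree a) (h : DoublingData a A b w D e b')
    (h₂ : DoublingData a (e ^ 2) b' (e * f) D₂ e₂ b₂) (hf : f ^ 2 = e ^ 4 + a * b' ^ 4)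
    (h₃ : DoublingData a (e₂ ^ 2) b₂ (e₂ * f₂) D₃ e₃ b₃) (hf₂ : f₂ ^ 2 = e₂ ^ 4 + a * b₂ ^ 4)
    (hD₃ : D₃ ≠ 0) : IsUnit D₃ := by
  have h4 := h₂.dvd_four ha h₃ hf₂ hD₃
  have hodd : ¬ Even D₃ := by
    intro hev
    -- An even D₃ makes e₂ even and a ≡ 4 mod 8. If e is even, then 4 ∣ D₂, so 8 ∣ D₂e₂, although
    -- this numerator is 4 modulo 8. If e is odd, D₂e₂ is odd.
    obtain ⟨he2, -, ha8⟩ := h₂.even_of_even ha h₃ hf₂ hev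
    have hn := h₂.num
    by_cases he : Even e
    · have hb : Odd b' := by
        by_contra hb
        rw [Int.not_odd_iff_even] at hb
        exact Int.prime_two.not_isUnit (h.coprime'.isUnit_of_dvd' he.two_dvd hb.two_dvd)
      have h8 := num_mod_eight he hb ha8
      rw [← pow_mul] at hn
      norm_num at hn
      have hD4 : (4 : ℤ) ∣ D₂ := by
        refine h₂.dvd_of_dvd ?_ ?_
        · rw [← pow_mul]; norm_num; omega
        · obtain ⟨x, rfl⟩ := he.two_dvd
          exact ⟨b' * x * f, by ring⟩
      obtain ⟨u, rfl⟩ := hD4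
      obtain ⟨v, rfl⟩ := he2.two_dvd
      rw [hn, show 4 * u * (2 * v) = 8 * (u * v) by ring] at h8
      omega
    · have h1 : Odd ((e ^ 2) ^ 2 - a * b' ^ 4) := by
        have : Even a := even_iff_two_dvd.2 (by omega)
        rw [Int.not_even_iff_odd] at he
        exact (he.pow.pow).sub_even (this.mul_right _)
      rw [hn, Int.odd_mul] at h1
      exact (Int.not_even_iff_odd.2 h1.2) he2
  have hc : IsCoprime D₃ 2 := (Int.prime_two.coprime_iff_not_dvd.2 (by
    rwa [← even_iff_two_dvd])).symm
  have h4' : D₃ ∣ 2 * (2 * 1) := by norm_num; exact h4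
  exact isUnit_of_dvd_one (hc.dvd_of_dvd_mul_left (hc.dvd_of_dvd_mul_left h4'))

end DoublingData

end IntegerDoubling

/-! ### Lowest terms and real size estimates for doubling -/

section RationalPoints

variable {a : ℤ} {Q : (curve (a : ℚ)).toAffine.Point}

theorem isCoprime_num_den (q : ℚ) : IsCoprime q.num (q.den : ℤ) :=
  Int.isCoprime_iff_gcd_eq_one.2 q.reduced

/-- A rational point has `x = A / b²` and `x³ + a x = (w / b³)²` in lowest terms. -/
theorem exists_sq_den (Q : (curve (a : ℚ)).toAffine.Point) :
    ∃ b w : ℤ, ((xCoord Q).den : ℤ) = b ^ 2 ∧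
      w ^ 2 = (xCoord Q).num * ((xCoord Q).num ^ 2 + a * b ^ 4) := by
  have he := equation_coords' Q
  set x := xCoord Q
  set y := yCoord Q
  have hB : (x.den : ℤ) ≠ 0 := by exact_mod_cast x.den_ne_zero
  have hs : (y.den : ℤ) ≠ 0 := by exact_mod_cast y.den_ne_zero
  have heq : y.num ^ 2 * (x.den : ℤ) ^ 3 =
      (y.den : ℤ) ^ 2 * (x.num * (x.num ^ 2 + a * (x.den : ℤ) ^ 2)) := by
    have h1 : (y.num : ℚ) = y * y.den := (Rat.mul_den_eq_num y).symm
    have h2 : (x.num : ℚ) = x * x.den := (Rat.mul_den_eq_num x).symm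
    have : ((y.num ^ 2 * (x.den : ℤ) ^ 3 : ℤ) : ℚ) =
        (((y.den : ℤ) ^ 2 * (x.num * (x.num ^ 2 + a * (x.den : ℤ) ^ 2)) : ℤ) : ℚ) := by
      push_cast
      rw [h1, h2]
      linear_combination (y.den : ℚ) ^ 2 * (x.den : ℚ) ^ 3 * he
    exact_mod_cast this
  -- The numerator x(x² + a), cleared by den(x)³, is prime to den(x). Hence den(y)² = den(x)³, which
  -- makes den(x) a square.
  have hcop : IsCoprime ((x.den : ℤ) ^ 3) (x.num * (x.num ^ 2 + a * (x.den : ℤ) ^ 2)) := by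
    have h1 : IsCoprime (x.den : ℤ) x.num := (isCoprime_num_den x).symm
    have h2 : IsCoprime (x.den : ℤ) (x.num ^ 2 + a * (x.den : ℤ) ^ 2) := by
      rw [show x.num ^ 2 + a * (x.den : ℤ) ^ 2 =
        x.num ^ 2 + (x.den : ℤ) * (a * (x.den : ℤ)) by ring]
      exact h1.pow_right.add_mul_left_right _
    exact (h1.mul_right h2).pow_left
  have d1 : (x.den : ℤ) ^ 3 ∣ (y.den : ℤ) ^ 2 :=
    hcop.dvd_of_dvd_mul_right ⟨y.num ^ 2, by rw [← heq]; ring⟩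
  have d2 : (y.den : ℤ) ^ 2 ∣ (x.den : ℤ) ^ 3 :=
    ((isCoprime_num_den y).symm.pow (m := 2) (n := 2)).dvd_of_dvd_mul_left ⟨_, heq⟩
  have hs2 : (y.den : ℤ) ^ 2 = (x.den : ℤ) ^ 3 :=
    Int.dvd_antisymm (by positivity) (by positivity) d2 d1
  obtain ⟨b, hb⟩ : (x.den : ℤ) ∣ (y.den : ℤ) :=
    (Int.pow_dvd_pow_iff two_ne_zero).1 (by rw [hs2]; exact pow_dvd_pow _ (by norm_num))
  have hb2 : (x.den : ℤ) = b ^ 2 := by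
    apply mul_left_cancel₀ (pow_ne_zero 2 hB)
    rw [hb] at hs2
    linear_combination (-1) * hs2
  refine ⟨b, y.num, hb2, ?_⟩
  apply mul_right_cancel₀ (pow_ne_zero 3 hB)
  rw [heq, hs2, show b ^ 4 = (b ^ 2) ^ 2 by ring, ← hb2]
  ring

theorem xCoord_ne_zero (hy : yCoord Q ≠ 0) : xCoord Q ≠ 0 := by
  intro hx
  have := equation_coords' Q
  rw [hx] at this
  exact hy (by simpa using this)

/-- Here x(2Q) = ((A² − ab⁴)/(2bw))², and D is the gcd of these two integers. A double therefore has
square numerator and square denominator. -/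
theorem exists_doublingData (hQ : Q ≠ 0) (hy : yCoord Q ≠ 0) {b w : ℤ}
    (hb : ((xCoord Q).den : ℤ) = b ^ 2)
    (hw : w ^ 2 = (xCoord Q).num * ((xCoord Q).num ^ 2 + a * b ^ 4)) :
    ∃ D e b' : ℤ, DoublingData a (xCoord Q).num b w D e b' ∧ D ≠ 0 ∧
      (xCoord (2 • Q)).num = e ^ 2 ∧ ((xCoord (2 • Q)).den : ℤ) = b' ^ 2 := by
  have hd := four_mul_sq_mul_xCoord_double hQ hy
  have he := equation_coords hQ
  set x := xCoord Q
  set y := yCoord Q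
  have hb0 : b ≠ 0 := by
    rintro rfl
    have : (x.den : ℤ) ≠ 0 := by exact_mod_cast x.den_ne_zero
    exact this (by simpa using hb)
  have hx : x = x.num / (b : ℚ) ^ 2 := by
    have h1 : (x.den : ℚ) = (b : ℚ) ^ 2 := by exact_mod_cast hb
    rw [← h1, Rat.num_div_den]
  have hwq : (w : ℚ) ^ 2 = x.num * ((x.num : ℚ) ^ 2 + a * (b : ℚ) ^ 4) := by exact_mod_cast hw
  generalize hA : x.num = A at *
  have hbq : (b : ℚ) ≠ 0 := by exact_mod_cast hb0
  have hyw : y ^ 2 * (b : ℚ) ^ 6 = (w : ℚ) ^ 2 := by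
    rw [he, hwq, hx]; field_simp
  have hw0 : w ≠ 0 := by
    rintro rfl
    have : y ^ 2 * (b : ℚ) ^ 6 ≠ 0 := by positivity
    exact this (by rw [hyw]; simp)
  have hden : 2 * b * w ≠ 0 := by positivity
  obtain ⟨e, b', hcop, h1, h2⟩ := Int.exists_gcd_one
    (Int.gcd_pos_of_ne_zero_right (A ^ 2 - a * b ^ 4) hden)
  generalize hD : ((Int.gcd (A ^ 2 - a * b ^ 4) (2 * b * w) : ℕ) : ℤ) = D at h1 h2
  have hD0 : D ≠ 0 := by
    rintro rfl
    exact hden (by rw [h2, mul_zero])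
  have hb'0 : b' ≠ 0 := by
    rintro rfl
    exact hden (by rw [h2, zero_mul])
  have hcop' : IsCoprime e b' := Int.isCoprime_iff_gcd_eq_one.2 hcop
  have hAb : IsCoprime A b := by
    have : IsCoprime A (b ^ 2) := by rw [← hb, ← hA]; exact isCoprime_num_den x
    exact (IsCoprime.pow_right_iff two_pos).1 this
  have hx2 : xCoord (2 • Q) = ((e ^ 2 : ℤ) : ℚ) / ((b' ^ 2 : ℤ) : ℚ) := by
    have hwq0 : (w : ℚ) ≠ 0 := by exact_mod_cast hw0
    have hb'q : (b' : ℚ) ≠ 0 := by exact_mod_cast hb'0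
    have hDq : (D : ℚ) ≠ 0 := by exact_mod_cast hD0
    have h1q : (A : ℚ) ^ 2 - a * (b : ℚ) ^ 4 = e * D := by exact_mod_cast h1
    have h2q : 2 * (b : ℚ) * w = b' * D := by exact_mod_cast h2
    push_cast
    rw [eq_div_iff (pow_ne_zero _ hb'q)]
    apply mul_right_cancel₀ (pow_ne_zero 2 hDq)
    rw [show xCoord (2 • Q) * (b' : ℚ) ^ 2 * (D : ℚ) ^ 2 = xCoord (2 • Q) * (b' * D) ^ 2 by ring,
      show (e : ℚ) ^ 2 * (D : ℚ) ^ 2 = (e * D) ^ 2 by ring, ← h1q, ← h2q]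
    have h8 : x ^ 2 - a = (A ^ 2 - a * (b : ℚ) ^ 4) / (b : ℚ) ^ 4 := by
      rw [hx]; field_simp
    rw [h8] at hd
    have h9 : 4 * y ^ 2 * xCoord (2 • Q) * (b : ℚ) ^ 8 =
        ((A : ℚ) ^ 2 - a * (b : ℚ) ^ 4) ^ 2 := by
      rw [hd]; field_simp
    rw [← h9]
    linear_combination (-4) * xCoord (2 • Q) * (b : ℚ) ^ 2 * hyw
  have hpos : 0 < b' ^ 2 := by positivity
  have hcop2 : Nat.Coprime (e ^ 2).natAbs (b' ^ 2).natAbs :=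
    Int.isCoprime_iff_gcd_eq_one.1 (hcop'.pow (m := 2) (n := 2))
  refine ⟨D, e, b', ⟨hAb, hw, by rw [h1]; ring, by rw [h2]; ring, hcop'⟩, hD0, ?_, ?_⟩
  · rw [hx2, Rat.num_div_eq_of_coprime hpos hcop2]
  · rw [hx2, Rat.den_div_eq_of_coprime hpos hcop2]

/-- Rescaled `ℓ¹`-size of a point. -/
noncomputable def sizeOne (Q : (curve (a : ℚ)).toAffine.Point) : ℝ :=
  |((xCoord Q).num : ℝ)| + √|(a : ℝ)| * (xCoord Q).den

/-- Square of the rescaled `ℓ²`-size of a point. -/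
noncomputable def sizeTwo (Q : (curve (a : ℚ)).toAffine.Point) : ℝ :=
  ((xCoord Q).num : ℝ) ^ 2 + |(a : ℝ)| * ((xCoord Q).den : ℝ) ^ 2

/-- The two expressions are numerator plus rescaled denominator of a double, for a > 0 and a < 0.
They are symmetric in x and t, so t ≤ x may be assumed; the constant 8 is attained by the first one
at x = t. -/
theorem two_forms_le {x t : ℝ} (hx : 0 ≤ x) (ht : 0 ≤ t) :
    (x ^ 2 - t ^ 2) ^ 2 + 4 * x * t * (x ^ 2 + t ^ 2) ≤ (x + t) ^ 4 ∧
      (x ^ 2 - t ^ 2) ^ 2 + 4 * x * t * (x ^ 2 + t ^ 2) ≤ 8 * (max x t) ^ 4 ∧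
      (x ^ 2 + t ^ 2) ^ 2 + 4 * x * t * |x ^ 2 - t ^ 2| ≤ (x + t) ^ 4 ∧
      (x ^ 2 + t ^ 2) ^ 2 + 4 * x * t * |x ^ 2 - t ^ 2| ≤ 8 * (max x t) ^ 4 := by
  have key : ∀ {x t : ℝ}, 0 ≤ t → t ≤ x →
      (x ^ 2 - t ^ 2) ^ 2 + 4 * x * t * (x ^ 2 + t ^ 2) ≤ (x + t) ^ 4 ∧
      (x ^ 2 - t ^ 2) ^ 2 + 4 * x * t * (x ^ 2 + t ^ 2) ≤ 8 * x ^ 4 ∧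
      (x ^ 2 + t ^ 2) ^ 2 + 4 * x * t * (x ^ 2 - t ^ 2) ≤ (x + t) ^ 4 ∧
      (x ^ 2 + t ^ 2) ^ 2 + 4 * x * t * (x ^ 2 - t ^ 2) ≤ 8 * x ^ 4 := by
    intro x t ht hxt
    have hx : 0 ≤ x := ht.trans hxt
    have h1 : 0 ≤ x ^ 2 * t ^ 2 := by positivity
    have h2 : 0 ≤ x * t ^ 3 := by positivity
    have h3 : 0 ≤ (x - t) * (7 * x ^ 3 + 3 * x ^ 2 * t + 5 * x * t ^ 2 + t ^ 3) :=
      mul_nonneg (sub_nonneg.2 hxt) (by positivity)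
    have h4 : 0 ≤ (x - t) * (7 * x ^ 3 + 3 * x ^ 2 * t + x * t ^ 2 + t ^ 3) :=
      mul_nonneg (sub_nonneg.2 hxt) (by positivity)
    have h5 : 0 ≤ t ^ 3 * x := by positivity
    refine ⟨?_, ?_, ?_, ?_⟩ <;> nlinarith
  rcases le_total t x with h | h
  · rw [max_eq_left h, abs_of_nonneg (by nlinarith)]
    exact key ht h
  · have := key hx h
    rw [max_eq_right h, abs_of_nonpos (by nlinarith)]
    refine ⟨?_, ?_, ?_, ?_⟩
    · convert this.1 using 1 <;> ring
    · convert this.2.1 using 1; ring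
    · convert this.2.2.1 using 1 <;> ring
    · convert this.2.2.2 using 1; ring

/-- With Y = √|α|·B the formulas no longer depend on |α|, and the sign of α selects one of the two
forms. The last inequality bounds a double from below before cancellation. -/
theorem real_doubling_bounds {α X B : ℝ} (hB : 0 ≤ B) (hpos : 0 ≤ X * (X ^ 2 + α * B ^ 2)) :
    (X ^ 2 - α * B ^ 2) ^ 2 + √|α| * (4 * B * (X * (X ^ 2 + α * B ^ 2))) ≤
        (|X| + √|α| * B) ^ 4 ∧
      (X ^ 2 - α * B ^ 2) ^ 2 + √|α| * (4 * B * (X * (X ^ 2 + α * B ^ 2))) ≤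
        8 * (max |X| (√|α| * B)) ^ 4 ∧
      (X ^ 2 + |α| * B ^ 2) ^ 4 ≤ ((X ^ 2 - α * B ^ 2) ^ 2) ^ 2 +
        |α| * (4 * B * (X * (X ^ 2 + α * B ^ 2))) ^ 2 := by
  have hs : √|α| ^ 2 = |α| := Real.sq_sqrt (abs_nonneg α)
  have hs0 : 0 ≤ √|α| := Real.sqrt_nonneg _
  have hpos' : X * (X ^ 2 + α * B ^ 2) = |X| * |X ^ 2 + α * B ^ 2| := by
    rw [← abs_mul, abs_of_nonneg hpos]
  have hXX : X ^ 2 = |X| ^ 2 := (sq_abs X).symm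
  have hX0 := abs_nonneg X
  set Y := √|α| * B with hY
  have hY0 : 0 ≤ Y := mul_nonneg hs0 hB
  have hY2 : Y ^ 2 = |α| * B ^ 2 := by rw [hY, mul_pow, hs]
  have e1 : √|α| * (4 * B * (X * (X ^ 2 + α * B ^ 2))) = 4 * |X| * Y * |X ^ 2 + α * B ^ 2| := by
    rw [hpos', hY]; ring
  have e2 : |α| * (4 * B * (X * (X ^ 2 + α * B ^ 2))) ^ 2 =
      16 * |X| ^ 2 * Y ^ 2 * (X ^ 2 + α * B ^ 2) ^ 2 := by
    rw [hpos', hY2]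
    linear_combination 16 * |α| * B ^ 2 * |X| ^ 2 * sq_abs (X ^ 2 + α * B ^ 2)
  rw [e1, e2, ← hY2, hXX]
  generalize |X| = x at *
  obtain ⟨t1, t2, t3, t4⟩ := two_forms_le hX0 hY0
  rcases abs_cases α with ⟨h1, -⟩ | ⟨h1, -⟩
  · have : α * B ^ 2 = Y ^ 2 := by rw [hY2, h1]
    rw [this, abs_of_nonneg (by positivity : 0 ≤ x ^ 2 + Y ^ 2)]
    refine ⟨t1, t2, ?_⟩
    · nlinarith [mul_nonneg (sq_nonneg (x ^ 2 + Y ^ 2)) (mul_nonneg (sq_nonneg x) (sq_nonneg Y)),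
        mul_nonneg (mul_nonneg (sq_nonneg x) (sq_nonneg Y))
          (mul_nonneg (sq_nonneg x) (sq_nonneg Y))]
  · have : α * B ^ 2 = -Y ^ 2 := by rw [hY2, h1]; ring
    have h2 : (x ^ 2 - -Y ^ 2) ^ 2 = (x ^ 2 + Y ^ 2) ^ 2 := by ring
    rw [this, h2, ← sub_eq_add_neg]
    refine ⟨t3, t4, ?_⟩
    have := mul_nonneg (mul_nonneg (sq_nonneg x) (sq_nonneg Y)) (sq_nonneg (x ^ 2 - Y ^ 2))
    have h3 : ((x ^ 2 + Y ^ 2) ^ 2) ^ 2 = (x ^ 2 + Y ^ 2) ^ 4 := by ring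
    rw [h3]
    linarith

end RationalPoints

/-! ### Comparison of naive and canonical height -/

section Heights

variable {a : ℤ} {P Q R : (curve (a : ℚ)).toAffine.Point}

/-- Numerator and denominator of the double, before cancellation, are D²e² and D²b'². This explains
D² for the linear size and D⁴ for the quadratic one. -/
theorem size_double {b w D e b' : ℤ}
    (hb : ((xCoord Q).den : ℤ) = b ^ 2)
    (h : DoublingData a (xCoord Q).num b w D e b')
    (hn : (xCoord R).num = e ^ 2) (hd : ((xCoord R).den : ℤ) = b' ^ 2) :
    sizeOne R * (D : ℝ) ^ 2 ≤ sizeOne Q ^ 4 ∧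
      sizeOne R * (D : ℝ) ^ 2 ≤
        8 * max |((xCoord Q).num : ℝ)| (√|(a : ℝ)| * (xCoord Q).den) ^ 4 ∧
      sizeTwo Q ^ 4 ≤ sizeTwo R * (D : ℝ) ^ 4 := by
  have hbr : ((xCoord Q).den : ℝ) = (b : ℝ) ^ 2 := by exact_mod_cast hb
  have hnr : ((xCoord R).num : ℝ) = (e : ℝ) ^ 2 := by exact_mod_cast hn
  have hdr : ((xCoord R).den : ℝ) = (b' : ℝ) ^ 2 := by exact_mod_cast hd
  have h1 : (w : ℝ) ^ 2 = (xCoord Q).num * (((xCoord Q).num : ℝ) ^ 2 + a * (b : ℝ) ^ 4) := by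
    exact_mod_cast h.eq
  have h2 : ((xCoord Q).num : ℝ) ^ 2 - a * (b : ℝ) ^ 4 = D * e := by exact_mod_cast h.num
  have h3 : 2 * (b : ℝ) * w = D * b' := by exact_mod_cast h.den
  have hpos : 0 ≤ ((xCoord Q).num : ℝ) * (((xCoord Q).num : ℝ) ^ 2 + a * ((b : ℝ) ^ 2) ^ 2) := by
    rw [← pow_mul, ← h1]; positivity
  obtain ⟨t1, t2, t3⟩ := real_doubling_bounds (sq_nonneg (b : ℝ)) hpos
  have e1 : (((xCoord Q).num : ℝ) ^ 2 - a * ((b : ℝ) ^ 2) ^ 2) ^ 2 = e ^ 2 * D ^ 2 := by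
    rw [← pow_mul, h2]; ring
  have e2 : 4 * (b : ℝ) ^ 2 *
      ((xCoord Q).num * (((xCoord Q).num : ℝ) ^ 2 + a * ((b : ℝ) ^ 2) ^ 2)) = b' ^ 2 * D ^ 2 := by
    rw [← pow_mul, ← h1]
    linear_combination (2 * (b : ℝ) * w + D * b') * h3
  rw [e1, e2] at t1 t2 t3
  unfold sizeOne sizeTwo
  rw [hbr, hnr, hdr, abs_of_nonneg (sq_nonneg (e : ℝ))]
  refine ⟨le_trans (le_of_eq ?_) t1, le_trans (le_of_eq ?_) t2, t3.trans (le_of_eq ?_)⟩ <;> ring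

theorem FourthPowerFree.ne_zero (ha : FourthPowerFree a) : a ≠ 0 := by
  rintro rfl
  simpa using ha 0 (dvd_zero _)

theorem one_le_den (q : ℚ) : (1 : ℝ) ≤ q.den := by exact_mod_cast q.pos

theorem one_le_sqrt_abs (ha : a ≠ 0) : 1 ≤ √|(a : ℝ)| := by
  rw [Real.one_le_sqrt]
  exact_mod_cast Int.one_le_abs ha

theorem one_le_sizeOne (ha : a ≠ 0) (Q : (curve (a : ℚ)).toAffine.Point) : 1 ≤ sizeOne Q := by
  have := one_le_mul_of_one_le_of_one_le (one_le_sqrt_abs ha) (one_le_den (xCoord Q))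
  unfold sizeOne
  linarith [abs_nonneg ((xCoord Q).num : ℝ)]

theorem one_le_sizeTwo (ha : a ≠ 0) (Q : (curve (a : ℚ)).toAffine.Point) : 1 ≤ sizeTwo Q := by
  have h1 : 1 ≤ |(a : ℝ)| := by exact_mod_cast Int.one_le_abs ha
  have := one_le_mul_of_one_le_of_one_le h1 (one_le_pow₀ (n := 2) (one_le_den (xCoord Q)))
  unfold sizeTwo
  linarith [sq_nonneg ((xCoord Q).num : ℝ)]

theorem sizeTwo_le_sq (Q : (curve (a : ℚ)).toAffine.Point) : sizeTwo Q ≤ sizeOne Q ^ 2 := by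
  have h : 0 ≤ |((xCoord Q).num : ℝ)| * (√|(a : ℝ)| * (xCoord Q).den) := by positivity
  unfold sizeOne sizeTwo
  rw [add_sq, sq_abs, mul_pow, Real.sq_sqrt (abs_nonneg _)]
  linarith

/-- The multiplicative height. -/
noncomputable def mulSize (Q : (curve (a : ℚ)).toAffine.Point) : ℝ :=
  max |((xCoord Q).num : ℝ)| (xCoord Q).den

theorem naiveHeight_eq (Q : (curve (a : ℚ)).toAffine.Point) :
    naiveHeight Q = Real.log (mulSize Q) := by
  rw [naiveHeight, Rat.logHeight₁_eq_log_max, mulSize]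
  push_cast
  rw [Nat.cast_natAbs, Int.cast_abs]

theorem one_le_mulSize (Q : (curve (a : ℚ)).toAffine.Point) : 1 ≤ mulSize Q :=
  (one_le_den _).trans (le_max_right _ _)

theorem mulSize_sq_le (ha : a ≠ 0) (Q : (curve (a : ℚ)).toAffine.Point) :
    mulSize Q ^ 2 ≤ sizeTwo Q := by
  have h1 : 1 ≤ |(a : ℝ)| := by exact_mod_cast Int.one_le_abs ha
  have h2 := sq_nonneg ((xCoord Q).num : ℝ)
  have h3 := sq_nonneg ((xCoord Q).den : ℝ)
  unfold sizeTwo mulSize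
  rcases max_choice |((xCoord Q).num : ℝ)| ((xCoord Q).den : ℝ) with h | h <;> rw [h]
  · rw [sq_abs]; nlinarith
  · nlinarith

theorem max_le_mulSize (ha : a ≠ 0) (Q : (curve (a : ℚ)).toAffine.Point) :
    max |((xCoord Q).num : ℝ)| (√|(a : ℝ)| * (xCoord Q).den) ≤ √|(a : ℝ)| * mulSize Q := by
  have := one_le_sqrt_abs ha
  refine max_le ?_ (mul_le_mul_of_nonneg_left (le_max_right _ _) (by positivity))
  refine (le_max_left _ ((xCoord Q).den : ℝ)).trans ?_
  have h1 := one_le_mulSize Q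
  rw [mulSize] at *
  nlinarith

theorem sizeOne_le (Q : (curve (a : ℚ)).toAffine.Point) :
    sizeOne Q ≤ (1 + √|(a : ℝ)|) * mulSize Q := by
  have h1 : |((xCoord Q).num : ℝ)| ≤ mulSize Q := le_max_left _ _
  have h2 : √|(a : ℝ)| * ((xCoord Q).den : ℝ) ≤ √|(a : ℝ)| * mulSize Q :=
    mul_le_mul_of_nonneg_left (le_max_right _ _) (by positivity)
  unfold sizeOne
  linarith

theorem mulSize_le_sizeOne (ha : a ≠ 0) (Q : (curve (a : ℚ)).toAffine.Point) :
    mulSize Q ≤ sizeOne Q := by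
  have h := one_le_sqrt_abs ha
  have h2 := one_le_den (xCoord Q)
  unfold sizeOne
  refine max_le ?_ ?_
  · have : 0 ≤ √|(a : ℝ)| * (xCoord Q).den := by positivity
    linarith
  · nlinarith [abs_nonneg ((xCoord Q).num : ℝ)]

theorem infinite_nsmul (hQ : ¬ IsOfFinAddOrder Q) {n : ℕ} (hn : n ≠ 0) :
    ¬ IsOfFinAddOrder (n • Q) := by
  rw [isOfFinAddOrder_nsmul]
  tauto

theorem yCoord_ne_zero (hQ : ¬ IsOfFinAddOrder Q) : yCoord Q ≠ 0 := by
  have := yCoord_nsmul_ne_zero hQ (n := 1) one_ne_zero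
  rwa [one_nsmul] at this

theorem ne_zero_of_infinite (hQ : ¬ IsOfFinAddOrder Q) : Q ≠ 0 := by
  rintro rfl
  exact hQ IsOfFinAddOrder.zero

theorem one_le_sq_cast {D : ℤ} (hD : D ≠ 0) : (1 : ℝ) ≤ (D : ℝ) ^ 2 := by
  have : (1 : ℤ) ≤ D ^ 2 := Int.one_le_abs (pow_ne_zero 2 hD) |>.trans_eq (abs_of_nonneg (sq_nonneg D))
  exact_mod_cast this

theorem sizeOne_double (ha : a ≠ 0) (hQ : ¬ IsOfFinAddOrder Q) :
    sizeOne (2 • Q) ≤ sizeOne Q ^ 4 ∧ sizeOne (2 • Q) ≤ 8 * (√|(a : ℝ)| * mulSize Q) ^ 4 := by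
  obtain ⟨b, w, hb, hw⟩ := exists_sq_den Q
  have hQ0 := ne_zero_of_infinite hQ
  obtain ⟨D, e, b', h, hD, h1, h2⟩ := exists_doublingData hQ0 (yCoord_ne_zero hQ) hb hw
  obtain ⟨t1, t2, -⟩ := size_double hb h h1 h2
  have h3 : sizeOne (2 • Q) ≤ sizeOne (2 • Q) * (D : ℝ) ^ 2 :=
    le_mul_of_one_le_right (by linarith [one_le_sizeOne ha (2 • Q)]) (one_le_sq_cast hD)
  refine ⟨h3.trans t1, (h3.trans t2).trans ?_⟩
  have : 0 ≤ max |((xCoord Q).num : ℝ)| (√|(a : ℝ)| * (xCoord Q).den) :=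
    (abs_nonneg _).trans (le_max_left _ _)
  gcongr
  exact max_le_mulSize ha Q

theorem pow_four_le_of_dvd {D n : ℤ} (hn : n ≠ 0) (h : D ∣ n) : (D : ℝ) ^ 4 ≤ |(n : ℝ)| ^ 4 := by
  have h1 : |D| ≤ |n| := Int.le_of_dvd (abs_pos.2 hn) ((abs_dvd_abs _ _).2 h)
  have h2 : |(D : ℝ)| ≤ |(n : ℝ)| := by exact_mod_cast h1
  rw [← Even.pow_abs (by decide : Even 4) (D : ℝ)]
  gcongr

/-- In three consecutive doublings the cancellation is bounded by `2a`, `4` and `1`. -/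
theorem sizeTwo_doubles (ha : FourthPowerFree a) (hQ : ¬ IsOfFinAddOrder Q) :
    sizeTwo Q ^ 4 ≤ sizeTwo (2 • Q) * (2 * |(a : ℝ)|) ^ 4 ∧
      sizeTwo (2 • Q) ^ 4 ≤ sizeTwo (4 • Q) * 4 ^ 4 ∧
      sizeTwo (4 • Q) ^ 4 ≤ sizeTwo (8 • Q) := by
  have ha0 := ha.ne_zero
  have h24 : 2 • (2 • Q) = 4 • Q := smul_smul 2 2 Q
  have h48 : 2 • (4 • Q) = 8 • Q := smul_smul 2 4 Q
  have hQ2 := infinite_nsmul hQ (n := 2) two_ne_zero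
  have hQ4 := infinite_nsmul hQ (n := 4) four_ne_zero
  obtain ⟨b, w, hb, hw⟩ := exists_sq_den Q
  obtain ⟨D, e, b₁, h, hD, hn1, hd1⟩ :=
    exists_doublingData (ne_zero_of_infinite hQ) (yCoord_ne_zero hQ) hb hw
  -- From the second doubling on, the numerator is a square e², so w is divisible by e and w = ef
  -- with f² = e⁴ + ab⁴.
  have next : ∀ {R : (curve (a : ℚ)).toAffine.Point} {e b₁ : ℤ}, ¬ IsOfFinAddOrder R →
      (xCoord R).num = e ^ 2 → ((xCoord R).den : ℤ) = b₁ ^ 2 →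
      ∃ f D₂ e₂ b₂, f ^ 2 = e ^ 4 + a * b₁ ^ 4 ∧ DoublingData a (e ^ 2) b₁ (e * f) D₂ e₂ b₂ ∧
        D₂ ≠ 0 ∧ (xCoord (2 • R)).num = e₂ ^ 2 ∧ ((xCoord (2 • R)).den : ℤ) = b₂ ^ 2 := by
    intro R e b₁ hR hn hd
    have he : e ≠ 0 := by
      rintro rfl
      exact xCoord_ne_zero (yCoord_ne_zero hR) (Rat.num_eq_zero.1 (by rw [hn]; rfl))
    obtain ⟨c, w, hc, hw⟩ := exists_sq_den R
    have hcb : c ^ 4 = b₁ ^ 4 := by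
      rw [show c ^ 4 = (c ^ 2) ^ 2 by ring, ← hc, hd]; ring
    rw [hcb, hn] at hw
    obtain ⟨f, rfl⟩ : e ∣ w := (Int.pow_dvd_pow_iff two_ne_zero).1 ⟨_, hw⟩
    have hf : f ^ 2 = e ^ 4 + a * b₁ ^ 4 := by
      apply mul_left_cancel₀ (pow_ne_zero 2 he)
      linear_combination hw
    obtain ⟨D₂, e₂, b₂, h₂, hD₂, hn2, hd2⟩ :=
      exists_doublingData (ne_zero_of_infinite hR) (yCoord_ne_zero hR) hd (w := e * f)
        (by rw [hn]; exact hw)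
    rw [hn] at h₂
    exact ⟨f, D₂, e₂, b₂, hf, h₂, hD₂, hn2, hd2⟩
  obtain ⟨f, D₂, e₂, b₂, hf, h₂, hD₂, hn2, hd2⟩ := next hQ2 hn1 hd1
  rw [h24] at hn2 hd2
  obtain ⟨f₂, D₃, e₃, b₃, hf₂, h₃, hD₃, hn3, hd3⟩ := next hQ4 hn2 hd2
  rw [h48] at hn3 hd3
  obtain ⟨-, -, t1⟩ := size_double hb h hn1 hd1
  obtain ⟨-, -, t2⟩ := size_double hd1 (by rw [hn1]; exact h₂) hn2 hd2
  obtain ⟨-, -, t3⟩ := size_double hd2 (by rw [hn2]; exact h₃) hn3 hd3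
  have p : ∀ R : (curve (a : ℚ)).toAffine.Point, 0 ≤ sizeTwo R := fun R =>
    zero_le_one.trans (one_le_sizeTwo ha0 R)
  refine ⟨t1.trans (mul_le_mul_of_nonneg_left ?_ (p _)),
    t2.trans (mul_le_mul_of_nonneg_left ?_ (p _)), t3.trans (le_of_eq ?_)⟩
  · have := pow_four_le_of_dvd (by simpa using ha0) (h.dvd_two_mul hD)
    push_cast at this
    rwa [abs_mul, abs_two] at this
  · have := pow_four_le_of_dvd (by norm_num) (h.dvd_four ha h₂ hf hD₂)
    push_cast at this
    rwa [abs_of_pos (by norm_num : (0:ℝ) < 4)] at this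
  · rcases Int.isUnit_iff.1 (h.isUnit_factor ha h₂ hf h₃ hf₂ hD₃) with h | h <;> rw [h] <;> norm_num

/-- Since `sizeOne` of a double is at most its fourth power, log `sizeOne` (2^N P)/4^N decreases and
converges. The naive height differs from log `sizeOne` by a bounded amount, so it has the same
limit, and every term bounds 2ĥ from above. -/
theorem exists_tendsto_naiveHeight (ha : a ≠ 0) (hP : ¬ IsOfFinAddOrder P) :
    Tendsto (fun N : ℕ => naiveHeight (2 ^ N • P) / 4 ^ N) atTop
        (nhds (2 * canonicalHeight P)) ∧
      Tendsto (fun N : ℕ => Real.log (sizeOne (2 ^ N • P)) / 4 ^ N) atTop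
        (nhds (2 * canonicalHeight P)) ∧
      ∀ N : ℕ, 2 * canonicalHeight P ≤ Real.log (sizeOne (2 ^ N • P)) / 4 ^ N := by
  have hmono : Antitone (fun N : ℕ => Real.log (sizeOne (2 ^ N • P)) / 4 ^ N) := by
    apply antitone_nat_of_succ_le
    intro N
    rw [pow_succ 4, div_le_div_iff₀ (by positivity) (by positivity)]
    have h1 := (sizeOne_double ha (infinite_nsmul hP (n := 2 ^ N) (by positivity))).1
    rw [smul_smul, ← pow_succ'] at h1
    have h2 := Real.log_le_log (zero_lt_one.trans_le (one_le_sizeOne ha _)) h1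
    rw [Real.log_pow] at h2
    push_cast at h2
    have h4 : (0 : ℝ) < 4 ^ N := by positivity
    nlinarith
  have hbdd : BddBelow (Set.range fun N : ℕ => Real.log (sizeOne (2 ^ N • P)) / 4 ^ N) :=
    ⟨0, by
      rintro _ ⟨N, rfl⟩
      exact div_nonneg (Real.log_nonneg (one_le_sizeOne ha _)) (by positivity)⟩
  have hlim := tendsto_atTop_ciInf hmono hbdd
  set L := ⨅ N : ℕ, Real.log (sizeOne (2 ^ N • P)) / 4 ^ N
  have h4 : Tendsto (fun N : ℕ => (4 : ℝ) ^ N) atTop atTop :=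
    tendsto_pow_atTop_atTop_of_one_lt (by norm_num)
  have hlim2 : Tendsto (fun N : ℕ => naiveHeight (2 ^ N • P) / 4 ^ N) atTop (nhds L) := by
    have h0 : Tendsto (fun N : ℕ => Real.log (1 + √|(a : ℝ)|) / 4 ^ N) atTop (nhds 0) :=
      tendsto_const_nhds.div_atTop h4
    have hl := hlim.sub h0
    rw [sub_zero] at hl
    refine tendsto_of_tendsto_of_tendsto_of_le_of_le hl hlim (fun N => ?_) (fun N => ?_)
    · dsimp only
      rw [← sub_div]
      gcongr
      rw [naiveHeight_eq, sub_le_iff_le_add, add_comm, ← Real.log_mul (by positivity)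
        (zero_lt_one.trans_le (one_le_mulSize _)).ne']
      exact Real.log_le_log (zero_lt_one.trans_le (one_le_sizeOne ha _)) (sizeOne_le _)
    · dsimp only
      gcongr
      rw [naiveHeight_eq]
      exact Real.log_le_log (zero_lt_one.trans_le (one_le_mulSize _)) (mulSize_le_sizeOne ha _)
  have hL : 2 * canonicalHeight P = L := by
    rw [canonicalHeight, hlim2.limUnder_eq]; ring
  rw [hL]
  exact ⟨hlim2, hlim, fun N => ciInf_le hbdd N⟩

/-- The origin of 0.26: both height comparisons lose exactly (3/4) log 2 + (1/2) log |a|, which is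
at most 2C. -/
theorem log_two_mul_le : 3 / 4 * Real.log 2 ≤ 0.52 := by
  have := Real.log_two_lt_d9
  norm_num at *
  linarith

theorem canonicalHeight_le (ha : a ≠ 0) (hP : ¬ IsOfFinAddOrder P) :
    2 * canonicalHeight P ≤ naiveHeight P + 2 * heightConst a := by
  have h := (exists_tendsto_naiveHeight ha hP).2.2 1
  have h1 := (sizeOne_double ha hP).2
  have hm := zero_lt_one.trans_le (one_le_mulSize P)
  have hsa := zero_lt_one.trans_le (one_le_sqrt_abs ha)
  have h2 := Real.log_le_log (zero_lt_one.trans_le (one_le_sizeOne ha _)) h1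
  rw [Real.log_mul (by norm_num) (by positivity), Real.log_pow,
    Real.log_mul hsa.ne' hm.ne', Real.log_sqrt (abs_nonneg _), ← naiveHeight_eq,
    show (8 : ℝ) = 2 ^ 3 by norm_num, Real.log_pow] at h2
  push_cast at h2
  have h3 := log_two_mul_le
  rw [pow_one, pow_one, le_div_iff₀ (by norm_num)] at h
  unfold heightConst
  linarith

/-- The lower bounds for `sizeTwo` lose log(2|a|) in the first doubling, (log 4)/4 in the second and
nothing from the third on. Halving, since `sizeTwo` is quadratic, gives (3/4) log 2 + (1/2) log |a|.
-/
theorem naiveHeight_le (ha : FourthPowerFree a) (hP : ¬ IsOfFinAddOrder P) :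
    naiveHeight P ≤ 2 * canonicalHeight P + 2 * heightConst a := by
  have ha0 := ha.ne_zero
  have pos : ∀ R : (curve (a : ℚ)).toAffine.Point, 0 < sizeTwo R := fun R =>
    zero_lt_one.trans_le (one_le_sizeTwo ha0 R)
  have haa : 0 < |(a : ℝ)| := abs_pos.2 (by exact_mod_cast ha0)
  obtain ⟨t1, t2, -⟩ := sizeTwo_doubles ha hP
  have hmono : ∀ N : ℕ, Real.log (sizeTwo (4 • P)) * 4 ^ N ≤
      Real.log (sizeTwo ((2 ^ (N + 2)) • P)) := by
    intro N
    induction N with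
    | zero => norm_num
    | succ N ih =>
      have t3 := (sizeTwo_doubles ha (infinite_nsmul hP (n := 2 ^ N) (by positivity))).2.2
      rw [smul_smul, smul_smul, show 4 * 2 ^ N = 2 ^ (N + 2) by ring,
        show 8 * 2 ^ N = 2 ^ (N + 1 + 2) by ring] at t3
      have h2 := Real.log_le_log (by have := pos (2 ^ (N + 2) • P); positivity) t3
      rw [Real.log_pow] at h2
      push_cast at h2
      rw [pow_succ]
      linarith
  have hlim : Real.log (sizeTwo (4 • P)) / 32 ≤ 2 * canonicalHeight P := by
    refine ge_of_tendsto (exists_tendsto_naiveHeight ha0 hP).2.1 ?_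
    filter_upwards [eventually_ge_atTop 2] with N hN
    obtain ⟨M, rfl⟩ := Nat.exists_eq_add_of_le' hN
    have h1 := Real.log_le_log (pos _) (sizeTwo_le_sq (2 ^ (M + 2) • P))
    rw [Real.log_pow] at h1
    push_cast at h1
    have h2 := hmono M
    have h4 : (0 : ℝ) < 4 ^ M := by positivity
    rw [div_le_div_iff₀ (by norm_num) (by positivity), pow_add]
    nlinarith
  have l1 := Real.log_le_log (by have := pos P; positivity) t1
  have l2 := Real.log_le_log (by have := pos (2 • P); positivity) t2
  rw [Real.log_pow, Real.log_mul (pos _).ne' (by positivity), Real.log_pow,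
    Real.log_mul two_ne_zero haa.ne'] at l1
  rw [Real.log_pow, Real.log_mul (pos _).ne' (by positivity), Real.log_pow,
    show (4 : ℝ) = 2 ^ 2 by norm_num, Real.log_pow] at l2
  have l0 := Real.log_le_log (by have := one_le_mulSize P; positivity) (mulSize_sq_le ha0 P)
  rw [Real.log_pow, ← naiveHeight_eq] at l0
  push_cast at l0 l1 l2
  have h3 := log_two_mul_le
  unfold heightConst
  linarith

end Heights

/-! ### The canonical height is quadratic and positive -/

section Parallelogram

variable {a : ℤ} {P Q : (curve (a : ℚ)).toAffine.Point}

theorem isElliptic_curve (ha : a ≠ 0) : (curve (a : ℚ)).IsElliptic := by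
  refine ⟨IsUnit.mk0 _ ?_⟩
  have : (curve (a : ℚ)).Δ = -64 * (a : ℚ) ^ 3 := by
    simp only [WeierstrassCurve.Δ, WeierstrassCurve.b₂, WeierstrassCurve.b₄, WeierstrassCurve.b₆,
      WeierstrassCurve.b₈, curve]
    ring
  rw [this]
  have : (a : ℚ) ≠ 0 := by exact_mod_cast ha
  positivity

theorem eval_addSubMap {K : Type*} [CommRing K] (c s t u : K) :
    (fun i => MvPolynomial.eval ![s, t, u] (WeierstrassCurve.addSubMap (curve c) i)) =
      ![(s - c * u) ^ 2, 2 * t * (s + c * u), t ^ 2 - 4 * s * u] := by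
  funext i
  fin_cases i <;>
    simp [WeierstrassCurve.addSubMap, WeierstrassCurve.b₂, WeierstrassCurve.b₄,
      WeierstrassCurve.b₆, WeierstrassCurve.b₈, curve] <;> ring

/-- The approximate parallelogram law. -/
theorem exists_parallelogram_bound (ha : a ≠ 0) :
    ∃ C : ℝ, ∀ P Q : (curve (a : ℚ)).toAffine.Point, P ≠ 0 → Q ≠ 0 → xCoord P ≠ xCoord Q →
      |naiveHeight (P + Q) + naiveHeight (P - Q) - 2 * naiveHeight P - 2 * naiveHeight Q| ≤ C := by
  have := isElliptic_curve ha
  obtain ⟨C₁, h₁⟩ :=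
    WeierstrassCurve.abs_logHeight_addSubMap_sub_two_mul_logHeight_le (curve (a : ℚ))
  obtain ⟨C₂, h₂⟩ := Height.abs_logHeight_sym2_sub_le ℚ
  refine ⟨C₂ + C₁ + 2 * C₂, fun P Q hP hQ hne => ?_⟩
  have nz : ∀ x : ℚ, ![x, 1] ≠ 0 := fun x h => by simpa using congrFun h 1
  have e1 := h₂ (nz (xCoord (P + Q))) (nz (xCoord (P - Q)))
  have e2 := h₂ (nz (xCoord P)) (nz (xCoord Q))
  have e3 := h₁ ![xCoord P * xCoord Q, xCoord P * 1 + 1 * xCoord Q, 1 * 1]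
  have hsum := sq_mul_xCoord_add_add_xCoord_sub hP hQ hne
  have hprod := sq_mul_xCoord_add_mul_xCoord_sub hP hQ hne
  have hD : (xCoord P - xCoord Q) ^ 2 ≠ 0 := pow_ne_zero 2 (sub_ne_zero.2 hne)
  -- The map takes the symmetric functions of x(P), x(Q) to a multiple of those of x(P ± Q), and
  -- projective heights ignore the multiple.
  have hvec : (fun i => MvPolynomial.eval
      ![xCoord P * xCoord Q, xCoord P * 1 + 1 * xCoord Q, 1 * 1]
      (WeierstrassCurve.addSubMap (curve (a : ℚ)) i)) =
      (xCoord P - xCoord Q) ^ 2 • ![xCoord (P + Q) * xCoord (P - Q),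
        xCoord (P + Q) * 1 + 1 * xCoord (P - Q), 1 * 1] := by
    rw [eval_addSubMap]
    funext i
    fin_cases i
    · simp only [Matrix.smul_cons, smul_eq_mul, Fin.zero_eta, Matrix.cons_val_zero]
      linear_combination -hprod
    · simp only [Matrix.smul_cons, smul_eq_mul, Fin.mk_one, Matrix.cons_val_one,
        Matrix.cons_val_zero]
      linear_combination -hsum
    · simp only [Matrix.smul_cons, smul_eq_mul, Fin.reduceFinMk, Matrix.cons_val]
      ring
  rw [hvec, Height.logHeight_smul_eq_logHeight _ hD] at e3
  simp only [naiveHeight, Height.logHeight₁_eq_logHeight]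
  rw [abs_le] at *
  constructor <;> linarith [e1.1, e1.2, e2.1, e2.2, e3.1, e3.2]

theorem tendsto_naiveHeight_nsmul (ha : a ≠ 0) (hP : ¬ IsOfFinAddOrder P) {n : ℕ} (hn : n ≠ 0) :
    Tendsto (fun N : ℕ => naiveHeight ((n * 2 ^ N) • P) / 4 ^ N) atTop
        (nhds (2 * canonicalHeight (n • P))) := by
  have := (exists_tendsto_naiveHeight ha (infinite_nsmul hP hn)).1
  simpa only [smul_smul, mul_comm n] using this

/-- Apply the approximate law to 2^N nP and 2^N P and divide by 4^N: the error disappears. The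
condition n ≥ 2 keeps these points, their difference and the difference of their x-coordinates
nonzero. -/
theorem canonicalHeight_add_sub (ha : a ≠ 0) (hP : ¬ IsOfFinAddOrder P) {n : ℕ} (hn : 2 ≤ n) :
    canonicalHeight ((n + 1) • P) + canonicalHeight ((n - 1) • P) =
      2 * canonicalHeight (n • P) + 2 * canonicalHeight P := by
  obtain ⟨C, hC⟩ := exists_parallelogram_bound ha
  have t1 := tendsto_naiveHeight_nsmul ha hP (n := n + 1) (by omega)
  have t2 := tendsto_naiveHeight_nsmul ha hP (n := n - 1) (by omega)
  have t3 := tendsto_naiveHeight_nsmul ha hP (n := n) (by omega)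
  have t4 := tendsto_naiveHeight_nsmul ha hP (n := 1) one_ne_zero
  have t := ((t1.add t2).sub (t3.const_mul 2)).sub (t4.const_mul 2)
  have h0 : Tendsto (fun N : ℕ => C / (4 : ℝ) ^ N) atTop (nhds 0) :=
    tendsto_const_nhds.div_atTop (tendsto_pow_atTop_atTop_of_one_lt (by norm_num))
  have hz := squeeze_zero_norm (fun N => ?_) h0 (f := fun N : ℕ =>
    naiveHeight (((n + 1) * 2 ^ N) • P) / 4 ^ N + naiveHeight (((n - 1) * 2 ^ N) • P) / 4 ^ N -
    2 * (naiveHeight ((n * 2 ^ N) • P) / 4 ^ N) - 2 * (naiveHeight ((1 * 2 ^ N) • P) / 4 ^ N))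
  · have := tendsto_nhds_unique t hz
    rw [one_nsmul] at this
    linarith
  · have hpow : 2 ^ N ≠ 0 := by positivity
    have := hC ((n * 2 ^ N) • P) ((1 * 2 ^ N) • P)
      (nsmul_ne_zero_of_infinite hP (by positivity)) (nsmul_ne_zero_of_infinite hP (by positivity))
      (xCoord_nsmul_ne hP (by positivity) (by positivity)
        fun h => by have := Nat.eq_of_mul_eq_mul_right (by positivity) h; omega)
    have hsub : (n * 2 ^ N) • P - (1 * 2 ^ N) • P = ((n - 1) * 2 ^ N) • P := by
      rw [sub_eq_iff_eq_add, ← add_nsmul, ← add_mul, Nat.sub_add_cancel (by omega)]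
    rw [hsub, ← add_nsmul, ← add_mul] at this
    rw [Real.norm_eq_abs, le_div_iff₀ (by positivity)]
    refine le_trans (le_of_eq ?_) this
    have h4 : (0 : ℝ) < 4 ^ N := by positivity
    rw [← abs_of_pos h4, ← abs_mul, abs_of_pos h4]
    congr 1
    field_simp

theorem canonicalHeight_two_nsmul (ha : a ≠ 0) (hP : ¬ IsOfFinAddOrder P) :
    canonicalHeight (2 • P) = 4 * canonicalHeight P := by
  have t2 := tendsto_naiveHeight_nsmul ha hP (n := 2) two_ne_zero
  have t1 := ((tendsto_add_atTop_iff_nat 1).2 (exists_tendsto_naiveHeight ha hP).1).const_mul 4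
  have : (fun N : ℕ => naiveHeight ((2 * 2 ^ N) • P) / 4 ^ N) =
      fun N : ℕ => 4 * (naiveHeight (2 ^ (N + 1) • P) / 4 ^ (N + 1)) := by
    funext N
    rw [← pow_succ', pow_succ 4]
    field_simp
  rw [this] at t2
  linarith [tendsto_nhds_unique t1 t2]

theorem canonicalHeight_nsmul (ha : a ≠ 0) (hP : ¬ IsOfFinAddOrder P) {n : ℕ} (hn : n ≠ 0) :
    canonicalHeight (n • P) = (n : ℝ) ^ 2 * canonicalHeight P := by
  suffices ∀ n : ℕ, canonicalHeight ((n + 1) • P) = ((n : ℝ) + 1) ^ 2 * canonicalHeight P ∧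
      canonicalHeight ((n + 2) • P) = ((n : ℝ) + 2) ^ 2 * canonicalHeight P by
    obtain ⟨m, rfl⟩ := Nat.exists_eq_succ_of_ne_zero hn
    simpa using (this m).1
  intro n
  induction n with
  | zero =>
    refine ⟨by simp, ?_⟩
    rw [zero_add, canonicalHeight_two_nsmul ha hP]; norm_num
  | succ n ih =>
    refine ⟨?_, ?_⟩
    · rw [add_assoc, one_add_one_eq_two, ih.2]; push_cast; ring
    · have := canonicalHeight_add_sub ha hP (n := n + 2) (by omega)
      rw [show n + 2 - 1 = n + 1 by omega, ih.1, ih.2] at this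
      rw [show n + 1 + 2 = n + 2 + 1 by omega]
      push_cast
      linear_combination this

/-- Northcott: if ĥ(P) ≤ 0, all multiples of P would have naive height at most 2C, yet their
x-coordinates are distinct. -/
theorem canonicalHeight_pos (ha : FourthPowerFree a) (hP : ¬ IsOfFinAddOrder P) :
    0 < canonicalHeight P := by
  by_contra! hle
  have hinj : Function.Injective fun n : ℕ => xCoord ((n + 1) • P) := fun m n h => by
    by_contra hne
    exact xCoord_nsmul_ne hP m.succ_ne_zero n.succ_ne_zero (by simpa using hne) h
  refine Set.infinite_range_of_injective hinj
    ((NumberField.finite_setOfPred_logHeight₁_le ℚ (2 * heightConst a)).subset ?_)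
  rintro _ ⟨n, rfl⟩
  have h1 := naiveHeight_le ha (infinite_nsmul hP n.succ_ne_zero)
  rw [canonicalHeight_nsmul ha.ne_zero hP n.succ_ne_zero] at h1
  have h2 : ((n.succ : ℕ) : ℝ) ^ 2 * canonicalHeight P ≤ 0 :=
    mul_nonpos_of_nonneg_of_nonpos (by positivity) hle
  rw [naiveHeight] at h1
  exact h1.trans (by linarith)

/-- `|h(nP) - 2 n² ĥ(P)| ≤ 2 C`. -/
theorem abs_naiveHeight_nsmul_sub_le (ha : FourthPowerFree a) (hP : ¬ IsOfFinAddOrder P) {n : ℕ}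
    (hn : n ≠ 0) :
    |naiveHeight (n • P) - 2 * (n : ℝ) ^ 2 * canonicalHeight P| ≤ 2 * heightConst a := by
  have h1 := naiveHeight_le ha (infinite_nsmul hP hn)
  have h2 := canonicalHeight_le ha.ne_zero (infinite_nsmul hP hn)
  rw [canonicalHeight_nsmul ha.ne_zero hP hn] at h1 h2
  rw [abs_le]
  constructor <;> linarith

end Parallelogram

/-! ### Values of homogenized polynomials -/

section Homogenization

theorem homEval_eq_sum (p : ℤ[X]) (u v : ℤ) : homEval p u v =
    ∑ i ∈ Finset.range (p.natDegree + 1), p.coeff i * (u ^ i * v ^ (p.natDegree - i)) := by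
  rw [homEval, homogenize, map_sum]
  rw [Finset.Nat.sum_antidiagonal_eq_sum_range_succ_mk]
  refine Finset.sum_congr rfl fun i _ => ?_
  rw [MvPolynomial.eval_monomial, Finsupp.update_eq_add_single (by simp),
    Finsupp.prod_add_index' (by simp) (by intros; rw [pow_add])]
  simp

theorem homEval_mul {p q : ℤ[X]} (hp : p ≠ 0) (hq : q ≠ 0) (u v : ℤ) :
    homEval (p * q) u v = homEval p u v * homEval q u v := by
  rw [homEval, natDegree_mul hp hq, homogenize_mul _ _ le_rfl le_rfl, map_mul]
  rfl

theorem homEval_eq_eval {K : Type*} [Field K] [CharZero K] (p : ℤ[X]) (u : ℤ) {v : ℤ}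
    (hv : v ≠ 0) :
    ((homEval p u v : ℤ) : K) =
      (p.map (Int.castRingHom K)).eval ((u : K) / v) * (v : K) ^ p.natDegree := by
  have hvK : (v : K) ≠ 0 := by exact_mod_cast hv
  rw [homEval_eq_sum, eval_map, eval₂_eq_sum_range, Finset.sum_mul]
  push_cast
  refine Finset.sum_congr rfl fun i hi => ?_
  have hi' : i ≤ p.natDegree := by simpa [Nat.lt_succ_iff] using hi
  have : (v : K) ^ p.natDegree = (v : K) ^ i * (v : K) ^ (p.natDegree - i) := by
    rw [← pow_add, Nat.add_sub_cancel' hi']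
  rw [this, div_pow, eq_intCast]
  field_simp

theorem exists_homEval_eq (p : ℤ[X]) (u v : ℤ) :
    ∃ r, homEval p u v = p.leadingCoeff * u ^ p.natDegree + v * r := by
  have : v ∣ ∑ i ∈ Finset.range p.natDegree, p.coeff i * (u ^ i * v ^ (p.natDegree - i)) :=
    Finset.dvd_sum fun i hi => ((dvd_pow_self v
      (Nat.sub_ne_zero_of_lt (Finset.mem_range.1 hi))).mul_left _).mul_left _
  obtain ⟨r, hr⟩ := this
  exact ⟨r, by rw [homEval_eq_sum, Finset.sum_range_succ, hr]; simp; ring⟩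

theorem exists_homEval_eq_of_coeff_eq_zero {p : ℤ[X]} (h : p.coeff (p.natDegree - 1) = 0)
    (u v : ℤ) : ∃ r, homEval p u v = p.leadingCoeff * u ^ p.natDegree + v ^ 2 * r := by
  have : v ^ 2 ∣ ∑ i ∈ Finset.range p.natDegree, p.coeff i * (u ^ i * v ^ (p.natDegree - i)) := by
    refine Finset.dvd_sum fun i hi => ?_
    have hi := Finset.mem_range.1 hi
    by_cases h1 : i = p.natDegree - 1
    · rw [h1, h, zero_mul]; exact dvd_zero _
    · exact ((pow_dvd_pow v (by omega)).mul_left _).mul_left _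
  obtain ⟨r, hr⟩ := this
  exact ⟨r, by rw [homEval_eq_sum, Finset.sum_range_succ, hr]; simp; ring⟩

end Homogenization

/-! ### Behaviour of division polynomials under x ↦ −x -/

section Parity

variable {R : Type*} [CommRing R]

theorem Ψ₂Sq_comp_neg (c : R) : (curve c).Ψ₂Sq.comp (-X) = -(curve c).Ψ₂Sq := by
  simp [WeierstrassCurve.Ψ₂Sq, curve, WeierstrassCurve.b₂, WeierstrassCurve.b₄,
    WeierstrassCurve.b₆]
  ring

theorem preΨ_comp_neg (c : R) (n : ℤ) : ((curve c).preΨ n).comp (-X) = (curve c).preΨ n := by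
  rw [WeierstrassCurve.preΨ, ← coe_compRingHom_apply, map_preNormEDS, map_pow]
  simp only [coe_compRingHom_apply, Ψ₂Sq_comp_neg]
  congr 1
  · ring
  · simp [WeierstrassCurve.Ψ₃, curve, WeierstrassCurve.b₂, WeierstrassCurve.b₄,
      WeierstrassCurve.b₆, WeierstrassCurve.b₈]
    ring
  · simp [WeierstrassCurve.preΨ₄, curve, WeierstrassCurve.b₂, WeierstrassCurve.b₄,
      WeierstrassCurve.b₆, WeierstrassCurve.b₈]
    ring

/-- Under x ↦ −x the polynomial ψ_n² is multiplied by ±1, so only exponents of one parity occur.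
Consequently ψ_n²(A, B) ≡ n²A^N modulo B² and not merely modulo B. -/
theorem coeff_ΨSq_sub_one (a : ℤ) {n : ℕ} (hn : 2 ≤ n) :
    ((curve a).ΨSq n).coeff (((curve a).ΨSq n).natDegree - 1) = 0 := by
  set p := (curve a).ΨSq n with hp
  have hp0 : p ≠ 0 := (curve a).ΨSq_ne_zero (n := n) (by simp; omega)
  have hlc : p.coeff p.natDegree ≠ 0 := leadingCoeff_ne_zero.2 hp0
  have h : p.comp (-X) = p ∨ p.comp (-X) = -p := by
    rw [hp, WeierstrassCurve.ΨSq, mul_comp, pow_comp, preΨ_comp_neg]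
    split_ifs
    · right; rw [Ψ₂Sq_comp_neg]; ring
    · left; simp
  have hc : ∀ i, (p.comp (-X)).coeff i = (-1) ^ i * p.coeff i := fun i => by
    rw [show (-X : ℤ[X]) = C (-1) * X by simp, comp_C_mul_X_coeff, mul_comm]
  have hz : p.natDegree ≠ 0 := ((curve a).natDegree_ΨSq_pos (n := n)
    (by rw [Int.natAbs_natCast]; omega) (by simp; omega)).ne'
  obtain ⟨m, hm⟩ := Nat.exists_eq_succ_of_ne_zero hz
  have h1 := hc p.natDegree
  have h2 := hc m
  rw [hm, Nat.succ_sub_one]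
  rw [hm] at hlc h1
  rcases h with h | h
  all_goals
    rw [h] at h1 h2
    rcases neg_one_pow_eq_or ℤ m with h3 | h3 <;>
      simp only [Nat.succ_eq_add_one, pow_succ, h3, coeff_neg] at h1 h2 hlc ⊢ <;> omega

end Parity

/-! ### Divisibility properties of the sequence B_n -/

section Divisibility

variable {a : ℤ} {P : (curve (a : ℚ)).toAffine.Point}

theorem B_ne_zero (n : ℕ) : B P n ≠ 0 := (xCoord (n • P)).den_ne_zero

theorem isCoprime_A_B (n : ℕ) : IsCoprime (A P n) (B P n : ℤ) := isCoprime_num_den _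

theorem xCoord_eq_div (n : ℕ) : xCoord (n • P) = (A P n : ℚ) / ((B P n : ℤ) : ℚ) := by
  rw [A, B, Int.cast_natCast, Rat.num_div_den]

/-- This is x(mtP) = φ_t/ψ_t² at x(mP) with denominators cleared; the extra B_m comes from the
degrees t² and t² − 1. -/
theorem A_mul_eq (hP : ¬ IsOfFinAddOrder P) {m t : ℕ} (hm : m ≠ 0) (ht : t ≠ 0) :
    A P (m * t) * (B P m * homEval ((curve a).ΨSq t) (A P m) (B P m)) =
      B P (m * t) * homEval ((curve a).Φ t) (A P m) (B P m) := by
  have hB : (B P m : ℤ) ≠ 0 := by exact_mod_cast B_ne_zero m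
  have hB' : (B P (m * t) : ℚ) ≠ 0 := by exact_mod_cast B_ne_zero (m * t)
  have h := (xCoord_nsmul_mul_eval_ΨSq (infinite_nsmul hP hm) ht).2
  rw [smul_smul, mul_comm t m] at h
  have e1 := homEval_eq_eval (K := ℚ) ((curve a).ΨSq t) (A P m) hB
  have e2 := homEval_eq_eval (K := ℚ) ((curve a).Φ t) (A P m) hB
  rw [← WeierstrassCurve.map_ΨSq, curve_map, eq_intCast, ← xCoord_eq_div,
    WeierstrassCurve.natDegree_ΨSq _ (by simpa using ht), Int.natAbs_natCast] at e1
  rw [← WeierstrassCurve.map_Φ, curve_map, eq_intCast, ← xCoord_eq_div,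
    WeierstrassCurve.natDegree_Φ, Int.natAbs_natCast] at e2
  have hpow : ((B P m : ℤ) : ℚ) ^ t ^ 2 = ((B P m : ℤ) : ℚ) ^ (t ^ 2 - 1) * ((B P m : ℤ) : ℚ) := by
    rw [← pow_succ, Nat.sub_add_cancel (Nat.one_le_iff_ne_zero.2 (by positivity))]
  have : (A P (m * t) : ℚ) = xCoord ((m * t) • P) * B P (m * t) := by
    rw [xCoord_eq_div]; push_cast; field_simp
  apply (Int.cast_injective : Function.Injective (Int.cast : ℤ → ℚ))
  push_cast at *
  rw [e1, e2, ← h, this, hpow]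
  ring

theorem isCoprime_homEval_Φ (m t : ℕ) :
    IsCoprime (homEval ((curve a).Φ t) (A P m) (B P m)) (B P m : ℤ) := by
  obtain ⟨r, hr⟩ := exists_homEval_eq ((curve a).Φ t) (A P m) (B P m)
  rw [hr, WeierstrassCurve.leadingCoeff_Φ, one_mul]
  exact (isCoprime_A_B m).pow_left.add_mul_left_left r

theorem B_dvd_B_mul (hP : ¬ IsOfFinAddOrder P) {m t : ℕ} (hm : m ≠ 0) (ht : t ≠ 0) :
    B P m ∣ B P (m * t) := by
  have : (B P m : ℤ) ∣ B P (m * t) := (isCoprime_homEval_Φ m t).symm.dvd_of_dvd_mul_right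
    ⟨A P (m * t) * homEval ((curve a).ΨSq t) (A P m) (B P m), by
      rw [← A_mul_eq hP hm ht]; ring⟩
  exact_mod_cast this

/-- The growth of the valuation along a prime multiple. -/
theorem pow_dvd_of_pow_dvd_B_mul (hP : ¬ IsOfFinAddOrder P) {l s m k : ℕ} (hl : l.Prime)
    (hs : s.Prime) (hm : m ≠ 0) (hlm : l ∣ B P m) (h : l ^ k ∣ B P (m * s)) :
    l ^ k ∣ s ^ 2 * B P m := by
  have hlZ : Prime (l : ℤ) := Nat.prime_iff_prime_int.1 hl
  have hlB : (l : ℤ) ∣ B P m := by exact_mod_cast hlm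
  have hlB' : l ∣ B P (m * s) := hlm.trans (B_dvd_B_mul hP hm hs.ne_zero)
  have hcopA : IsCoprime ((l : ℤ) ^ k) (A P (m * s)) :=
    ((isCoprime_A_B (P := P) (m * s)).symm.of_isCoprime_of_dvd_left
      (by exact_mod_cast hlB')).pow_left
  have hcop0 : IsCoprime (l : ℤ) (A P m) :=
    (isCoprime_A_B (P := P) m).symm.of_isCoprime_of_dvd_left hlB
  have h1 : (l : ℤ) ^ k ∣ B P m * homEval ((curve a).ΨSq s) (A P m) (B P m) :=
    hcopA.dvd_of_dvd_mul_left ((A_mul_eq hP hm hs.ne_zero) ▸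
      Dvd.dvd.mul_right (by exact_mod_cast h) _)
  obtain ⟨r, hr⟩ := exists_homEval_eq_of_coeff_eq_zero (coeff_ΨSq_sub_one a hs.two_le)
    (A P m) (B P m)
  rw [WeierstrassCurve.leadingCoeff_ΨSq _ (by simpa using hs.ne_zero)] at hr
  set N := ((curve a).ΨSq s).natDegree
  obtain ⟨b, w, hb, -⟩ := exists_sq_den (m • P)
  have hb' : (B P m : ℤ) = b ^ 2 := hb
  suffices (l : ℤ) ^ k ∣ s ^ 2 * B P m by exact_mod_cast this
  -- For l = s, the square B_m is divisible by l², so B_m² is divisible by l⁴. Removing l² = s² from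
  -- ψ_s²(A, B) leaves a factor prime to l.
  by_cases hls : l = s
  · subst hls
    obtain ⟨e, rfl⟩ : (l : ℤ) ∣ b := hlZ.dvd_of_dvd_pow (hb' ▸ hlB)
    have hcop : IsCoprime ((l : ℤ) ^ k) (A P m ^ N + l * (l * (e ^ 4 * r))) :=
      ((hcop0.pow_right (n := N)).add_mul_left_right _).pow_left
    refine hcop.dvd_of_dvd_mul_right (h1.trans (dvd_of_eq ?_))
    rw [hr, hb']
    push_cast
    ring
  · have hcop2 : IsCoprime (l : ℤ) ((s : ℤ) ^ 2 * A P m ^ N) :=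
      IsCoprime.mul_right (IsCoprime.pow_right
        (by exact_mod_cast (Nat.coprime_primes hl hs).2 hls)) hcop0.pow_right
    obtain ⟨q, hq⟩ := hlB
    have hcop : IsCoprime ((l : ℤ) ^ k) (homEval ((curve a).ΨSq s) (A P m) (B P m)) := by
      rw [hr, hq, show ((l : ℤ) * q) ^ 2 * r = l * (l * q ^ 2 * r) by ring]
      exact (hcop2.add_mul_left_right _).pow_left
    exact (hcop.dvd_of_dvd_mul_right h1).mul_left _

/-- Points with l in the denominator are those reducing to O, which suggests closure under
subtraction. The proof avoids reduction, and so covers bad primes: clear denominators in the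
quadratic satisfied by x((i − j)P). Modulo l only B_{i−j}² A_i² A_j² survives. -/
theorem dvd_B_sub (hP : ¬ IsOfFinAddOrder P) {l i j : ℕ} (hl : l.Prime) (hj : j ≠ 0) (hij : j < i)
    (hi' : l ∣ B P i) (hj' : l ∣ B P j) : l ∣ B P (i - j) := by
  have hlZ : Prime (l : ℤ) := Nat.prime_iff_prime_int.1 hl
  have hne := xCoord_nsmul_ne hP (by omega) hj hij.ne'
  have hPi := nsmul_ne_zero_of_infinite hP (n := i) (by omega)
  have hPj := nsmul_ne_zero_of_infinite hP hj
  have hsum := sq_mul_xCoord_add_add_xCoord_sub hPi hPj hne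
  have hprod := sq_mul_xCoord_add_mul_xCoord_sub hPi hPj hne
  have hsub : i • P - j • P = (i - j) • P := by
    rw [sub_eq_iff_eq_add, ← add_nsmul, Nat.sub_add_cancel hij.le]
  rw [hsub] at hsum hprod
  have key : xCoord ((i - j) • P) ^ 2 * (xCoord (i • P) - xCoord (j • P)) ^ 2 -
      2 * xCoord ((i - j) • P) * (xCoord (i • P) + xCoord (j • P)) *
        (a + xCoord (i • P) * xCoord (j • P)) + (xCoord (i • P) * xCoord (j • P) - a) ^ 2 = 0 := by
    linear_combination xCoord ((i - j) • P) * hsum - hprod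
  rw [xCoord_eq_div i, xCoord_eq_div j, xCoord_eq_div (i - j)] at key
  have b1 : ((B P i : ℤ) : ℚ) ≠ 0 := by exact_mod_cast B_ne_zero i
  have b2 : ((B P j : ℤ) : ℚ) ≠ 0 := by exact_mod_cast B_ne_zero j
  have b3 : ((B P (i - j) : ℤ) : ℚ) ≠ 0 := by exact_mod_cast B_ne_zero (i - j)
  have n1 := fun h : (l : ℤ) ∣ A P i => hlZ.not_isUnit
    ((isCoprime_A_B (P := P) i).isUnit_of_dvd' h (by exact_mod_cast hi'))
  have n2 := fun h : (l : ℤ) ∣ A P j => hlZ.not_isUnit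
    ((isCoprime_A_B (P := P) j).isUnit_of_dvd' h (by exact_mod_cast hj'))
  have d1 : (l : ℤ) ∣ B P i := by exact_mod_cast hi'
  have d2 : (l : ℤ) ∣ B P j := by exact_mod_cast hj'
  suffices (l : ℤ) ∣ B P (i - j) by exact_mod_cast this
  generalize A P i = A₁ at *
  generalize A P j = A₂ at *
  generalize A P (i - j) = A₃ at *
  generalize (B P i : ℤ) = B₁ at *
  generalize (B P j : ℤ) = B₂ at *
  generalize (B P (i - j) : ℤ) = B₃ at *
  have key2 : A₃ ^ 2 * (A₁ * B₂ - A₂ * B₁) ^ 2 - 2 * A₃ * B₃ * (A₁ * B₂ + A₂ * B₁) *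
      (a * (B₁ * B₂) + A₁ * A₂) + B₃ ^ 2 * (A₁ * A₂ - a * (B₁ * B₂)) ^ 2 = 0 := by
    field_simp at key
    have : ((A₃ ^ 2 * (A₁ * B₂ - A₂ * B₁) ^ 2 - 2 * A₃ * B₃ * (A₁ * B₂ + A₂ * B₁) *
      (a * (B₁ * B₂) + A₁ * A₂) + B₃ ^ 2 * (A₁ * A₂ - a * (B₁ * B₂)) ^ 2 : ℤ) : ℚ) = 0 := by
      push_cast
      linear_combination key
    exact_mod_cast this
  obtain ⟨c₁, rfl⟩ := d1
  obtain ⟨c₂, rfl⟩ := d2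
  have hd : (l : ℤ) ∣ B₃ ^ 2 * (A₁ ^ 2 * A₂ ^ 2) := by
    have : B₃ ^ 2 * (A₁ ^ 2 * A₂ ^ 2) = l * (-(A₃ ^ 2 * l * (A₁ * c₂ - A₂ * c₁) ^ 2) +
        2 * A₃ * B₃ * (A₁ * c₂ + A₂ * c₁) * (a * (l * c₁ * (l * c₂)) + A₁ * A₂) +
        B₃ ^ 2 * (2 * A₁ * A₂ * a * l * c₁ * c₂ - a ^ 2 * l ^ 3 * c₁ ^ 2 * c₂ ^ 2)) := by
      linear_combination key2
    exact this ▸ dvd_mul_right _ _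
  rcases hlZ.dvd_or_dvd hd with h | h
  · exact hlZ.dvd_of_dvd_pow h
  · rcases hlZ.dvd_or_dvd h with h | h
    · exact absurd (hlZ.dvd_of_dvd_pow h) n1
    · exact absurd (hlZ.dvd_of_dvd_pow h) n2

theorem dvd_B_gcd (hP : ¬ IsOfFinAddOrder P) {l : ℕ} (hl : l.Prime) :
    ∀ {i j : ℕ}, i ≠ 0 → j ≠ 0 → l ∣ B P i → l ∣ B P j → l ∣ B P (i.gcd j) := by
  intro i j
  induction h : i + j using Nat.strong_induction_on generalizing i j with
  | _ N ih =>
    intro hi hj hi' hj'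
    rcases lt_trichotomy i j with hlt | rfl | hlt
    · have := ih (i + (j - i)) (by omega) rfl hi (by omega) hi' (dvd_B_sub hP hl hi hlt hj' hi')
      rwa [Nat.gcd_sub_self_right hlt.le] at this
    · rwa [Nat.gcd_self]
    · have := ih ((i - j) + j) (by omega) rfl (by omega) hj (dvd_B_sub hP hl hj hlt hi' hj') hj'
      rwa [Nat.gcd_sub_self_left hlt.le] at this

/-- A prime that is not a primitive divisor of `B_n` divides `B_{n/s}` for some prime `s ∣ n`. -/
theorem exists_prime_dvd_B_div (hP : ¬ IsOfFinAddOrder P) {n l : ℕ} (hn : n ≠ 0) (hl : l.Prime)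
    (h : ¬ HasPrimitiveDivisor (B P) n) (hln : l ∣ B P n) :
    ∃ s ∈ n.primeFactors, l ∣ B P (n / s) := by
  have hex : l ∣ ∏ i ∈ Finset.Ico 1 n, B P i := by
    by_contra h'
    exact h ⟨l, hl, hln, h'⟩
  obtain ⟨j, hj, hlj⟩ := (Prime.dvd_finsetProd_iff hl.prime _).1 hex
  rw [Finset.mem_Ico] at hj
  have hg := dvd_B_gcd hP hl hn (by omega) hln hlj
  obtain ⟨t, ht⟩ := Nat.gcd_dvd_left n j
  have hgj : n.gcd j ≤ j := Nat.gcd_le_right _ (by omega)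
  have hg0 : n.gcd j ≠ 0 := Nat.gcd_ne_zero_left hn
  have ht1 : t ≠ 1 := by rintro rfl; omega
  obtain ⟨s, hs, u, rfl⟩ := Nat.exists_prime_and_dvd ht1
  have hu0 : u ≠ 0 := by rintro rfl; simp at ht; exact hn ht
  have hns : n = s * (n.gcd j * u) := ht.trans (by ring)
  have hdvd : s ∣ n := ⟨_, hns⟩
  refine ⟨s, Nat.mem_primeFactors.2 ⟨hs, hdvd, hn⟩, ?_⟩
  have : n / s = n.gcd j * u := Nat.div_eq_of_eq_mul_right hs.pos hns
  rw [this]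
  exact hg.trans (B_dvd_B_mul hP hg0 hu0)

theorem factorization_B_le (hP : ¬ IsOfFinAddOrder P) {n l s : ℕ} (hn : n ≠ 0) (hl : l.Prime)
    (hs : s ∈ n.primeFactors) (hls : l ∣ B P (n / s)) :
    (B P n).factorization l ≤ (n ^ 2).factorization l + (B P (n / s)).factorization l := by
  obtain ⟨hsp, hsn, -⟩ := Nat.mem_primeFactors.1 hs
  have h0 : n / s ≠ 0 := (Nat.div_pos (Nat.le_of_dvd (Nat.pos_of_ne_zero hn) hsn) hsp.pos).ne'
  have h1 := pow_dvd_of_pow_dvd_B_mul hP (k := (B P n).factorization l) hl hsp h0 hls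
    (by rw [Nat.div_mul_cancel hsn]; exact Nat.ordProj_dvd _ _)
  have h2 : l ^ (B P n).factorization l ∣ n ^ 2 * B P (n / s) :=
    h1.trans (Nat.mul_dvd_mul_right (pow_dvd_pow_of_dvd hsn 2) _)
  rw [hl.pow_dvd_iff_le_factorization (mul_ne_zero (pow_ne_zero 2 hn) (B_ne_zero _)),
    Nat.factorization_mul (pow_ne_zero 2 hn) (B_ne_zero _)] at h2
  exact h2

theorem factorization_prod_B (n l : ℕ) :
    (∏ s ∈ n.primeFactors, B P (n / s)).factorization l =
      ∑ s ∈ n.primeFactors, (B P (n / s)).factorization l := by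
  rw [Nat.factorization_prod fun s _ => B_ne_zero _, Finset.sum_apply']

/-- Without primitive divisors, `B_n` divides `n² ∏_{s ∣ n} B_{n/s}`. -/
theorem B_dvd_of_no_primitive (hP : ¬ IsOfFinAddOrder P) {n : ℕ} (hn : n ≠ 0)
    (h : ¬ HasPrimitiveDivisor (B P) n) :
    B P n ∣ n ^ 2 * ∏ s ∈ n.primeFactors, B P (n / s) := by
  have hprod : ∏ s ∈ n.primeFactors, B P (n / s) ≠ 0 :=
    Finset.prod_ne_zero_iff.2 fun _ _ => B_ne_zero _
  rw [← Nat.factorization_prime_le_iff_dvd (B_ne_zero _) (mul_ne_zero (pow_ne_zero 2 hn) hprod)]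
  intro l hl
  by_cases hln : l ∣ B P n
  · obtain ⟨s, hs, hls⟩ := exists_prime_dvd_B_div hP hn hl h hln
    rw [Nat.factorization_mul (pow_ne_zero 2 hn) hprod, Finsupp.add_apply, factorization_prod_B]
    have := Finset.single_le_sum (f := fun s => (B P (n / s)).factorization l)
      (fun _ _ => Nat.zero_le _) hs
    have := factorization_B_le hP hn hl hs hls
    omega
  · rw [Nat.factorization_eq_zero_of_not_dvd hln]; exact Nat.zero_le _

/-- Without primitive divisors, for two primes `p, q ∣ n`, the product is also divisible by
`B_n B_{n/pq}`. -/
theorem B_mul_B_dvd_of_no_primitive (hP : ¬ IsOfFinAddOrder P) {n p q : ℕ} (hn : n ≠ 0)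
    (h : ¬ HasPrimitiveDivisor (B P) n) (hp : p ∈ n.primeFactors) (hq : q ∈ n.primeFactors)
    (hpq : p ≠ q) :
    B P n * B P (n / (p * q)) ∣ n ^ 2 * ∏ s ∈ n.primeFactors, B P (n / s) := by
  have hprod : ∏ s ∈ n.primeFactors, B P (n / s) ≠ 0 :=
    Finset.prod_ne_zero_iff.2 fun _ _ => B_ne_zero _
  obtain ⟨hpp, hpn, -⟩ := Nat.mem_primeFactors.1 hp
  obtain ⟨hqp, hqn, -⟩ := Nat.mem_primeFactors.1 hq
  obtain ⟨t, rfl⟩ : p * q ∣ n := ((Nat.coprime_primes hpp hqp).2 hpq).mul_dvd_of_dvd_of_dvd hpn hqn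
  have ht : t ≠ 0 := by rintro rfl; simp at hn
  have e1 : p * q * t / (p * q) = t := Nat.mul_div_cancel_left _ (Nat.mul_pos hpp.pos hqp.pos)
  have e2 : p * q * t / p = t * q :=
    Nat.div_eq_of_eq_mul_right hpp.pos (by ring)
  have e3 : p * q * t / q = t * p :=
    Nat.div_eq_of_eq_mul_right hqp.pos (by ring)
  rw [e1, ← Nat.factorization_prime_le_iff_dvd (mul_ne_zero (B_ne_zero _) (B_ne_zero _))
    (mul_ne_zero (pow_ne_zero 2 hn) hprod)]
  intro l hl
  rw [Nat.factorization_mul (B_ne_zero _) (B_ne_zero _), Finsupp.add_apply]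
  -- If l ∣ B_t, the p-term of the product absorbs the valuation of B_n, up to n², and the q-term
  -- absorbs that of B_t. If l ∤ B_t, the previous divisibility suffices.
  by_cases hlt : l ∣ B P t
  · rw [Nat.factorization_mul (pow_ne_zero 2 hn) hprod, Finsupp.add_apply, factorization_prod_B]
    have d1 := B_dvd_B_mul hP ht hqp.ne_zero
    have d2 := B_dvd_B_mul hP ht hpp.ne_zero
    have h1 := factorization_B_le hP hn hl hp (by rw [e2]; exact hlt.trans d1)
    have h2 := (Nat.factorization_le_iff_dvd (B_ne_zero _) (B_ne_zero _)).2 d2 l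
    rw [← e3] at h2
    have h3 := Finset.sum_le_sum_of_subset (f := fun s => (B P (p * q * t / s)).factorization l)
      (show ({p, q} : Finset ℕ) ⊆ (p * q * t).primeFactors by
        intro x hx; simp at hx; rcases hx with rfl | rfl <;> assumption)
    rw [Finset.sum_pair hpq] at h3
    omega
  · rw [Nat.factorization_eq_zero_of_not_dvd hlt, add_zero]
    exact (Nat.factorization_le_iff_dvd (B_ne_zero _) (mul_ne_zero (pow_ne_zero 2 hn) hprod)).2
      (B_dvd_of_no_primitive hP hn h) l

end Divisibility

/-! ### Separation of x-coordinates of torsion points -/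

section RootSeparation

theorem exists_point_of_xCoord {c : ℂ} (hc : c ≠ 0) (x : ℂ) :
    ∃ T : (curve c).toAffine.Point, T ≠ 0 ∧ xCoord T = x := by
  obtain ⟨y, hy⟩ := IsAlgClosed.exists_pow_nat_eq (x ^ 3 + c * x) two_pos
  have hell : (curve c).IsElliptic := by
    refine ⟨IsUnit.mk0 _ ?_⟩
    have : (curve c).Δ = -64 * c ^ 3 := by
      simp only [WeierstrassCurve.Δ, WeierstrassCurve.b₂, WeierstrassCurve.b₄,
        WeierstrassCurve.b₆, WeierstrassCurve.b₈, curve]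
      ring
    rw [this]
    exact mul_ne_zero (by norm_num) (pow_ne_zero 3 hc)
  have h := WeierstrassCurve.Affine.equation_iff_nonsingular.1 ((curve_equation_iff x y).2 hy)
  exact ⟨.some x y h, nofun, rfl⟩

theorem exists_torsion_of_root {c : ℂ} (hc : c ≠ 0) (hI : ∀ n, AddSubIdentities c n) {k : ℕ}
    {x : ℂ} (hx : ((curve c).ΨSq k).eval x = 0) :
    ∃ T : (curve c).toAffine.Point, T ≠ 0 ∧ k • T = 0 ∧ xCoord T = x := by
  obtain ⟨T, hT, rfl⟩ := exists_point_of_xCoord hc x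
  exact ⟨T, hT, (nsmul_eq_zero_iff_eval_ΨSq hc hI hT k).2 hx, rfl⟩

/-- The set whose infimum is `rootSep k`. -/
def sepSet (k : ℕ) : Set ℝ :=
  {r : ℝ | ∃ T₁ T₂ : (curve (1 : ℂ)).toAffine.Point,
    T₁ ≠ 0 ∧ T₂ ≠ 0 ∧ k • T₁ = 0 ∧ k • T₂ = 0 ∧ T₁ ≠ T₂ ∧ T₁ ≠ -T₂ ∧
    (r = ‖xCoord T₁ - xCoord T₂‖ ∨
      (xCoord T₁ * xCoord T₂ ≠ 0 ∧ r = ‖(xCoord T₁)⁻¹ - (xCoord T₂)⁻¹‖))}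

theorem sepSet_pos {k : ℕ} {r : ℝ} (hr : r ∈ sepSet k) : 0 < r := by
  obtain ⟨T₁, T₂, h1, h2, -, -, h3, h4, h5⟩ := hr
  have hne : xCoord T₁ ≠ xCoord T₂ := fun h => by
    rcases (xCoord_eq_iff h1 h2).1 h with h | h
    exacts [h3 h, h4 h]
  rcases h5 with rfl | ⟨-, rfl⟩
  · exact norm_pos_iff.2 (sub_ne_zero.2 hne)
  · exact norm_pos_iff.2 (sub_ne_zero.2 fun h => hne (inv_injective h))

theorem rootSep_nonneg (k : ℕ) : 0 ≤ rootSep k := Real.sInf_nonneg fun _ h => (sepSet_pos h).le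

theorem rootSep_le {k : ℕ} {r : ℝ} (hr : r ∈ sepSet k) : rootSep k ≤ r :=
  csInf_le ⟨0, fun _ h => (sepSet_pos h).le⟩ hr

variable {c : ℂ}

/-- Torsion x-coordinates on E_1 are rescaled roots of ψ_k², hence finite in number. The infimum
defining `rootSep` is therefore a minimum, and positive once the set is nonempty; for an empty set
it is 0 by convention. -/
theorem sepSet_finite (hc : c ≠ 0) (hI : ∀ n, AddSubIdentities c n) {k : ℕ} (hk : k ≠ 0) :
    (sepSet k).Finite := by
  obtain ⟨u, hu⟩ := IsAlgClosed.exists_pow_nat_eq c four_pos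
  have hu0 : u ≠ 0 := by
    rintro rfl
    exact hc (by rw [← hu]; simp)
  have hΨ : (curve c).ΨSq k ≠ 0 := (curve c).ΨSq_ne_zero (by simpa using hk)
  set S : Finset ℂ := ((curve c).ΨSq k).roots.toFinset.image fun x => x / u ^ 2
  have hS : ∀ T : (curve (1 : ℂ)).toAffine.Point, T ≠ 0 → k • T = 0 → xCoord T ∈ S := by
    intro T hT hkT
    obtain ⟨Q, hQ, hkQ, hx⟩ := exists_scaled_torsion hu0 (by rw [mul_one, hu] : c = u ^ 4 * 1) hT hkT
    refine Finset.mem_image.2 ⟨xCoord Q, ?_, by rw [hx]; field_simp⟩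
    rw [Multiset.mem_toFinset, mem_roots hΨ]
    exact (nsmul_eq_zero_iff_eval_ΨSq hc hI hQ k).1 hkQ
  refine (((S ×ˢ S).image fun x => ‖x.1 - x.2‖) ∪
    ((S ×ˢ S).image fun x => ‖x.1⁻¹ - x.2⁻¹‖)).finite_toSet.subset ?_
  rintro r ⟨T₁, T₂, h1, h2, k1, k2, -, -, rfl | ⟨-, rfl⟩⟩
  · exact Finset.mem_coe.2 (Finset.mem_union_left _ (Finset.mem_image.2
      ⟨(xCoord T₁, xCoord T₂), Finset.mem_product.2 ⟨hS _ h1 k1, hS _ h2 k2⟩, rfl⟩))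
  · exact Finset.mem_coe.2 (Finset.mem_union_right _ (Finset.mem_image.2
      ⟨(xCoord T₁, xCoord T₂), Finset.mem_product.2 ⟨hS _ h1 k1, hS _ h2 k2⟩, rfl⟩))

/-- Scaling by u with u⁴ = 1/c carries E_c to E_1 and multiplies x by u², of modulus |c|^(−1/2).
Differences are multiplied by this factor, differences of inverses divided by it. -/
theorem exists_mem_sepSet (hc : c ≠ 0) (hI : ∀ n, AddSubIdentities c n) {k : ℕ} {x y : ℂ}
    (hx : ((curve c).ΨSq k).eval x = 0) (hy : ((curve c).ΨSq k).eval y = 0) (hxy : x ≠ y) :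
    ‖x - y‖ * ‖c‖ ^ (-(1 / 2) : ℝ) ∈ sepSet k ∧
      (x ≠ 0 → y ≠ 0 → ‖x⁻¹ - y⁻¹‖ / ‖c‖ ^ (-(1 / 2) : ℝ) ∈ sepSet k) := by
  obtain ⟨u, hu⟩ := IsAlgClosed.exists_pow_nat_eq c⁻¹ four_pos
  have hu0 : u ≠ 0 := by
    rintro rfl
    exact inv_ne_zero hc (by rw [← hu]; simp)
  have hnorm : ‖u ^ 2‖ = ‖c‖ ^ (-(1 / 2) : ℝ) := by
    have h1 : ‖u ^ 2‖ ^ 2 = ‖c‖⁻¹ := by rw [← norm_pow, ← pow_mul, show 2 * 2 = 4 from rfl, hu, norm_inv]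
    rw [Real.rpow_neg (norm_nonneg _), ← Real.sqrt_eq_rpow, ← Real.sqrt_inv, ← h1,
      Real.sqrt_sq (norm_nonneg _)]
  have key : ∀ {z : ℂ}, ((curve c).ΨSq k).eval z = 0 → ∃ T : (curve (1 : ℂ)).toAffine.Point,
      T ≠ 0 ∧ k • T = 0 ∧ xCoord T = u ^ 2 * z := by
    intro z hz
    obtain ⟨T, hT, hkT, rfl⟩ := exists_torsion_of_root hc hI hz
    exact exists_scaled_torsion hu0 (by rw [hu, inv_mul_cancel₀ hc]) hT hkT
  obtain ⟨T₁, h1, k1, e1⟩ := key hx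
  obtain ⟨T₂, h2, k2, e2⟩ := key hy
  have hu2 : u ^ 2 ≠ 0 := pow_ne_zero 2 hu0
  have hne : xCoord T₁ ≠ xCoord T₂ := by
    rw [e1, e2]
    exact fun h => hxy (mul_left_cancel₀ hu2 h)
  have hne1 : T₁ ≠ T₂ := fun h => hne (by rw [h])
  have hne2 : T₁ ≠ -T₂ := fun h => hne (by rw [h, xCoord_neg])
  refine ⟨⟨T₁, T₂, h1, h2, k1, k2, hne1, hne2, Or.inl ?_⟩, fun hx0 hy0 =>
    ⟨T₁, T₂, h1, h2, k1, k2, hne1, hne2, Or.inr ⟨?_, ?_⟩⟩⟩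
  · rw [e1, e2, ← mul_sub, norm_mul, hnorm, mul_comm]
  · rw [e1, e2]
    exact mul_ne_zero (mul_ne_zero hu2 hx0) (mul_ne_zero hu2 hy0)
  · rw [e1, e2, mul_inv, mul_inv, ← mul_sub, norm_mul, norm_inv, hnorm, div_eq_inv_mul]

theorem rootSep_pos (hc : c ≠ 0) (hI : ∀ n, AddSubIdentities c n) {k : ℕ} (hk : k ≠ 0) {x y : ℂ}
    (hx : ((curve c).ΨSq k).eval x = 0) (hy : ((curve c).ΨSq k).eval y = 0) (hxy : x ≠ y) :
    0 < rootSep k :=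
  sepSet_pos (Set.Nonempty.csInf_mem ⟨_, (exists_mem_sepSet hc hI hx hy hxy).1⟩
    (sepSet_finite hc hI hk))

/-- If `0` is a root then `k` is even and the points `(± i, 0)` are available. -/
theorem rootSep_le_two (hc : c ≠ 0) (hI : ∀ n, AddSubIdentities c n) {k : ℕ}
    (h0 : ((curve c).ΨSq k).eval 0 = 0) : rootSep k ≤ 2 := by
  have two_torsion : ∀ {b : ℂ} {T : (curve b).toAffine.Point}, T ≠ 0 → yCoord T = 0 →
      2 • T = 0 := fun hT hy => (two_nsmul_eq_zero_iff hT).2 hy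
  obtain ⟨T, hT, hkT, hx⟩ := exists_torsion_of_root hc hI h0
  have hy : yCoord T = 0 := by
    have := equation_coords hT
    rw [hx] at this
    simpa using this
  have heven : Even k := by
    by_contra hodd
    obtain ⟨j, rfl⟩ := Nat.not_even_iff_odd.1 hodd
    rw [add_nsmul, mul_comm, mul_smul, two_torsion hT hy, nsmul_zero, zero_add, one_nsmul] at hkT
    exact hT hkT
  obtain ⟨j, rfl⟩ := heven.two_dvd
  have key : ∀ z : ℂ, z ^ 2 = -1 → ∃ T : (curve (1 : ℂ)).toAffine.Point,
      T ≠ 0 ∧ (2 * j) • T = 0 ∧ xCoord T = z := by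
    intro z hz
    obtain ⟨T, hT, rfl⟩ := exists_point_of_xCoord one_ne_zero z
    refine ⟨T, hT, ?_, rfl⟩
    have hy : yCoord T = 0 := by
      have h := equation_coords hT
      rw [show xCoord T ^ 3 + 1 * xCoord T = xCoord T * (xCoord T ^ 2 + 1) by ring, hz] at h
      simpa using h
    rw [mul_comm, mul_smul, two_torsion hT hy, nsmul_zero]
  obtain ⟨T₁, h1, k1, e1⟩ := key Complex.I (by simp)
  obtain ⟨T₂, h2, k2, e2⟩ := key (-Complex.I) (by simp)
  have hne : xCoord T₁ ≠ xCoord T₂ := by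
    rw [e1, e2]
    intro h
    exact Complex.I_ne_zero (self_eq_neg.1 h)
  refine rootSep_le ⟨T₁, T₂, h1, h2, k1, k2, fun h => hne (by rw [h]),
    fun h => hne (by rw [h, xCoord_neg]), Or.inl ?_⟩
  rw [e1, e2, sub_neg_eq_add, ← two_mul]
  simp

end RootSeparation

/-! ### Lower bounds for ψ_k² away from its roots -/

section FarRoots

/-- Over ℂ the form is its leading coefficient, a nonzero integer, times the product of u − xv over
the roots x. -/
theorem pow_le_abs_homEval {p : ℤ[X]} (hp : p ≠ 0) {u v : ℤ} (hv : v ≠ 0) {r : ℝ} (hr : 0 ≤ r)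
    (h : ∀ x : ℂ, (p.map (Int.castRingHom ℂ)).eval x = 0 → r ≤ ‖(u : ℂ) - x * v‖) :
    r ^ p.natDegree ≤ |(homEval p u v : ℝ)| := by
  have hinj : Function.Injective (Int.castRingHom ℂ) := Int.cast_injective
  have hp0 : p.map (Int.castRingHom ℂ) ≠ 0 := (Polynomial.map_ne_zero_iff hinj).2 hp
  have hsplit := IsAlgClosed.splits (p.map (Int.castRingHom ℂ))
  have hvC : (v : ℂ) ≠ 0 := by exact_mod_cast hv
  have hdeg : (p.map (Int.castRingHom ℂ)).natDegree = p.natDegree :=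
    natDegree_map_eq_of_injective hinj p
  have hcard : (p.map (Int.castRingHom ℂ)).roots.card = p.natDegree := by
    rw [← hdeg]; exact hsplit.natDegree_eq_card_roots.symm
  have hlc : 1 ≤ ‖(p.map (Int.castRingHom ℂ)).leadingCoeff‖ := by
    rw [leadingCoeff_map_of_injective hinj, eq_intCast, Complex.norm_intCast]
    exact_mod_cast Int.one_le_abs (leadingCoeff_ne_zero.2 hp)
  have heq : (homEval p u v : ℂ) = (p.map (Int.castRingHom ℂ)).leadingCoeff *
      ((p.map (Int.castRingHom ℂ)).roots.map fun x => (u : ℂ) - x * v).prod := by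
    rw [homEval_eq_eval p u hv, hsplit.eval_eq_prod_roots, mul_assoc, ← hcard,
      ← Multiset.prod_replicate, ← Multiset.map_const', ← Multiset.prod_map_mul]
    congr 3
    funext x
    field_simp
  have hprod : ∀ s : Multiset ℂ, (∀ x ∈ s, r ≤ ‖(u : ℂ) - x * v‖) →
      r ^ s.card ≤ ‖(s.map fun x => (u : ℂ) - x * v).prod‖ := by
    intro s
    induction s using Multiset.induction_on with
    | empty => simp
    | cons x s ih =>
      intro hs
      rw [Multiset.card_cons, Multiset.map_cons, Multiset.prod_cons, norm_mul, pow_succ']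
      exact mul_le_mul (hs x (Multiset.mem_cons_self x s))
        (ih fun y hy => hs y (Multiset.mem_cons_of_mem hy)) (by positivity) (norm_nonneg _)
  have h1 := hprod _ fun x hx => h x ((mem_roots hp0).1 hx)
  rw [hcard] at h1
  rw [← Complex.norm_intCast, heq, norm_mul]
  exact h1.trans (le_mul_of_one_le_left (norm_nonneg _) hlc)

/-- Exchanging u and v replaces roots by their inverses; the root 0 has none and contributes the
power of u. -/
theorem homEval_eq_reverse (p : ℤ[X]) {u v : ℤ} (hu : u ≠ 0) (hv : v ≠ 0) :
    homEval p u v = u ^ p.natTrailingDegree * homEval p.reverse v u := by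
  have huC : (u : ℚ) ≠ 0 := by exact_mod_cast hu
  have hvC : (v : ℚ) ≠ 0 := by exact_mod_cast hv
  have e1 := homEval_eq_eval (K := ℚ) p u hv
  have e2 := homEval_eq_eval (K := ℚ) p.reverse v hu
  have hx : (u / v : ℚ) ≠ 0 := div_ne_zero huC hvC
  let : Invertible (u / v : ℚ) := invertibleOfNonzero hx
  have e3 := eval₂_reverse_mul_pow (Int.castRingHom ℚ) (u / v : ℚ) p
  rw [invOf_eq_inv, inv_div] at e3
  rw [eval_map] at e1 e2
  rw [← e3] at e1
  have hle := natTrailingDegree_le_natDegree p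
  have hpow : (u : ℚ) ^ p.natDegree =
      (u : ℚ) ^ p.natTrailingDegree * (u : ℚ) ^ p.reverse.natDegree := by
    rw [reverse_natDegree, ← pow_add, Nat.add_sub_cancel' hle]
  have : (homEval p u v : ℚ) = ((u ^ p.natTrailingDegree * homEval p.reverse v u : ℤ) : ℚ) := by
    push_cast
    rw [e1, e2, div_pow, mul_assoc, div_mul_cancel₀ _ (pow_ne_zero _ hvC), hpow]
    ring
  exact_mod_cast this

variable {a : ℤ} {k : ℕ}

theorem rpow_neg_half_le_one (ha : a ≠ 0) : |(a : ℝ)| ^ (-(1 / 2) : ℝ) ≤ 1 :=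
  Real.rpow_le_one_of_one_le_of_nonpos (by exact_mod_cast Int.one_le_abs ha) (by norm_num)

theorem rpow_neg_half_pos (ha : a ≠ 0) : 0 < |(a : ℝ)| ^ (-(1 / 2) : ℝ) :=
  Real.rpow_pos_of_pos (abs_pos.2 (by exact_mod_cast ha)) _

/-- On E_a root distances scale by |a|^(1/2) and those of inverses by |a|^(−1/2). As |a| ≥ 1, the
smaller factor serves both. -/
theorem two_mul_halfSep_le (ha : a ≠ 0) (hI : ∀ n, AddSubIdentities (a : ℂ) n) {x y : ℂ}
    (hx : ((curve (a : ℂ)).ΨSq k).eval x = 0) (hy : ((curve (a : ℂ)).ΨSq k).eval y = 0)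
    (hxy : x ≠ y) :
    2 * halfSep a k ≤ ‖x - y‖ ∧ (x ≠ 0 → y ≠ 0 → 2 * halfSep a k ≤ ‖x⁻¹ - y⁻¹‖) := by
  have h := exists_mem_sepSet (by exact_mod_cast ha) hI hx hy hxy
  rw [Complex.norm_intCast] at h
  have hτ := rpow_neg_half_pos ha
  have hτ1 := rpow_neg_half_le_one ha
  have e : 2 * halfSep a k = rootSep k * |(a : ℝ)| ^ (-(1 / 2) : ℝ) := by
    rw [halfSep]; ring
  rw [e]
  generalize |(a : ℝ)| ^ (-(1 / 2) : ℝ) = τ at *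
  refine ⟨?_, fun hx0 hy0 => ?_⟩
  · have h1 := rootSep_le h.1
    calc rootSep k * τ ≤ ‖x - y‖ * τ * τ := mul_le_mul_of_nonneg_right h1 hτ.le
      _ = ‖x - y‖ * (τ * τ) := by ring
      _ ≤ ‖x - y‖ := mul_le_of_le_one_right (norm_nonneg _) (mul_le_one₀ hτ1 hτ.le hτ1)
  · exact (le_div_iff₀ hτ).1 (rootSep_le (h.2 hx0 hy0))

theorem halfSep_nonneg (a : ℤ) (k : ℕ) : 0 ≤ halfSep a k := by
  have := rootSep_nonneg k
  unfold halfSep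
  positivity

theorem halfSep_le_one (ha : a ≠ 0) (hI : ∀ n, AddSubIdentities (a : ℂ) n)
    (h0 : ((curve (a : ℂ)).ΨSq k).eval 0 = 0) : halfSep a k ≤ 1 := by
  have h1 := rootSep_le_two (by exact_mod_cast ha) hI h0
  have := mul_le_mul h1 (rpow_neg_half_le_one ha) (rpow_neg_half_pos ha).le zero_le_two
  unfold halfSep
  linarith

theorem map_ΨSq_eq (a : ℤ) (k : ℕ) {f g : ℤ[X]} (hfg : (curve a).ΨSq k = f * g) :
    (curve (a : ℂ)).ΨSq k = f.map (Int.castRingHom ℂ) * g.map (Int.castRingHom ℂ) := by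
  rw [← Polynomial.map_mul, ← hfg, ← WeierstrassCurve.map_ΨSq, curve_map, eq_intCast]

theorem not_common_root {f g : ℤ[X]}
    (hcop : IsCoprime (f.map (Int.castRingHom ℚ)) (g.map (Int.castRingHom ℚ))) {x : ℂ}
    (hf : (f.map (Int.castRingHom ℂ)).eval x = 0) (hg : (g.map (Int.castRingHom ℂ)).eval x = 0) :
    False := by
  have h := hcop.map (mapRingHom (algebraMap ℚ ℂ))
  simp only [coe_mapRingHom, Polynomial.map_map,
    RingHom.ext_int ((algebraMap ℚ ℂ).comp (Int.castRingHom ℚ)) (Int.castRingHom ℂ)] at h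
  obtain ⟨p, q, hpq⟩ := h
  have := congrArg (eval x) hpq
  simp [hf, hg] at this

/-- The other factor is a nonzero integer, and r ≥ 1 allows lowering the exponent to the minimum. -/
theorem pow_le_abs_homEval_mul {f g : ℤ[X]} {u v : ℤ} {r : ℝ} (hr : 1 ≤ r)
    (hfr : r ^ f.natDegree ≤ |(homEval f u v : ℝ)|) (hg : homEval g u v ≠ 0) :
    r ^ min f.natDegree g.natDegree ≤ |(homEval f u v : ℝ)| * |(homEval g u v : ℝ)| := by
  have h1 : 1 ≤ |(homEval g u v : ℝ)| := by exact_mod_cast Int.one_le_abs hg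
  exact ((pow_le_pow_right₀ hr (min_le_left _ _)).trans hfr).trans
    (le_mul_of_one_le_right (abs_nonneg _) h1)

/-- If both values were small, u/v would lie within s of a root of f and of a root of g, which are
at least 2s apart. This works for |u| ≤ |v|; otherwise v/u and the inverse roots are used, so the
relevant denominator is always H. -/
theorem far_or_far (ha : a ≠ 0) (hI : ∀ n, AddSubIdentities (a : ℂ) n)
    {f g : ℤ[X]} (hfg : (curve a).ΨSq k = f * g)
    (hcop : IsCoprime (f.map (Int.castRingHom ℚ)) (g.map (Int.castRingHom ℚ)))
    (hf : f ≠ 0) (hg : g ≠ 0) {u v : ℤ} (hv : v ≠ 0) {H : ℝ} (hH : H = max |(u : ℝ)| |(v : ℝ)|) :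
    (halfSep a k * H) ^ f.natDegree ≤ |(homEval f u v : ℝ)| ∨
      (halfSep a k * H) ^ g.natDegree ≤ |(homEval g u v : ℝ)| := by
  have hΨ := map_ΨSq_eq a k hfg
  have hfΨ : ∀ x, (f.map (Int.castRingHom ℂ)).eval x = 0 →
      ((curve (a : ℂ)).ΨSq k).eval x = 0 := fun x h => by rw [hΨ, eval_mul, h, zero_mul]
  have hgΨ : ∀ x, (g.map (Int.castRingHom ℂ)).eval x = 0 →
      ((curve (a : ℂ)).ΨSq k).eval x = 0 := fun x h => by rw [hΨ, eval_mul, h, mul_zero]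
  have hs0 := halfSep_nonneg a k
  have hH0 : 0 ≤ H := hH ▸ (abs_nonneg _).trans (le_max_left _ _)
  have hr0 : 0 ≤ halfSep a k * H := mul_nonneg hs0 hH0
  by_contra! hcon
  rcases le_or_gt |(u : ℝ)| |(v : ℝ)| with huv | huv
  · rw [max_eq_right huv] at hH
    have near : ∀ {p : ℤ[X]}, p ≠ 0 → |(homEval p u v : ℝ)| < (halfSep a k * H) ^ p.natDegree →
        ∃ x : ℂ, (p.map (Int.castRingHom ℂ)).eval x = 0 ∧
          ‖(u : ℂ) - x * v‖ < halfSep a k * H := by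
      intro p hp h
      by_contra! hfar
      exact absurd (pow_le_abs_homEval hp hv hr0 hfar) (not_le.2 h)
    obtain ⟨x, hx, hx'⟩ := near hf hcon.1
    obtain ⟨y, hy, hy'⟩ := near hg hcon.2
    have hxy : x ≠ y := by
      rintro rfl
      exact not_common_root hcop hx hy
    have hsep := (two_mul_halfSep_le ha hI (hfΨ x hx) (hgΨ y hy) hxy).1
    have h1 : ‖x - y‖ * |(v : ℝ)| ≤ ‖(u : ℂ) - x * v‖ + ‖(u : ℂ) - y * v‖ := by
      rw [← Complex.norm_intCast, ← norm_mul, add_comm]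
      refine le_trans (le_of_eq ?_) (norm_sub_le _ _)
      congr 1
      ring
    have h2 := mul_le_mul_of_nonneg_right hsep hH0
    rw [← hH] at h1
    linarith
  · have hu : u ≠ 0 := by
      rintro rfl
      simp at huv
      exact absurd (abs_nonneg (v : ℝ)) (not_le.2 huv)
    rw [max_eq_left huv.le] at hH
    have near : ∀ {p : ℤ[X]}, p ≠ 0 → (∀ x, (p.map (Int.castRingHom ℂ)).eval x = 0 →
        ((curve (a : ℂ)).ΨSq k).eval x = 0) →
        |(homEval p u v : ℝ)| < (halfSep a k * H) ^ p.natDegree →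
        ∃ x : ℂ, x ≠ 0 ∧ (p.map (Int.castRingHom ℂ)).eval x⁻¹ = 0 ∧
          ‖(v : ℂ) - x * u‖ < halfSep a k * H := by
      intro p hp hpΨ h
      by_contra! hfar
      have hrev0 : p.reverse ≠ 0 := by rwa [Ne, reverse_eq_zero]
      refine absurd ?_ (not_le.2 h)
      rw [homEval_eq_reverse p hu hv]
      push_cast
      rw [abs_mul, abs_pow, ← hH]
      have hdeg : p.natDegree = p.natTrailingDegree + p.reverse.natDegree := by
        rw [reverse_natDegree, Nat.add_sub_cancel' (natTrailingDegree_le_natDegree p)]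
      rw [hdeg, pow_add]
      refine mul_le_mul ?_ (pow_le_abs_homEval hrev0 hu hr0 fun x hx => ?_) (by positivity)
        (by positivity)
      -- A root at 0 contributes |u| = H, which must exceed sH; this needs s ≤ 1, supplied by the
      -- torsion points (±i, 0).
      · by_cases hj : p.natTrailingDegree = 0
        · simp [hj]
        · have h0 : (p.map (Int.castRingHom ℂ)).eval 0 = 0 := by
            rw [← coeff_zero_eq_eval_zero, coeff_map,
              coeff_eq_zero_of_lt_natTrailingDegree (Nat.pos_of_ne_zero hj), map_zero]
          have := halfSep_le_one ha hI (hpΨ 0 h0)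
          gcongr
          exact mul_le_of_le_one_left hH0 this
      · have hx0 : x ≠ 0 := by
          rintro rfl
          rw [← coeff_zero_eq_eval_zero, coeff_map, coeff_zero_reverse, eq_intCast,
            Int.cast_eq_zero, leadingCoeff_eq_zero] at hx
          exact hp hx
        refine hfar x hx0 ?_
        let : Invertible (x⁻¹) := invertibleOfNonzero (inv_ne_zero hx0)
        have := eval₂_reverse_eq_zero_iff (Int.castRingHom ℂ) x⁻¹ p
        rw [invOf_eq_inv, inv_inv] at this
        rw [eval_map] at hx ⊢
        exact this.1 hx
    obtain ⟨x, hx0, hx, hx'⟩ := near hf hfΨ hcon.1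
    obtain ⟨y, hy0, hy, hy'⟩ := near hg hgΨ hcon.2
    have hxy : x⁻¹ ≠ y⁻¹ := by
      intro h
      exact not_common_root hcop hx (h ▸ hy)
    have hsep := (two_mul_halfSep_le ha hI (hfΨ _ hx) (hgΨ _ hy) hxy).2 (inv_ne_zero hx0)
      (inv_ne_zero hy0)
    rw [inv_inv, inv_inv] at hsep
    have h1 : ‖x - y‖ * |(u : ℝ)| ≤ ‖(v : ℂ) - x * u‖ + ‖(v : ℂ) - y * u‖ := by
      rw [← Complex.norm_intCast, ← norm_mul, add_comm]
      refine le_trans (le_of_eq ?_) (norm_sub_le _ _)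
      congr 1
      ring
    have h2 := mul_le_mul_of_nonneg_right hsep hH0
    rw [← hH] at h1
    linarith

/-- Lower bound for the value of `ψ_k²` at a rational point. -/
theorem halfSep_pow_le_abs_homEval (ha : a ≠ 0) (hI : ∀ n, AddSubIdentities (a : ℂ) n)
    (hk : k ≠ 0) {f g : ℤ[X]} (hfg : (curve a).ΨSq k = f * g)
    (hcop : IsCoprime (f.map (Int.castRingHom ℚ)) (g.map (Int.castRingHom ℚ)))
    {u v : ℤ} (hv : v ≠ 0) (h0 : homEval ((curve a).ΨSq k) u v ≠ 0)
    (h1 : 1 ≤ halfSep a k * max |(u : ℝ)| |(v : ℝ)|) :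
    (halfSep a k * max |(u : ℝ)| |(v : ℝ)|) ^ min f.natDegree g.natDegree ≤
      |(homEval ((curve a).ΨSq k) u v : ℝ)| := by
  have hΨ0 : (curve a).ΨSq k ≠ 0 := (curve a).ΨSq_ne_zero (by simpa using hk)
  rw [hfg] at hΨ0
  have hf := left_ne_zero_of_mul hΨ0
  have hg := right_ne_zero_of_mul hΨ0
  rw [hfg, homEval_mul hf hg] at h0 ⊢
  push_cast
  rw [abs_mul]
  rcases far_or_far ha hI hfg hcop hf hg hv rfl with h | h
  · exact pow_le_abs_homEval_mul h1 h (right_ne_zero_of_mul h0)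
  · rw [min_comm, mul_comm |(homEval f u v : ℝ)|]
    exact pow_le_abs_homEval_mul h1 h (left_ne_zero_of_mul h0)

/-- If both factors are non-constant then `K_k` is positive. -/
theorem halfSep_pos (ha : a ≠ 0) (hI : ∀ n, AddSubIdentities (a : ℂ) n) (hk : k ≠ 0)
    {f g : ℤ[X]} (hfg : (curve a).ΨSq k = f * g)
    (hcop : IsCoprime (f.map (Int.castRingHom ℚ)) (g.map (Int.castRingHom ℚ)))
    (hd : min f.natDegree g.natDegree ≠ 0) : 0 < halfSep a k := by
  have hΨ := map_ΨSq_eq a k hfg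
  have root : ∀ {p : ℤ[X]}, p.natDegree ≠ 0 →
      ∃ x : ℂ, (p.map (Int.castRingHom ℂ)).eval x = 0 := fun {p} hp => by
    refine IsAlgClosed.exists_root _ fun h => hp ?_
    rw [← natDegree_map_eq_of_injective (show Function.Injective
      (Int.castRingHom ℂ) from Int.cast_injective) p]
    exact natDegree_eq_zero_iff_degree_le_zero.2 h.le
  obtain ⟨x, hx⟩ := root (p := f) (by rintro h; simp [h] at hd)
  obtain ⟨y, hy⟩ := root (p := g) (by rintro h; simp [h] at hd)
  have hxy : x ≠ y := by
    rintro rfl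
    exact not_common_root hcop hx hy
  have := rootSep_pos (by exact_mod_cast ha) hI hk (by rw [hΨ, eval_mul, hx, zero_mul])
    (by rw [hΨ, eval_mul, hy, mul_zero]) hxy
  have := rpow_neg_half_pos ha
  unfold halfSep
  positivity

end FarRoots

/-! ### Upper and lower bounds for log B_n -/

section Bounds

variable {a : ℤ} {P : (curve (a : ℚ)).toAffine.Point}

theorem addSubIdentities_complex (hP : ¬ IsOfFinAddOrder P) (n : ℕ) :
    AddSubIdentities (a : ℂ) n := by
  simpa using (addSubIdentities_of_infinite hP n).map (algebraMap ℚ ℂ)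

theorem homEval_ΨSq_ne_zero (hP : ¬ IsOfFinAddOrder P) {m k : ℕ} (hm : m ≠ 0) (hk : k ≠ 0) :
    homEval ((curve a).ΨSq k) (A P m) (B P m) ≠ 0 := by
  have hB : (B P m : ℤ) ≠ 0 := by exact_mod_cast B_ne_zero m
  have h := (xCoord_nsmul_mul_eval_ΨSq (infinite_nsmul hP hm) hk).1
  have e1 := homEval_eq_eval (K := ℚ) ((curve a).ΨSq k) (A P m) hB
  rw [← WeierstrassCurve.map_ΨSq, curve_map, eq_intCast, ← xCoord_eq_div] at e1
  intro h0
  rw [h0, Int.cast_zero] at e1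
  have hB' : ((B P m : ℤ) : ℚ) ≠ 0 := by exact_mod_cast hB
  exact mul_ne_zero h (pow_ne_zero _ hB') e1.symm

/-- Since φ_k is monic, φ_k(A_m, B_m) is prime to B_m. Thus g_k is also the gcd of φ_k and B_m ψ_k²,
which is exactly what cancels in x(mkP). -/
theorem gk_mul (hP : ¬ IsOfFinAddOrder P) {m k : ℕ} (hm : m ≠ 0) (hk : k ≠ 0) :
    gk P k m * (A P (m * k)).natAbs = (homEval ((curve a).Φ k) (A P m) (B P m)).natAbs ∧
      gk P k m * B P (m * k) = B P m * (homEval ((curve a).ΨSq k) (A P m) (B P m)).natAbs := by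
  have h := A_mul_eq hP hm hk
  have hcop := isCoprime_A_B (P := P) (m * k)
  obtain ⟨c, hc⟩ : (B P (m * k) : ℤ) ∣ B P m * homEval ((curve a).ΨSq k) (A P m) (B P m) :=
    hcop.symm.dvd_of_dvd_mul_left ⟨_, h⟩
  have hc' : homEval ((curve a).Φ k) (A P m) (B P m) = A P (m * k) * c := by
    have hB : (B P (m * k) : ℤ) ≠ 0 := by exact_mod_cast B_ne_zero (m * k)
    apply mul_left_cancel₀ hB
    rw [← h, hc]; ring
  have hg : gk P k m = c.natAbs := by
    have h1 : Nat.Coprime (B P m) (homEval ((curve a).Φ k) (A P m) (B P m)).natAbs :=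
      Int.isCoprime_iff_gcd_eq_one.1 (isCoprime_homEval_Φ (P := P) m k).symm
    rw [gk, Int.gcd, ← h1.gcd_mul_left_cancel_right, ← Int.natAbs_natCast (B P m),
      ← Int.natAbs_mul, Int.natAbs_natCast, hc, hc']
    change Int.gcd _ _ = _
    rw [Int.gcd_mul_right, Int.isCoprime_iff_gcd_eq_one.1 hcop, one_mul]
  rw [hg, hc']
  refine ⟨by rw [Int.natAbs_mul, mul_comm], ?_⟩
  have := congrArg Int.natAbs hc
  rw [Int.natAbs_mul, Int.natAbs_mul, Int.natAbs_natCast, Int.natAbs_natCast] at this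
  rw [this, mul_comm]

theorem gk_pos (hP : ¬ IsOfFinAddOrder P) {m k : ℕ} (hm : m ≠ 0) (hk : k ≠ 0) : 0 < gk P k m :=
  Nat.pos_of_ne_zero fun h => homEval_ΨSq_ne_zero hP hm hk (Int.gcd_eq_zero_iff.1 h).2

theorem mulSize_nsmul (n : ℕ) : mulSize (n • P) = max |(A P n : ℝ)| |((B P n : ℤ) : ℝ)| := by
  rw [Int.cast_natCast, Nat.abs_cast]; rfl

theorem log_B_le (n : ℕ) : Real.log (B P n) ≤ naiveHeight (n • P) := by
  rw [naiveHeight_eq]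
  exact Real.log_le_log (by exact_mod_cast Nat.pos_of_ne_zero (B_ne_zero n)) (le_max_right _ _)

theorem exists_abs_homEval_le (p : ℤ[X]) : ∃ c : ℝ, 0 ≤ c ∧ ∀ u v : ℤ,
    |(homEval p u v : ℝ)| ≤ c * (max |(u : ℝ)| |(v : ℝ)|) ^ p.natDegree := by
  refine ⟨∑ i ∈ Finset.range (p.natDegree + 1), |(p.coeff i : ℝ)|,
    Finset.sum_nonneg fun _ _ => abs_nonneg _, fun u v => ?_⟩
  rw [homEval_eq_sum, Finset.sum_mul]
  push_cast
  refine (Finset.abs_sum_le_sum_abs _ _).trans (Finset.sum_le_sum fun i hi => ?_)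
  have hi' : i ≤ p.natDegree := by simpa [Nat.lt_succ_iff] using hi
  rw [abs_mul, abs_mul, abs_pow, abs_pow]
  refine mul_le_mul_of_nonneg_left ?_ (abs_nonneg _)
  calc |(u : ℝ)| ^ i * |(v : ℝ)| ^ (p.natDegree - i)
      ≤ (max |(u : ℝ)| |(v : ℝ)|) ^ i * (max |(u : ℝ)| |(v : ℝ)|) ^ (p.natDegree - i) := by
        gcongr
        · exact le_max_left _ _
        · exact le_max_right _ _
    _ = _ := by rw [← pow_add, Nat.add_sub_cancel' hi']

/-- The cancellation `g_k` is bounded independently of `m`. -/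
theorem exists_log_gk_le (ha : FourthPowerFree a) (hP : ¬ IsOfFinAddOrder P) {k : ℕ}
    (hk : k ≠ 0) : ∃ G : ℝ, ∀ m : ℕ, m ≠ 0 → Real.log (gk P k m) ≤ G := by
  obtain ⟨c₁, hc₁, b1⟩ := exists_abs_homEval_le ((curve a).Φ k)
  obtain ⟨c₂, hc₂, b2⟩ := exists_abs_homEval_le ((curve a).ΨSq k)
  refine ⟨Real.log (c₁ + c₂ + 1) + (k : ℝ) ^ 2 * (2 * heightConst a) + 2 * heightConst a,
    fun m hm => ?_⟩
  obtain ⟨h1, h2⟩ := gk_mul hP hm hk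
  have h1r : (gk P k m : ℝ) * |(A P (m * k) : ℝ)| =
      |(homEval ((curve a).Φ k) (A P m) (B P m) : ℝ)| := by
    have : ((gk P k m * (A P (m * k)).natAbs : ℕ) : ℝ) =
      ((homEval ((curve a).Φ k) (A P m) (B P m)).natAbs : ℕ) := by rw [h1]
    push_cast [Nat.cast_natAbs] at this
    exact this
  have h2r : (gk P k m : ℝ) * (B P (m * k) : ℝ) =
      B P m * |(homEval ((curve a).ΨSq k) (A P m) (B P m) : ℝ)| := by
    have : ((gk P k m * B P (m * k) : ℕ) : ℝ) =
      (B P m * (homEval ((curve a).ΨSq k) (A P m) (B P m)).natAbs : ℕ) := by rw [h2]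
    push_cast [Nat.cast_natAbs] at this
    exact this
  have b1 := b1 (A P m) (B P m)
  have b2 := b2 (A P m) (B P m)
  rw [WeierstrassCurve.natDegree_Φ, Int.natAbs_natCast, ← mulSize_nsmul] at b1
  rw [WeierstrassCurve.natDegree_ΨSq _ (by simpa using hk), Int.natAbs_natCast,
    ← mulSize_nsmul] at b2
  have hH := one_le_mulSize (m • P)
  have hBH : (B P m : ℝ) ≤ mulSize (m • P) := le_max_right _ _
  have hpow : mulSize (m • P) ^ k ^ 2 = mulSize (m • P) * mulSize (m • P) ^ (k ^ 2 - 1) := by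
    rw [← pow_succ', Nat.sub_add_cancel (Nat.one_le_iff_ne_zero.2 (by positivity))]
  have hg : (0 : ℝ) < gk P k m := by exact_mod_cast gk_pos hP hm hk
  -- Both heights have main term 2m²k²ĥ(P), so taking logarithms leaves only constants for log g_k.
  have hmax : (gk P k m : ℝ) * mulSize ((m * k) • P) ≤
      (c₁ + c₂ + 1) * mulSize (m • P) ^ k ^ 2 := by
    have hpos : 0 ≤ mulSize (m • P) ^ k ^ 2 := by positivity
    rw [mulSize, mul_max_of_nonneg _ _ hg.le]
    refine max_le ?_ ?_
    · refine (le_of_eq h1r).trans (b1.trans ?_)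
      exact mul_le_mul_of_nonneg_right (by linarith) hpos
    · refine (le_of_eq h2r).trans ?_
      calc (B P m : ℝ) * |(homEval ((curve a).ΨSq k) (A P m) (B P m) : ℝ)|
          ≤ mulSize (m • P) * (c₂ * mulSize (m • P) ^ (k ^ 2 - 1)) :=
            mul_le_mul hBH b2 (abs_nonneg _) (by linarith)
        _ = c₂ * mulSize (m • P) ^ k ^ 2 := by rw [hpow]; ring
        _ ≤ _ := mul_le_mul_of_nonneg_right (by linarith) hpos
  have hH' := one_le_mulSize ((m * k) • P)
  have hlog := Real.log_le_log (by positivity) hmax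
  rw [Real.log_mul hg.ne' (by positivity), Real.log_mul (by positivity) (by positivity),
    Real.log_pow, ← naiveHeight_eq, ← naiveHeight_eq] at hlog
  have t1 := (abs_le.1 (abs_naiveHeight_nsmul_sub_le ha hP (n := m * k) (mul_ne_zero hm hk))).1
  have t2 := (abs_le.1 (abs_naiveHeight_nsmul_sub_le ha hP hm)).2
  have t3 := mul_le_mul_of_nonneg_left t2 (sq_nonneg (k : ℝ))
  push_cast at hlog t1
  rw [mul_pow] at t1
  linarith

theorem heightConst_pos (ha : a ≠ 0) : 0 < heightConst a := by
  have : 0 ≤ Real.log |(a : ℝ)| := Real.log_nonneg (by exact_mod_cast Int.one_le_abs ha)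
  unfold heightConst
  linarith

theorem rho_nonneg (n : ℕ) : 0 ≤ rho n := Finset.sum_nonneg fun _ _ => by positivity

/-- Lower bound for `log B_{mk}`. -/
theorem le_log_gk_add_log_B (ha : FourthPowerFree a) (hP : ¬ IsOfFinAddOrder P) {k : ℕ}
    (hk : k ≠ 0) {f g : ℤ[X]} (hfg : (curve a).ΨSq k = f * g)
    (hcop : IsCoprime (f.map (Int.castRingHom ℚ)) (g.map (Int.castRingHom ℚ)))
    {d : ℕ} (hd : d = min f.natDegree g.natDegree) (hd0 : d ≠ 0) {m : ℕ} (hm : m ≠ 0)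
    (h : (-Real.log (halfSep a k) + 2 * heightConst a) / canonicalHeight P ≤ 2 * (m : ℝ) ^ 2) :
    d * (Real.log (halfSep a k) + 2 * (m : ℝ) ^ 2 * canonicalHeight P - 2 * heightConst a) ≤
      Real.log (gk P k m) + Real.log (B P (m * k)) := by
  have hI := addSubIdentities_complex hP
  have hs := halfSep_pos ha.ne_zero hI hk hfg hcop (hd ▸ hd0)
  rw [div_le_iff₀ (canonicalHeight_pos ha hP)] at h
  have hht := (abs_le.1 (abs_naiveHeight_nsmul_sub_le ha hP hm)).1
  have hB : (B P m : ℤ) ≠ 0 := by exact_mod_cast B_ne_zero m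
  have hH := one_le_mulSize (m • P)
  -- The size condition on m serves precisely to make sH ≥ 1.
  have h1 : 1 ≤ halfSep a k * mulSize (m • P) := by
    rw [← Real.log_nonneg_iff (by positivity), Real.log_mul hs.ne' (by positivity),
      ← naiveHeight_eq]
    linarith
  have hΨ0 := homEval_ΨSq_ne_zero hP hm hk
  have hfar := halfSep_pow_le_abs_homEval ha.ne_zero hI hk hfg hcop hB hΨ0
    (by rw [← mulSize_nsmul]; exact h1)
  rw [← mulSize_nsmul, ← hd] at hfar
  have hΨle : |(homEval ((curve a).ΨSq k) (A P m) (B P m) : ℝ)| ≤ gk P k m * B P (m * k) := by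
    have h2 := (gk_mul hP hm hk).2
    have : (homEval ((curve a).ΨSq k) (A P m) (B P m)).natAbs ≤ gk P k m * B P (m * k) :=
      h2 ▸ Nat.le_mul_of_pos_left _ (Nat.pos_of_ne_zero (B_ne_zero m))
    have h3 : (((homEval ((curve a).ΨSq k) (A P m) (B P m)).natAbs : ℕ) : ℝ) ≤
      ((gk P k m * B P (m * k) : ℕ) : ℝ) := by exact_mod_cast this
    push_cast [Nat.cast_natAbs] at h3
    exact h3
  have hlog := Real.log_le_log (by positivity) (hfar.trans hΨle)
  have hg : (gk P k m : ℝ) ≠ 0 := by exact_mod_cast (gk_pos hP hm hk).ne'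
  have hBn : (B P (m * k) : ℝ) ≠ 0 := by exact_mod_cast B_ne_zero (m * k)
  rw [Real.log_pow, Real.log_mul hs.ne' (by positivity), ← naiveHeight_eq,
    Real.log_mul hg hBn] at hlog
  refine le_trans ?_ hlog
  gcongr
  linarith

/-- Each factor satisfies log B_{n/p} ≤ 2(n/p)²ĥ(P) + 2C; summation over p produces ρ(n) and ω(n).
-/
theorem log_prod_B_le (ha : FourthPowerFree a) (hP : ¬ IsOfFinAddOrder P) {n : ℕ} (hn : n ≠ 0) :
    Real.log ((n ^ 2 * ∏ s ∈ n.primeFactors, B P (n / s) : ℕ) : ℝ) ≤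
      2 * Real.log n + 2 * (n : ℝ) ^ 2 * rho n * canonicalHeight P +
        2 * heightConst a * (ArithmeticFunction.cardDistinctFactors n : ℝ) := by
  have hnR : (n : ℝ) ≠ 0 := by exact_mod_cast hn
  have hBR : ∀ s ∈ n.primeFactors, (B P (n / s) : ℝ) ≠ 0 := fun s _ => by
    exact_mod_cast B_ne_zero _
  push_cast
  rw [Real.log_mul (by positivity) (Finset.prod_ne_zero_iff.2 hBR), Real.log_pow,
    Real.log_prod hBR, add_assoc]
  push_cast
  gcongr
  have hω : (ArithmeticFunction.cardDistinctFactors n : ℝ) = ∑ s ∈ n.primeFactors, (1 : ℝ) := by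
    rw [Finset.sum_const, nsmul_one]
    rfl
  rw [hω, rho, Finset.mul_sum, Finset.mul_sum, Finset.sum_mul, ← Finset.sum_add_distrib]
  refine Finset.sum_le_sum fun s hs => (log_B_le _).trans ?_
  obtain ⟨hsp, hsn, -⟩ := Nat.mem_primeFactors.1 hs
  have h0 : n / s ≠ 0 := (Nat.div_pos (Nat.le_of_dvd (Nat.pos_of_ne_zero hn) hsn) hsp.pos).ne'
  have := (abs_le.1 (abs_naiveHeight_nsmul_sub_le ha hP h0)).2
  rw [Nat.cast_div hsn (by exact_mod_cast hsp.ne_zero), div_pow] at this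
  rw [mul_one, mul_assoc 2, mul_one_div]
  rw [mul_assoc 2] at this ⊢
  linarith

theorem log_B_le_of_no_primitive (ha : FourthPowerFree a) (hP : ¬ IsOfFinAddOrder P) {n : ℕ}
    (hn : n ≠ 0) (h : ¬ HasPrimitiveDivisor (B P) n) :
    Real.log (B P n) ≤ 2 * Real.log n + 2 * (n : ℝ) ^ 2 * rho n * canonicalHeight P +
        2 * heightConst a * (ArithmeticFunction.cardDistinctFactors n : ℝ) := by
  refine le_trans ?_ (log_prod_B_le ha hP hn)
  refine Real.log_le_log (by exact_mod_cast Nat.pos_of_ne_zero (B_ne_zero n)) ?_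
  exact_mod_cast Nat.le_of_dvd (Nat.pos_of_ne_zero (mul_ne_zero (pow_ne_zero 2 hn)
    (Finset.prod_ne_zero_iff.2 fun _ _ => B_ne_zero _))) (B_dvd_of_no_primitive hP hn h)

theorem log_B_add_log_B_le_of_no_primitive (ha : FourthPowerFree a) (hP : ¬ IsOfFinAddOrder P)
    {n p q : ℕ} (hn : n ≠ 0) (h : ¬ HasPrimitiveDivisor (B P) n) (hp : p ∈ n.primeFactors)
    (hq : q ∈ n.primeFactors) (hpq : p ≠ q) :
    Real.log (B P n) + Real.log (B P (n / (p * q))) ≤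
      2 * Real.log n + 2 * (n : ℝ) ^ 2 * rho n * canonicalHeight P +
        2 * heightConst a * (ArithmeticFunction.cardDistinctFactors n : ℝ) := by
  refine le_trans ?_ (log_prod_B_le ha hP hn)
  have h1 : (0 : ℝ) < B P n := by exact_mod_cast Nat.pos_of_ne_zero (B_ne_zero n)
  have h2 : (0 : ℝ) < B P (n / (p * q)) := by
    exact_mod_cast Nat.pos_of_ne_zero (B_ne_zero (n / (p * q)))
  rw [← Real.log_mul h1.ne' h2.ne']
  refine Real.log_le_log (by positivity) ?_
  exact_mod_cast Nat.le_of_dvd (Nat.pos_of_ne_zero (mul_ne_zero (pow_ne_zero 2 hn)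
    (Finset.prod_ne_zero_iff.2 fun _ _ => B_ne_zero _)))
    (B_mul_B_dvd_of_no_primitive hP hn h hp hq hpq)

theorem cardDistinctFactors_mul_log_two_le {n : ℕ} (hn : n ≠ 0) :
    (ArithmeticFunction.cardDistinctFactors n : ℝ) * Real.log 2 ≤ Real.log n := by
  have h : 2 ^ n.primeFactors.card ≤ n :=
    (Finset.pow_card_le_prod _ _ _ fun p hp => (Nat.prime_of_mem_primeFactors hp).two_le).trans
      (Nat.le_of_dvd (Nat.pos_of_ne_zero hn) (Nat.prod_primeFactors_dvd n))
  have h2 : (2 : ℝ) ^ n.primeFactors.card ≤ n := by exact_mod_cast h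
  have h3 := Real.log_le_log (by positivity) h2
  rw [Real.log_pow] at h3
  exact h3

end Bounds

/-! ### How close ρ(mk) can come to its bound -/

section Gap

theorem rho_le_of_dvd {m n : ℕ} (hn : n ≠ 0) (h : m ∣ n) : rho m ≤ rho n :=
  Finset.sum_le_sum_of_subset_of_nonneg (Nat.primeFactors_mono h hn) fun _ _ _ => by positivity

theorem sum_inv_sq_le (s : Finset ℕ) {Y : ℕ} (hY : Y ≠ 0) (hs : ∀ p ∈ s, Y < p) :
    ∑ p ∈ s, 1 / (p : ℝ) ^ 2 ≤ 1 / (Y : ℝ) := by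
  obtain ⟨N, hN⟩ : ∃ N, ∀ p ∈ s, p ≤ N := ⟨s.sup id, fun p hp => Finset.le_sup (f := id) hp⟩
  rcases le_or_gt Y N with h | h
  · have h1 := sum_Ioc_inv_sq_le_sub (α := ℝ) hY h
    have h2 : ∑ p ∈ s, 1 / (p : ℝ) ^ 2 ≤ ∑ p ∈ Finset.Ioc Y N, 1 / (p : ℝ) ^ 2 :=
      Finset.sum_le_sum_of_subset_of_nonneg
        (fun p hp => Finset.mem_Ioc.2 ⟨hs p hp, hN p hp⟩) fun _ _ _ => by positivity
    simp only [one_div] at h2 ⊢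
    have : (0 : ℝ) ≤ (N : ℝ)⁻¹ := by positivity
    linarith
  · have : s = ∅ := Finset.eq_empty_of_forall_notMem fun p hp =>
      absurd (hs p hp) (by have := hN p hp; omega)
    subst this
    rw [Finset.sum_empty]
    positivity

theorem rho_le_add {n k : ℕ} {s : Finset ℕ}
    (h : n.primeFactors ⊆ k.primeFactors ∪ s) :
    rho n ≤ rho k + ∑ p ∈ s, 1 / (p : ℝ) ^ 2 := by
  refine (Finset.sum_le_sum_of_subset_of_nonneg h fun _ _ _ => by positivity).trans ?_
  rw [rho, ← Finset.sum_union_inter]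
  exact le_add_of_nonneg_right (Finset.sum_nonneg fun _ _ => by positivity)

theorem exists_pos_le_of_pos (f : ℕ → ℝ) (N : ℕ) :
    ∃ δ > 0, ∀ t < N, 0 < f t → δ ≤ f t := by
  induction N with
  | zero => exact ⟨1, one_pos, nofun⟩
  | succ N ih =>
    obtain ⟨δ, hδ, h⟩ := ih
    by_cases hN : 0 < f N
    · refine ⟨min δ (f N), lt_min hδ hN, fun t ht hft => ?_⟩
      rcases Nat.lt_succ_iff_lt_or_eq.1 ht with ht | rfl
      · exact (min_le_left _ _).trans (h t ht hft)
      · exact min_le_right _ _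
    · refine ⟨δ, hδ, fun t ht hft => ?_⟩
      rcases Nat.lt_succ_iff_lt_or_eq.1 ht with ht | rfl
      · exact h t ht hft
      · exact absurd hft hN

/-- The gap `α - ρ(kt)` stays away from zero for `t` prime or `1`. -/
theorem exists_gap_prime {k : ℕ} (hk : k ≠ 0) (α : ℝ) :
    ∃ δ > 0, ∀ t : ℕ, t = 1 ∨ t.Prime → rho (k * t) < α → δ ≤ α - rho (k * t) := by
  rcases le_or_gt α (rho k) with h | h
  · refine ⟨1, one_pos, fun t ht hlt => absurd (hlt.trans_le h) (not_lt.2 ?_)⟩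
    refine rho_le_of_dvd (mul_ne_zero hk ?_) (dvd_mul_right k t)
    rcases ht with rfl | ht
    exacts [one_ne_zero, ht.ne_zero]
  -- Beyond N the single term 1/t² uses at most half of α − ρ(k); below N only finitely many gaps
  -- occur.
  · obtain ⟨N, hN⟩ := exists_nat_gt (2 / (α - rho k))
    obtain ⟨δ, hδ, hδN⟩ := exists_pos_le_of_pos (fun t => α - rho (k * t)) N
    have he : 0 < α - rho k := sub_pos.2 h
    refine ⟨min δ ((α - rho k) / 2), lt_min hδ (by positivity), fun t ht hlt => ?_⟩
    rcases lt_or_ge t N with htN | htN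
    · exact (min_le_left _ _).trans (hδN t htN (sub_pos.2 hlt))
    · refine (min_le_right _ _).trans ?_
      have ht0 : 1 ≤ t := by
        rcases ht with rfl | ht
        exacts [le_rfl, ht.one_le]
      have ht1 : (1 : ℝ) ≤ t := by exact_mod_cast ht0
      have h1 : rho (k * t) ≤ rho k + ∑ p ∈ {t}, 1 / (p : ℝ) ^ 2 := by
        refine rho_le_add ?_
        rw [Nat.primeFactors_mul hk (by omega)]
        refine Finset.union_subset_union_right ?_
        rcases ht with rfl | ht
        · simp
        · rw [ht.primeFactors]
      rw [Finset.sum_singleton] at h1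
      have h2 : 2 / (α - rho k) < t := hN.trans_le (by exact_mod_cast htN)
      rw [div_lt_iff₀ he] at h2
      have h3 : 1 / (t : ℝ) ^ 2 ≤ (α - rho k) / 2 := by
        rw [div_le_div_iff₀ (by positivity) two_pos]
        nlinarith
      linarith

/-- Either the gap `α - ρ(mk)` is bounded below or `m` has two distinct bounded prime factors. -/
theorem exists_gap {k : ℕ} (hk : k ≠ 0) (α : ℝ) :
    ∃ δ > 0, ∃ Y : ℕ, ∀ m : ℕ, m ≠ 0 → rho (m * k) < α → δ ≤ α - rho (m * k) ∨
      ∃ p ∈ m.primeFactors, ∃ q ∈ m.primeFactors, p ≠ q ∧ p ≤ Y ∧ q ≤ Y := by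
  obtain ⟨δ, hδ, hgap⟩ := exists_gap_prime hk α
  -- All primes above Y together contribute at most 1/Y ≤ δ/2 to ρ.
  obtain ⟨Y, hY⟩ := exists_nat_gt (2 / δ)
  have hY0 : Y ≠ 0 := by
    rintro rfl
    have : 0 < 2 / δ := by positivity
    simp at hY
    linarith
  have hYδ : 1 / (Y : ℝ) ≤ δ / 2 := by
    rw [div_lt_iff₀ hδ] at hY
    rw [div_le_div_iff₀ (by positivity) two_pos]
    linarith
  refine ⟨δ / 2, by positivity, Y, fun m hm hlt => ?_⟩
  by_contra! hcon
  obtain ⟨hsmall, hpair⟩ := hcon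
  -- With no pair of small primes, t is the only prime factor of m up to Y, or 1 if there is none.
  obtain ⟨t, ht, htm, hcov⟩ : ∃ t : ℕ, (t = 1 ∨ t.Prime) ∧ t ∣ m ∧
      ∀ p ∈ m.primeFactors, p ≤ Y → p = t := by
    by_cases h : ∃ t ∈ m.primeFactors, t ≤ Y
    · obtain ⟨t, ht, htY⟩ := h
      obtain ⟨h1, h2, -⟩ := Nat.mem_primeFactors.1 ht
      refine ⟨t, Or.inr h1, h2, fun p hp hpY => ?_⟩
      by_contra hne
      exact absurd (hpair p hp t ht hne hpY) (not_lt.2 htY)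
    · push Not at h
      exact ⟨1, Or.inl rfl, one_dvd m, fun p hp hpY => absurd (h p hp) (not_lt.2 hpY)⟩
  have ht0 : t ≠ 0 := by
    rcases ht with rfl | ht
    exacts [one_ne_zero, ht.ne_zero]
  have h1 : rho (k * t) ≤ rho (m * k) :=
    rho_le_of_dvd (mul_ne_zero hm hk) (mul_comm m k ▸ mul_dvd_mul_left k htm)
  have h2 := hgap t ht (h1.trans_lt hlt)
  have h3 : rho (m * k) ≤ rho (k * t) +
      ∑ p ∈ m.primeFactors.filter (Y < ·), 1 / (p : ℝ) ^ 2 := by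
    refine rho_le_add fun p hp => ?_
    rw [Nat.primeFactors_mul hm hk, Finset.mem_union] at hp
    rw [Nat.primeFactors_mul hk ht0, Finset.mem_union, Finset.mem_union, Finset.mem_filter]
    rcases hp with hp | hp
    · by_cases hpY : p ≤ Y
      · obtain rfl := hcov p hp hpY
        rcases ht with h | h
        · exact absurd (Nat.prime_of_mem_primeFactors hp) (h ▸ Nat.not_prime_one)
        · exact Or.inl (Or.inr (by rw [h.primeFactors]; exact Finset.mem_singleton_self _))
      · exact Or.inr ⟨hp, not_le.1 hpY⟩
    · exact Or.inl (Or.inl hp)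
  have h4 := sum_inv_sq_le (m.primeFactors.filter (Y < ·)) hY0 fun p hp =>
    (Finset.mem_filter.1 hp).2
  linarith

end Gap

/-! ### Conclusion: the three claims -/

section Main

variable {a : ℤ} {P : (curve (a : ℚ)).toAffine.Point}

/-- The arithmetic error terms are `O(log n)`. -/
theorem error_le (ha : a ≠ 0) {n : ℕ} (hn : n ≠ 0) :
    2 * Real.log n + 2 * heightConst a * (ArithmeticFunction.cardDistinctFactors n : ℝ) ≤
      (2 + 2 * heightConst a / Real.log 2) * Real.log n := by
  have h := cardDistinctFactors_mul_log_two_le hn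
  have h2 : 0 < Real.log 2 := Real.log_pos one_lt_two
  have hC := heightConst_pos ha
  rw [← le_div_iff₀ h2] at h
  have := mul_le_mul_of_nonneg_left h (by positivity : 0 ≤ 2 * heightConst a)
  calc _ ≤ 2 * Real.log n + 2 * heightConst a * (Real.log n / Real.log 2) := by linarith
    _ = _ := by ring

/-- Only log(mk) and ω(mk) ≤ log(mk)/log 2 depend unboundedly on m, as log g_k is bounded. -/
theorem boundNumerator_isBigO (ha : FourthPowerFree a) (hP : ¬ IsOfFinAddOrder P) {k : ℕ}
    (hk : k ≠ 0) (d : ℕ) :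
    (fun m : ℕ => boundNumerator P d k m) =O[atTop] (fun m : ℕ => Real.log m) := by
  obtain ⟨G, hG⟩ := exists_log_gk_le ha hP hk
  have hC := heightConst_pos ha.ne_zero
  set c₀ := -(d * Real.log (halfSep a k)) + 2 * d * heightConst a with hc₀
  set κ := 2 + 2 * heightConst a / Real.log 2
  have hκ : 0 ≤ κ := by
    have : 0 < Real.log 2 := Real.log_pos one_lt_two
    positivity
  have hlk : 0 ≤ Real.log k := Real.log_natCast_nonneg k
  refine Asymptotics.IsBigO.of_bound (|G| + |c₀| + κ * Real.log k + κ) ?_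
  filter_upwards [eventually_ge_atTop 1,
    (Real.tendsto_log_atTop.comp tendsto_natCast_atTop_atTop).eventually_ge_atTop 1] with m hm hlm
  have hm0 : m ≠ 0 := by omega
  have hmk : m * k ≠ 0 := mul_ne_zero hm0 hk
  simp only [Function.comp_apply] at hlm
  have h1 := error_le ha.ne_zero hmk
  have h2 : 0 ≤ Real.log (gk P k m) := Real.log_natCast_nonneg _
  have h3 : 0 ≤ (ArithmeticFunction.cardDistinctFactors (m * k) : ℝ) := Nat.cast_nonneg _
  have h4 : 0 ≤ Real.log ((m * k : ℕ) : ℝ) := Real.log_natCast_nonneg _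
  have h5 : Real.log ((m * k : ℕ) : ℝ) = Real.log m + Real.log k := by
    push_cast
    exact Real.log_mul (by exact_mod_cast hm0) (by exact_mod_cast hk)
  have h6 : 0 ≤ 2 * heightConst a * (ArithmeticFunction.cardDistinctFactors (m * k) : ℝ) := by
    positivity
  have heq : boundNumerator P d k m = Real.log (gk P k m) + c₀ +
      (2 * Real.log ((m * k : ℕ) : ℝ) +
        2 * heightConst a * (ArithmeticFunction.cardDistinctFactors (m * k) : ℝ)) := by
    rw [boundNumerator, hc₀]
    push_cast
    ring
  rw [heq, Real.norm_eq_abs, Real.norm_eq_abs, abs_of_pos (by linarith : 0 < Real.log m)]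
  have h7 : |Real.log (gk P k m) + c₀ + (2 * Real.log ((m * k : ℕ) : ℝ) +
      2 * heightConst a * (ArithmeticFunction.cardDistinctFactors (m * k) : ℝ))| ≤
      |G| + |c₀| + κ * (Real.log m + Real.log k) := by
    refine (abs_add_le _ _).trans (add_le_add ((abs_add_le _ _).trans (add_le_add ?_ le_rfl)) ?_)
    · rw [abs_of_nonneg h2]
      exact (hG m hm0).trans (le_abs_self G)
    · rw [abs_of_nonneg (by linarith), ← h5]
      exact h1
  refine h7.trans ?_
  have h8 : 0 ≤ |G| + |c₀| + κ * Real.log k := by positivity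
  nlinarith

variable {k : ℕ} {f g : ℤ[X]} {d : ℕ}

theorem pos_of_mul_rho_lt {k n d : ℕ} (h : (k : ℝ) ^ 2 * rho n < d) : d ≠ 0 := by
  rintro rfl
  have := mul_nonneg (sq_nonneg (k : ℝ)) (rho_nonneg n)
  rw [Nat.cast_zero] at h
  linarith

theorem bound_of_no_primitive (ha : FourthPowerFree a) (hP : ¬ IsOfFinAddOrder P)
    (hk : k ≠ 0) (hfg : (curve a).ΨSq k = f * g)
    (hcop : IsCoprime (f.map (Int.castRingHom ℚ)) (g.map (Int.castRingHom ℚ)))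
    (hd : d = min f.natDegree g.natDegree) {m : ℕ} (hm : m ≠ 0)
    (hprim : ¬ HasPrimitiveDivisor (B P) (m * k)) (hρ : (k : ℝ) ^ 2 * rho (m * k) < d)
    (h : (-Real.log (halfSep a k) + 2 * heightConst a) / canonicalHeight P ≤ 2 * (m : ℝ) ^ 2) :
    2 * ((m : ℝ) * k) ^ 2 ≤
        boundNumerator P d k m / ((d / (k : ℝ) ^ 2 - rho (m * k)) * canonicalHeight P) := by
  have h1 := le_log_gk_add_log_B ha hP hk hfg hcop hd (pos_of_mul_rho_lt hρ) hm h
  have h2 := log_B_le_of_no_primitive ha hP (mul_ne_zero hm hk) hprim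
  have hk2 : (0 : ℝ) < (k : ℝ) ^ 2 := by positivity
  have hgap : 0 < d / (k : ℝ) ^ 2 - rho (m * k) := by
    rw [sub_pos, lt_div_iff₀ hk2]
    linarith
  rw [le_div_iff₀ (mul_pos hgap (canonicalHeight_pos ha hP)), boundNumerator]
  have e : 2 * ((m : ℝ) * k) ^ 2 * ((d / (k : ℝ) ^ 2 - rho (m * k)) * canonicalHeight P) =
      d * (2 * (m : ℝ) ^ 2 * canonicalHeight P) -
        2 * ((m : ℝ) * k) ^ 2 * rho (m * k) * canonicalHeight P := by
    field_simp
  rw [e]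
  push_cast at h2
  linarith

/-- Without a primitive divisor, a quantity of order m² would be at most E·m. The quadratic term
comes from the gap when it is at least δ, and otherwise from B_{n/(pq)}. -/
theorem exists_forall_hasPrimitiveDivisor (ha : FourthPowerFree a) (hP : ¬ IsOfFinAddOrder P)
    (hk : k ≠ 0) (hfg : (curve a).ΨSq k = f * g)
    (hcop : IsCoprime (f.map (Int.castRingHom ℚ)) (g.map (Int.castRingHom ℚ)))
    (hd : d = min f.natDegree g.natDegree) :
    ∃ M : ℕ, ∀ m : ℕ, M ≤ m → (k : ℝ) ^ 2 * rho (m * k) < d →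
      HasPrimitiveDivisor (B P) (m * k) := by
  by_cases hd0 : d = 0
  · exact ⟨0, fun m _ h => absurd hd0 (pos_of_mul_rho_lt h)⟩
  obtain ⟨G, hG⟩ := exists_log_gk_le ha hP hk
  obtain ⟨δ, hδ, Y, hgap⟩ := exists_gap hk ((d : ℝ) / (k : ℝ) ^ 2)
  have hC := heightConst_pos ha.ne_zero
  have hh := canonicalHeight_pos ha hP
  have hk2 : (0 : ℝ) < (k : ℝ) ^ 2 := by positivity
  have hdpos : (0 : ℝ) < d := by exact_mod_cast Nat.pos_of_ne_zero hd0
  set h := canonicalHeight P with hhdef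
  set t := (-Real.log (halfSep a k) + 2 * heightConst a) / h with ht
  set κ := 2 + 2 * heightConst a / Real.log 2 with hκdef
  have hκ : 0 ≤ κ := by
    have : 0 < Real.log 2 := Real.log_pos one_lt_two
    positivity
  set c₀ := d * (Real.log (halfSep a k) - 2 * heightConst a) with hc₀
  -- The constants are doubled because the second case uses the lower bound at both m and m/(pq).
  set E := κ * k + 2 * (|G| + |c₀|) with hE
  have hcast := tendsto_natCast_atTop_atTop (R := ℝ)
  -- The bounds on m with t serve the size condition at m and at m' = m/(pq) ≥ m/Y²; those with E
  -- contradict the final inequality in each case.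
  have hev : ∀ᶠ m : ℕ in atTop, 1 ≤ m ∧ t ≤ m ∧ E / (2 * h * (k : ℝ) ^ 2 * δ) < m ∧
      (Y : ℝ) ^ 2 * t ≤ m ∧ E * (Y : ℝ) ^ 4 / (2 * d * h) < m :=
    (eventually_ge_atTop 1).and ((hcast.eventually_ge_atTop _).and
      ((hcast.eventually_gt_atTop _).and
        ((hcast.eventually_ge_atTop _).and (hcast.eventually_gt_atTop _))))
  obtain ⟨M, hM⟩ := eventually_atTop.1 hev
  refine ⟨M, fun m hm hρ => ?_⟩
  obtain ⟨hm1, hmt, hmA, hmY, hmB⟩ := hM m hm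
  by_contra hprim
  have hm0 : m ≠ 0 := by omega
  have hm1R : (1 : ℝ) ≤ m := by exact_mod_cast hm1
  have hn := mul_ne_zero hm0 hk
  have sq_ge : ∀ {x : ℝ}, 1 ≤ x → t ≤ x → t ≤ 2 * x ^ 2 := fun h1 h2 => by nlinarith
  have lower := le_log_gk_add_log_B ha hP hk hfg hcop hd hd0 hm0 (sq_ge hm1R hmt)
  rw [← hhdef] at lower
  have herr : 2 * Real.log ((m * k : ℕ) : ℝ) +
      2 * heightConst a * (ArithmeticFunction.cardDistinctFactors (m * k) : ℝ) ≤ κ * k * m := by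
    refine (error_le ha.ne_zero hn).trans ?_
    have := Real.log_le_self (Nat.cast_nonneg (α := ℝ) (m * k))
    have := mul_le_mul_of_nonneg_left this hκ
    push_cast at this ⊢
    linarith
  have hGm := hG m hm0
  have hcc : |G| + |c₀| ≤ (|G| + |c₀|) * m := le_mul_of_one_le_right (by positivity) hm1R
  have hS : 0 ≤ |G| + |c₀| := by positivity
  have l1 := le_abs_self G
  have l2 := neg_abs_le c₀
  have hρ' : rho (m * k) < (d : ℝ) / (k : ℝ) ^ 2 := by
    rw [lt_div_iff₀ hk2]; linarith
  rcases hgap m hm0 hρ' with hlarge | ⟨p, hp, q, hq, hpq, hpY, hqY⟩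
  · have upper := log_B_le_of_no_primitive ha hP hn hprim
    rw [← hhdef] at upper
    have key : 2 * h * (k : ℝ) ^ 2 * (m : ℝ) ^ 2 * δ ≤ E * m := by
      have h1 : 2 * h * (k : ℝ) ^ 2 * (m : ℝ) ^ 2 * δ ≤
          2 * h * (k : ℝ) ^ 2 * (m : ℝ) ^ 2 * (d / (k : ℝ) ^ 2 - rho (m * k)) := by gcongr
      have h2 : 2 * h * (k : ℝ) ^ 2 * (m : ℝ) ^ 2 * (d / (k : ℝ) ^ 2 - rho (m * k)) =
          d * (2 * (m : ℝ) ^ 2 * h) - 2 * ((m : ℝ) * k) ^ 2 * rho (m * k) * h := by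
        field_simp
      push_cast at upper herr
      rw [hE]
      linarith
    rw [div_lt_iff₀ (by positivity)] at hmA
    have := mul_lt_mul_of_pos_right hmA (by linarith : (0 : ℝ) < m)
    linarith
  · obtain ⟨hpp, hpm, -⟩ := Nat.mem_primeFactors.1 hp
    obtain ⟨hqp, hqm, -⟩ := Nat.mem_primeFactors.1 hq
    have hsub : m.primeFactors ⊆ (m * k).primeFactors :=
      Nat.primeFactors_mono (dvd_mul_right m k) hn
    have upper := log_B_add_log_B_le_of_no_primitive ha hP hn hprim (hsub hp) (hsub hq) hpq
    obtain ⟨m', rfl⟩ : p * q ∣ m :=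
      ((Nat.coprime_primes hpp hqp).2 hpq).mul_dvd_of_dvd_of_dvd hpm hqm
    have hm'0 : m' ≠ 0 := by rintro rfl; simp at hm0
    have e : p * q * m' * k / (p * q) = m' * k := by
      rw [mul_assoc]
      exact Nat.mul_div_cancel_left _ (Nat.mul_pos hpp.pos hqp.pos)
    rw [e, ← hhdef] at upper
    have hpqY : ((p * q : ℕ) : ℝ) ≤ (Y : ℝ) ^ 2 := by
      rw [sq]; exact_mod_cast Nat.mul_le_mul hpY hqY
    have hm'1 : (1 : ℝ) ≤ m' := by exact_mod_cast Nat.one_le_iff_ne_zero.2 hm'0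
    have hmm' : ((p * q * m' : ℕ) : ℝ) ≤ (Y : ℝ) ^ 2 * m' := by
      push_cast at hpqY ⊢
      exact mul_le_mul_of_nonneg_right hpqY (by positivity)
    have hY0 : (0 : ℝ) < (Y : ℝ) ^ 2 := by
      have : 0 < Y := hpp.pos.trans_le hpY
      positivity
    have hm't : t ≤ m' := le_of_mul_le_mul_left (hmY.trans hmm') hY0
    have lower' := le_log_gk_add_log_B ha hP hk hfg hcop hd hd0 hm'0 (sq_ge hm'1 hm't)
    rw [← hhdef] at lower'
    have hGm' := hG m' hm'0
    -- Only ρ(mk) < d/k² is used here: the main terms at m cancel, and the term 2dm'²ĥ(P) from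
    -- B_{m'k} remains.
    have hd' : 2 * ((p * q * m' * k : ℕ) : ℝ) ^ 2 * rho (p * q * m' * k) * h ≤
        d * (2 * ((p * q * m' : ℕ) : ℝ) ^ 2 * h) := by
      have h0 : 0 ≤ 2 * ((p * q * m' : ℕ) : ℝ) ^ 2 * h := by positivity
      have := mul_le_mul_of_nonneg_left hρ.le h0
      push_cast at this ⊢
      linarith
    generalize hmdef : ((p * q * m' : ℕ) : ℝ) = x at *
    have key : d * (2 * (m' : ℝ) ^ 2 * h) ≤ E * x := by
      rw [hE]
      linarith
    have hx2 : x ^ 2 ≤ (Y : ℝ) ^ 4 * (m' : ℝ) ^ 2 := by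
      have := pow_le_pow_left₀ (by linarith) hmm' 2
      linarith [show ((Y : ℝ) ^ 2 * m') ^ 2 = (Y : ℝ) ^ 4 * (m' : ℝ) ^ 2 by ring]
    rw [div_lt_iff₀ (by positivity)] at hmB
    have h1 : 2 * d * h * x ^ 2 ≤ E * (Y : ℝ) ^ 4 * x := by
      calc 2 * d * h * x ^ 2 ≤ 2 * d * h * ((Y : ℝ) ^ 4 * (m' : ℝ) ^ 2) := by gcongr
        _ = (Y : ℝ) ^ 4 * (d * (2 * (m' : ℝ) ^ 2 * h)) := by ring
        _ ≤ (Y : ℝ) ^ 4 * (E * x) := by gcongr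
        _ = _ := by ring
    have := mul_lt_mul_of_pos_right hmB (by linarith : 0 < x)
    linarith

end Main

end EllDiv

open EllDiv Polynomial Filter
theorem mainTheorem6 (a : ℤ) (ha : FourthPowerFree a)
    (P : (curve (a : ℚ)).toAffine.Point) (hP : ¬ IsOfFinAddOrder P)
    (k : ℕ) (hk : 2 ≤ k) (f g : ℤ[X]) (hfg : (curve a).ΨSq k = f * g)
    (hcop : IsCoprime (f.map (Int.castRingHom ℚ)) (g.map (Int.castRingHom ℚ)))
    (d : ℕ) (hd : d = min f.natDegree g.natDegree) :
    (∀ m : ℕ, 1 ≤ m → ¬ HasPrimitiveDivisor (B P) (m * k) →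
      (k : ℝ) ^ 2 * rho (m * k) < d →
      (-Real.log (halfSep a k) + 2 * heightConst a) / canonicalHeight P ≤ 2 * (m : ℝ) ^ 2 →
      2 * ((m : ℝ) * k) ^ 2 ≤
        boundNumerator P d k m / ((d / (k : ℝ) ^ 2 - rho (m * k)) * canonicalHeight P)) ∧
    (fun m : ℕ => boundNumerator P d k m) =O[atTop] (fun m : ℕ => Real.log m) ∧
    (∃ M : ℕ, ∀ m : ℕ, M ≤ m → (k : ℝ) ^ 2 * rho (m * k) < d →
      HasPrimitiveDivisor (B P) (m * k)) := by
  have hk0 : k ≠ 0 := by omega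
  exact ⟨fun m hm hprim hρ h =>
      bound_of_no_primitive ha hP hk0 hfg hcop hd (by omega) hprim hρ h,
    boundNumerator_isBigO ha hP hk0 d,
    exists_forall_hasPrimitiveDivisor ha hP hk0 hfg hcop hd⟩
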